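/- **Theorem 5.** Let $(X_j,\varepsilon_j)_{j\ge 1}$ be i.i.d. copies of $(X,\varepsilon)\in\mathbb R^p\times\mathbb R$, where $X$ and $\varepsilon$ are independent, $E\varepsilon=0$, $EX=0$ and $E\|X\|^2<\infty$. Let $\Theta\subset\mathbb R^d$ be compact and convex, let $\theta_0$ be an interior point of $\Theta$, let $\ell:\mathbb R^p\to\mathbb R$ be measurable, and let $g(x,\theta)$ be a real function that is Borel in $x$ for each $\theta\in\Theta$ and twice continuously differentiable in $\theta\in\Theta$ for each $x$, with gradient $\dot g$ and Hessian $\ddot g$ in $\theta$. For a real sequence $(\delta_n)$ consider the local alternative models $$Y^{(n)}=g(X,\theta_0)+\delta_n\ell(X)+\varepsilon ,\qquad y_j=g(X_j,\theta_0)+\delta_n\ell(X_j)+\varepsilon_j\quad(1\le j\le n),$$ and the null model $Y^{(0)}=g(X,\theta_0)+\varepsilon$. Assume: * for $Y=Y^{(0)}$ and for $Y=Y^{(n)}$, $n\ge1$: $EY^2<\infty$, and $\sup_{\theta\in\Theta}g^2$, $\sup_{\theta\in\Theta}\|\dot g\dot g^\top\|$, $\sup_{\theta\in\Theta}\|(Y-g)^2\dot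 g\dot g^\top\|$ and $\sup_{\theta\in\Theta}\|(Y-g)^2\ddot g\|$, evaluated at $(X,\theta)$, have finite expectation; * $\theta_0$ is the unique minimizer over $\Theta$ of $\theta\mapsto E\{Y^{(0)}-g(X,\theta)\}^2$; * $G=E[\dot g\dot g^\top]$ is nonsingular, where $\dot g=\dot g(X,\theta_0)$; * $\tilde M=\int\tilde m(t)\tilde m^{H}(t)\,dF_\varepsilon(t)\neq0$, where $F_\varepsilon$ is the distribution of $\varepsilon$ and $\tilde m(t)=E(it\,e^{it\varepsilon}X\ell(X))-E(it\,X\dot g^\top e^{it\varepsilon})\,G^{-1}E(\dot g\,\ell(X))$. Let $\hat\theta_n$ be a (measurable) minimizer over $\Theta$ of $\sum_{j\le n}[y_j-g(X_j,\theta)]^2$. Put $\hat\eta_j=y_j-g(X_j,\hat\theta_n)$, $\hat m_n(t)=\frac1n\sum_{j\le n}X_je^{it\hat\eta_j}$ and $\hat M_n=\frac1n\sum_{k\le n}\hat m_n(\hat\eta_k)\hat m_n^{H}(\hat\eta_k)$. Let $\hat\lambda_1\ge\dots\ge\hat\lambda_p\ge0$ be the eigenvalues of $\hat M_n$, and $\hat\lambda_j=0$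 for $j>p$. For ridges $c_{1n},c_{2n}$ that are positive for all large $n$ and a threshold $\tau\in(0,1)$ put $$\hat s_j=\frac{\hat\lambda_j}{\hat\lambda_j+1},\qquad \hat s_j^*=\frac{\hat s_j^2+c_{1n}}{\hat s_{j+1}^2+c_{1n}}-1,\qquad \hat r_j=\frac{\hat s_{j+1}^*+c_{2n}}{\hat s_j^*+c_{2n}},$$ and let the estimated indicative dimension $\hat q$ be the largest $j\in\{1,\dots,p\}$ with $\hat r_j\le\tau$, and $\hat q=0$ if there is none. Then: 1. If $\delta_n=n^{-1/2}$ for $n\ge1$, $c_{1n}\to0$, $c_{2n}\to0$ and $n^2c_{1n}c_{2n}\to\infty$, then $P(\hat q=0)\to1$. 2. If $\delta_n=n^{-\alpha}$ for $n\ge1$, for some $0<\alpha<1/2$, $c_{1n}=o(\delta_n^4)$, $c_{2n}\to0$, $nc_{1n}c_{2n}/\delta_n^2\to\infty$ and $c_{1n}c_{2n}/\delta_n^6\to\infty$, and if, in the case $p\ge2$, moreover $E\|X\|^4<\infty$ and $E|\varepsilon|^3<\infty$, then $P(\hat q=1)\to1$. -/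

import Mathlib

open MeasureTheory ProbabilityTheory Filter Topology Asymptotics
open scoped ENNReal

noncomputable section

namespace HybridTest

/-! ### The estimated target matrix and its eigenvalues

A sample of size `n` is indexed by `j = 0, …, n - 1`. -/

/-- `m̂_n(t) = n⁻¹ ∑_j x_j exp(i t e_j)`, for covariates `x_j` and residuals `e_j`. -/
def mHat {p : ℕ} (n : ℕ) (x : ℕ → EuclideanSpace ℝ (Fin p)) (e : ℕ → ℝ) (t : ℝ) :
    Fin p → ℂ :=
  fun i => (n : ℂ)⁻¹ * ∑ j ∈ Finset.range n, (x j i : ℂ) * Complex.exp (Complex.I * t * e j)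

/-- `M̂_n = n⁻¹ ∑_k m̂_n(e_k) m̂_n(e_k)ᴴ`. -/
def MHat {p : ℕ} (n : ℕ) (x : ℕ → EuclideanSpace ℝ (Fin p)) (e : ℕ → ℝ) :
    Matrix (Fin p) (Fin p) ℂ :=
  fun a b => (n : ℂ)⁻¹ * ∑ k ∈ Finset.range n, mHat n x e (e k) a * star (mHat n x e (e k) b)

theorem MHat_isHermitian {p : ℕ} (n : ℕ) (x : ℕ → EuclideanSpace ℝ (Fin p)) (e : ℕ → ℝ) :
    (MHat n x e).IsHermitian := by
  ext a b
  simp [MHat, Matrix.conjTranspose_apply, mul_comm]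

/-- The `j`-th largest eigenvalue of a Hermitian `p × p` matrix for `1 ≤ j ≤ p`
(counted with multiplicity), and `0` for every other index. -/
def orderedEigenvalue {p : ℕ} {A : Matrix (Fin p) (Fin p) ℂ} (hA : A.IsHermitian) (j : ℕ) : ℝ :=
  if h : 1 ≤ j ∧ j ≤ p then
    hA.eigenvalues₀ ⟨j - 1, by rw [Fintype.card_fin]; omega⟩
  else 0

/-! ### The thresholding double ridge ratio criterion -/

/-- `ŝ_j = λ̂_j / (λ̂_j + 1)`. -/
def sHat (lam : ℕ → ℝ) (j : ℕ) : ℝ := lam j / (lam j + 1)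

/-- `ŝ*_j = (ŝ_j² + c₁) / (ŝ_{j+1}² + c₁) - 1`. -/
def sStar (lam : ℕ → ℝ) (c₁ : ℝ) (j : ℕ) : ℝ :=
  (sHat lam j ^ 2 + c₁) / (sHat lam (j + 1) ^ 2 + c₁) - 1

/-- `r̂_j = (ŝ*_{j+1} + c₂) / (ŝ*_j + c₂)`. -/
def ratio (lam : ℕ → ℝ) (c₁ c₂ : ℝ) (j : ℕ) : ℝ :=
  (sStar lam c₁ (j + 1) + c₂) / (sStar lam c₁ j + c₂)

open Classical in
/-- The largest `j ∈ {1, …, p}` with `r̂_j ≤ τ`, and `0` if `r̂_j > τ` for all of them. -/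
def tdrr (p : ℕ) (lam : ℕ → ℝ) (c₁ c₂ τ : ℝ) : ℕ :=
  ((Finset.Icc 1 p).filter fun j => ratio lam c₁ c₂ j ≤ τ).sup id

/-- The estimated indicative dimension `q̂` computed from covariates `x_j`, residuals `e_j`,
ridges `c₁, c₂` and threshold `τ`. -/
def qHat {p : ℕ} (n : ℕ) (x : ℕ → EuclideanSpace ℝ (Fin p)) (e : ℕ → ℝ) (c₁ c₂ τ : ℝ) : ℕ :=
  tdrr p (orderedEigenvalue (MHat_isHermitian n x e)) c₁ c₂ τ

/-! ### The regression model -/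

/-- `θ` is a least squares estimate over `Θ`: it minimizes `∑_{j<n} (y_j - g(x_j, θ))²`. -/
def IsLeastSquares {p d : ℕ} (g : EuclideanSpace ℝ (Fin p) → EuclideanSpace ℝ (Fin d) → ℝ)
    (Θ : Set (EuclideanSpace ℝ (Fin d))) (n : ℕ) (x : ℕ → EuclideanSpace ℝ (Fin p)) (y : ℕ → ℝ)
    (θ : EuclideanSpace ℝ (Fin d)) : Prop :=
  θ ∈ Θ ∧ ∀ θ' ∈ Θ, ∑ j ∈ Finset.range n, (y j - g (x j) θ) ^ 2
    ≤ ∑ j ∈ Finset.range n, (y j - g (x j) θ') ^ 2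

/-- The response `g(x, θ₀) + δ ℓ(x) + e` of the local alternative model. -/
def response {p d : ℕ} (g : EuclideanSpace ℝ (Fin p) → EuclideanSpace ℝ (Fin d) → ℝ)
    (ℓ : EuclideanSpace ℝ (Fin p) → ℝ) (θ₀ : EuclideanSpace ℝ (Fin d)) (δ : ℝ)
    (x : EuclideanSpace ℝ (Fin p)) (e : ℝ) : ℝ :=
  g x θ₀ + δ * ℓ x + e

/-- `ġ(x, θ)`, the gradient of `g(x, ·)` on the parameter space `Θ`. -/
def gdot {p d : ℕ} (g : EuclideanSpace ℝ (Fin p) → EuclideanSpace ℝ (Fin d) → ℝ)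
    (Θ : Set (EuclideanSpace ℝ (Fin d))) (x : EuclideanSpace ℝ (Fin p))
    (θ : EuclideanSpace ℝ (Fin d)) : EuclideanSpace ℝ (Fin d) :=
  gradientWithin (g x) Θ θ

/-- `∂²g(x, θ)/∂θ∂θᵀ`, the Hessian of `g(x, ·)` on `Θ`, as a linear map. -/
def gddot {p d : ℕ} (g : EuclideanSpace ℝ (Fin p) → EuclideanSpace ℝ (Fin d) → ℝ)
    (Θ : Set (EuclideanSpace ℝ (Fin d))) (x : EuclideanSpace ℝ (Fin p))
    (θ : EuclideanSpace ℝ (Fin d)) : EuclideanSpace ℝ (Fin d) →L[ℝ] EuclideanSpace ℝ (Fin d) :=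
  fderivWithin ℝ (gdot g Θ x) Θ θ

section Population

variable {Ω : Type*} [MeasurableSpace Ω] {p d : ℕ}

/-- `G = E[ġ(X, θ₀) ġ(X, θ₀)ᵀ]`. -/
def gramMatrix (P : Measure Ω) (X : Ω → EuclideanSpace ℝ (Fin p))
    (g : EuclideanSpace ℝ (Fin p) → EuclideanSpace ℝ (Fin d) → ℝ)
    (Θ : Set (EuclideanSpace ℝ (Fin d))) (θ₀ : EuclideanSpace ℝ (Fin d)) :
    Matrix (Fin d) (Fin d) ℝ :=
  fun a b => ∫ ω, gdot g Θ (X ω) θ₀ a * gdot g Θ (X ω) θ₀ b ∂P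

/-- `E[ġ(X, θ₀) ℓ(X)]`. -/
def gradEll (P : Measure Ω) (X : Ω → EuclideanSpace ℝ (Fin p))
    (g : EuclideanSpace ℝ (Fin p) → EuclideanSpace ℝ (Fin d) → ℝ)
    (ℓ : EuclideanSpace ℝ (Fin p) → ℝ)
    (Θ : Set (EuclideanSpace ℝ (Fin d))) (θ₀ : EuclideanSpace ℝ (Fin d)) : Fin d → ℝ :=
  fun a => ∫ ω, gdot g Θ (X ω) θ₀ a * ℓ (X ω) ∂P

/-- `m̃(t) = E(i t exp(itε) X ℓ) - E(i t X ġᵀ exp(itε)) G⁻¹ E(ġ ℓ)`. -/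
def mTilde (P : Measure Ω) (X : Ω → EuclideanSpace ℝ (Fin p)) (ε : Ω → ℝ)
    (g : EuclideanSpace ℝ (Fin p) → EuclideanSpace ℝ (Fin d) → ℝ)
    (ℓ : EuclideanSpace ℝ (Fin p) → ℝ)
    (Θ : Set (EuclideanSpace ℝ (Fin d))) (θ₀ : EuclideanSpace ℝ (Fin d)) (t : ℝ) :
    Fin p → ℂ :=
  fun i =>
    (∫ ω, Complex.I * t * Complex.exp (Complex.I * t * ε ω) * (X ω i : ℂ) * (ℓ (X ω) : ℂ) ∂P)
    - ∑ a, (∫ ω, Complex.I * t * (X ω i : ℂ) * (gdot g Θ (X ω) θ₀ a : ℂ)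
          * Complex.exp (Complex.I * t * ε ω) ∂P)
        * (((gramMatrix P X g Θ θ₀)⁻¹.mulVec (gradEll P X g ℓ Θ θ₀) a : ℝ) : ℂ)

/-- `M̃ = ∫ m̃(t) m̃(t)ᴴ dF_ε(t)`. -/
def MTilde (P : Measure Ω) (X : Ω → EuclideanSpace ℝ (Fin p)) (ε : Ω → ℝ)
    (g : EuclideanSpace ℝ (Fin p) → EuclideanSpace ℝ (Fin d) → ℝ)
    (ℓ : EuclideanSpace ℝ (Fin p) → ℝ)
    (Θ : Set (EuclideanSpace ℝ (Fin d))) (θ₀ : EuclideanSpace ℝ (Fin d)) :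
    Matrix (Fin p) (Fin p) ℂ :=
  fun i j => ∫ t, mTilde P X ε g ℓ Θ θ₀ t i * star (mTilde P X ε g ℓ Θ θ₀ t j) ∂(P.map ε)

/-- The moment conditions on a pair `(X, Y)`: `E Y² < ∞`, and the suprema over `Θ` of
`g²`, `‖ġ ġᵀ‖ = ‖ġ‖²`, `‖(Y - g)² ġ ġᵀ‖` and `‖(Y - g)² g̈‖` have finite expectation. -/
structure MomentConditions (P : Measure Ω) (X : Ω → EuclideanSpace ℝ (Fin p)) (Y : Ω → ℝ)
    (g : EuclideanSpace ℝ (Fin p) → EuclideanSpace ℝ (Fin d) → ℝ)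
    (Θ : Set (EuclideanSpace ℝ (Fin d))) : Prop where
  response_sq : MemLp Y 2 P
  sup_g : ∫⁻ ω, ⨆ θ ∈ Θ, ENNReal.ofReal (g (X ω) θ ^ 2) ∂P < ∞
  sup_grad : ∫⁻ ω, ⨆ θ ∈ Θ, ENNReal.ofReal (‖gdot g Θ (X ω) θ‖ ^ 2) ∂P < ∞
  sup_res_grad : ∫⁻ ω, ⨆ θ ∈ Θ,
    ENNReal.ofReal ((Y ω - g (X ω) θ) ^ 2 * ‖gdot g Θ (X ω) θ‖ ^ 2) ∂P < ∞
  sup_res_hess : ∫⁻ ω, ⨆ θ ∈ Θ,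
    ENNReal.ofReal ((Y ω - g (X ω) θ) ^ 2 * ‖gddot g Θ (X ω) θ‖) ∂P < ∞

/-- The regularity conditions for the sequence of local alternative models
`Y = g(X, θ₀) + δ_n ℓ(X) + ε`, `n ≥ 1`, around the null model `Y = g(X, θ₀) + ε`.
The pairs `(X_j, ε_j)`, `j = 0, 1, …`, are i.i.d. copies of `(X, ε)`. -/
structure RegularityConditions (P : Measure Ω) (X : ℕ → Ω → EuclideanSpace ℝ (Fin p))
    (ε : ℕ → Ω → ℝ) (g : EuclideanSpace ℝ (Fin p) → EuclideanSpace ℝ (Fin d) → ℝ)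
    (ℓ : EuclideanSpace ℝ (Fin p) → ℝ)
    (Θ : Set (EuclideanSpace ℝ (Fin d))) (θ₀ : EuclideanSpace ℝ (Fin d)) (δ : ℕ → ℝ) : Prop where
  measurable_X : ∀ j, Measurable (X j)
  measurable_err : ∀ j, Measurable (ε j)
  measurable_ell : Measurable ℓ
  indep : iIndepFun (fun j ω => (X j ω, ε j ω)) P
  identDistrib : ∀ j, IdentDistrib (fun ω => (X j ω, ε j ω)) (fun ω => (X 0 ω, ε 0 ω)) P P
  -- the error is centred and independent of the covariate
  indep_err : IndepFun (X 0) (ε 0) P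
  mean_err : ∫ ω, ε 0 ω ∂P = 0
  -- the covariate is centred with finite covariance matrix
  X_sq : MemLp (X 0) 2 P
  mean_X : ∫ ω, X 0 ω ∂P = 0
  -- parameter space and regression function
  compact_param : IsCompact Θ
  convex_param : Convex ℝ Θ
  measurable_g : ∀ θ ∈ Θ, Measurable fun x => g x θ
  contDiff_g : ∀ x, ContDiffOn ℝ 2 (g x) Θ
  -- moment conditions under the null model and under each local alternative
  moments_null : MomentConditions P (X 0)
    (fun ω => response g ℓ θ₀ 0 (X 0 ω) (ε 0 ω)) g Θ
  moments_local : ∀ n, 1 ≤ n → MomentConditions P (X 0)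
    (fun ω => response g ℓ θ₀ (δ n) (X 0 ω) (ε 0 ω)) g Θ
  -- under the null model the least squares criterion has the unique minimizer `θ₀`, in the interior
  interior_param : θ₀ ∈ interior Θ
  unique_min : ∀ θ ∈ Θ, θ ≠ θ₀ →
    ∫ ω, (response g ℓ θ₀ 0 (X 0 ω) (ε 0 ω) - g (X 0 ω) θ₀) ^ 2 ∂P
      < ∫ ω, (response g ℓ θ₀ 0 (X 0 ω) (ε 0 ω) - g (X 0 ω) θ) ^ 2 ∂P
  gram_nonsingular : IsUnit (gramMatrix P (X 0) g Θ θ₀)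
  target_ne_zero : MTilde P (X 0) (ε 0) g ℓ Θ θ₀ ≠ 0

/-- The estimated indicative dimension for the sample
`(X_j, g(X_j, θ₀) + δ ℓ(X_j) + ε_j)`, `j < n`, with residuals
`η̂_j = y_j - g(x_j, θ)` formed at the parameter estimate `θ`. -/
def qHatLocal (n : ℕ) (X : ℕ → Ω → EuclideanSpace ℝ (Fin p))
    (ε : ℕ → Ω → ℝ) (g : EuclideanSpace ℝ (Fin p) → EuclideanSpace ℝ (Fin d) → ℝ)
    (ℓ : EuclideanSpace ℝ (Fin p) → ℝ) (θ₀ : EuclideanSpace ℝ (Fin d)) (δ : ℝ)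
    (θ : Ω → EuclideanSpace ℝ (Fin d)) (c₁ c₂ τ : ℝ) (ω : Ω) : ℕ :=
  qHat n (fun j => X j ω)
    (fun j => response g ℓ θ₀ δ (X j ω) (ε j ω) - g (X j ω) (θ ω)) c₁ c₂ τ

end Population

end HybridTest

end

/-!
Write `e_j` for the residuals at the least squares estimate. The argument separates what happens to
the eigenvalues of `M̂_n` from what happens to the least squares estimate.

**Residuals.** Let `θ_n` minimize the population criterion `E (Y - g(X, θ))²` of the local
alternative model of size `δ_n`. The first order condition at `θ_n` linearizes to
`(θ_n - θ₀) / δ_n → G⁻¹ E(ġ ℓ)` (`RegressionConditions.tendsto_minimizer_div`). The empirical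
criterion is uniformly convex near `θ₀` with probability tending to one, and its score at `θ_n` is an
average of centred i.i.d. variables, so `θ̂_n - θ_n = O_P(n^{-1/2})`
(`RegressionConditions.bddInProb_norm_sub_sq`). Hence `e_j` is `ε_j + D_n(X_j)` up to
`O_P(n^{-1/2})` times a square integrable function of `X_j`, where the deterministic drift `D_n` is
of order `δ_n` and `D_n / δ_n → ℓ - ġᵀ G⁻¹ E(ġ ℓ)` pointwise
(`RegressionConditions.exists_drift`). Centring at `θ_n` instead of `θ₀` keeps all conditions at
second moments.

**Eigenvalues.** Let `μ_n(t) = E X exp(it(ε + D_n(X)))` be the population version of `m̂_n(t)`. The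
real and imaginary parts of `m̂_n - μ_n`, evaluated at the residuals, are averages of degenerate
kernels, whence `n⁻¹ ∑_k ‖m̂_n(e_k) - μ_n(ε_k + D_n(X_k))‖² = O_P(1/n)`
(`ResidualConditions.bddInProb_mHat_sub`). Because `X` is centred and independent of `ε`, the vector
`μ_n(t)` is `i t E(exp(itε)) E(X D_n(X))` up to a Taylor remainder. Therefore

* `λ̂₁ ≤ tr M̂_n = O_P(1/n + δ_n²)`, which is `O_P(1/n)` if `δ_n = n^{-1/2}`
  (`bddInProb_sampleEigenvalue_one`);
* `λ̂₁ ≥ c δ_n²` with probability tending to one if `n δ_n² → ∞`, since `M̃ ≠ 0`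
  (`exists_le_sampleEigenvalue_one`);
* `λ̂₂ = O_P(1/n + δ_n³)` (`bddInProb_sampleEigenvalue_two`): the second eigenvalue of an average of
  outer products is at most the mean squared distance of the vectors from any line, and the linear
  part of `μ_n` runs along the fixed vector `E(X D_n(X))`. The remainder is estimated by
  `|exp(ia) - 1 - ia| ≤ 2 |a|^{3/2}`, which requires only a third moment of `ε`.

The criterion is then evaluated at eigenvalues of these orders: `r̂_j` exceeds `τ` when `λ̂_j²` is
negligible against `c₁ c₂`, and `r̂_1 ≤ τ` when `λ̂₁²` dominates `c₁` while `λ̂₂²` is negligible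
(`tdrr_eq_zero`, `tdrr_eq_one`).

Uniformity in the size of the alternative comes from the moment conditions at the sizes `0` and
`δ₁ = 1`: the residual is affine in the size, so these two dominate all sizes in between. They also
give a dominating function for `g̈` itself, because the error is independent of `X` and not degenerate
(`RegularityConditions.ae_norm_gddot_le`).
-/

namespace HybridTest

/-! ### The ridge ratio criterion for a given eigenvalue sequence -/

section Criterion

variable {lam : ℕ → ℝ} {c₁ c₂ τ κ : ℝ}

lemma sHat_nonneg (h : ∀ j, 0 ≤ lam j) (j : ℕ) : 0 ≤ sHat lam j :=
  div_nonneg (h j) (by linarith [h j])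

lemma sHat_le (h : ∀ j, 0 ≤ lam j) (j : ℕ) : sHat lam j ≤ lam j :=
  div_le_self (h j) (by linarith [h j])

lemma div_add_one_le_div_add_one {a b : ℝ} (ha : 0 ≤ a) (hab : a ≤ b) :
    a / (a + 1) ≤ b / (b + 1) := by
  rw [div_le_div_iff₀ (by linarith) (by linarith)]
  nlinarith

lemma sStar_eq (h₁ : 0 < c₁) (j : ℕ) :
    sStar lam c₁ j = (sHat lam j ^ 2 - sHat lam (j + 1) ^ 2) / (sHat lam (j + 1) ^ 2 + c₁) := by
  have : sHat lam (j + 1) ^ 2 + c₁ ≠ 0 := by positivity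
  unfold sStar
  field_simp
  ring

lemma sStar_nonneg (h : ∀ j, 0 ≤ lam j) (h₁ : 0 < c₁) {j : ℕ} (hj : lam (j + 1) ≤ lam j) :
    0 ≤ sStar lam c₁ j := by
  rw [sStar_eq h₁]
  have := div_add_one_le_div_add_one (h _) hj
  have h0 := sHat_nonneg h (j + 1)
  refine div_nonneg (sub_nonneg.2 ?_) (by positivity)
  exact pow_le_pow_left₀ h0 this 2

lemma sStar_le (h : ∀ j, 0 ≤ lam j) (h₁ : 0 < c₁) (j : ℕ) :
    sStar lam c₁ j ≤ lam j ^ 2 / c₁ := by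
  rw [sStar_eq h₁]
  have h0 := pow_le_pow_left₀ (sHat_nonneg h j) (sHat_le h j) 2
  rw [div_le_div_iff₀ (by positivity) h₁]
  nlinarith [mul_nonneg (sq_nonneg (lam j)) (sq_nonneg (sHat lam (j + 1))),
    mul_nonneg h₁.le (sq_nonneg (sHat lam (j + 1)))]

/-- Where the eigenvalue is negligible against the ridges, the ratio is close to `1` or larger. -/
lemma lt_ratio (h : ∀ j, 0 ≤ lam j) (h₁ : 0 < c₁) (h₂ : 0 < c₂) (hτ : 0 < τ)
    (hκ : τ * (1 + κ) < 1) {j : ℕ} (hj : lam (j + 1) ≤ lam j) (hj' : lam (j + 2) ≤ lam (j + 1))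
    (hl : lam j ^ 2 ≤ κ * (c₁ * c₂)) : τ < ratio lam c₁ c₂ j := by
  have ha := sStar_nonneg h h₁ hj
  have hb := sStar_nonneg h h₁ hj'
  have hc : sStar lam c₁ j ≤ κ * c₂ := (sStar_le h h₁ j).trans (by
    rw [div_le_iff₀ h₁]; linarith)
  unfold ratio
  rw [lt_div_iff₀ (by linarith)]
  nlinarith

/-- If all eigenvalues are negligible against the ridges, no ratio falls below the threshold. -/
lemma tdrr_eq_zero (p : ℕ) (h : ∀ j, 0 ≤ lam j) (hanti : ∀ j, 1 ≤ j → lam (j + 1) ≤ lam j)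
    (h₁ : 0 < c₁) (h₂ : 0 < c₂) (hτ : 0 < τ) (hκ : τ * (1 + κ) < 1)
    (hl : lam 1 ^ 2 ≤ κ * (c₁ * c₂)) : tdrr p lam c₁ c₂ τ = 0 := by
  have hle : ∀ j, 1 ≤ j → lam j ≤ lam 1 := fun j hj => by
    induction j, hj using Nat.le_induction with
    | base => rfl
    | succ j hj ih => exact (hanti j hj).trans ih
  unfold tdrr
  rw [Finset.filter_false_of_mem]
  · rfl
  intro j hj
  rw [Finset.mem_Icc] at hj
  refine not_le.2 (lt_ratio h h₁ h₂ hτ hκ (hanti _ hj.1) (hanti _ (by omega)) (le_trans ?_ hl))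
  exact pow_le_pow_left₀ (h j) (hle j hj.1) 2

/-- One dominant eigenvalue, the others being negligible against the ridges. -/
lemma tdrr_eq_one {p : ℕ} (hp : 1 ≤ p) (h : ∀ j, 0 ≤ lam j)
    (hanti : ∀ j, 1 ≤ j → lam (j + 1) ≤ lam j)
    (h₁ : 0 < c₁) (h₂ : 0 < c₂) (hc₂ : c₂ ≤ 1) (hτ : 0 < τ) (hκ₁ : κ ≤ 1)
    (hκ : τ * (1 + κ) < 1) (hl : lam 2 ^ 2 ≤ κ * (c₁ * c₂)) {a : ℝ} (ha : 0 ≤ a) (hal : a ≤ lam 1)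
    (hac : 2 * c₁ * (1 + 2 / τ) ≤ (a / (a + 1)) ^ 2) : tdrr p lam c₁ c₂ τ = 1 := by
  have hle : ∀ j, 2 ≤ j → lam j ≤ lam 2 := fun j hj => by
    induction j, hj using Nat.le_induction with
    | base => rfl
    | succ j hj ih => exact (hanti j (by omega)).trans ih
  have hfar : ∀ j, 2 ≤ j → τ < ratio lam c₁ c₂ j := fun j hj =>
    lt_ratio h h₁ h₂ hτ hκ (hanti _ (by omega)) (hanti _ (by omega))
      ((pow_le_pow_left₀ (h j) (hle j hj) 2).trans hl)
  have hone : ratio lam c₁ c₂ 1 ≤ τ := by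
    have hs2 : sHat lam 2 ^ 2 ≤ c₁ :=
      (pow_le_pow_left₀ (sHat_nonneg h 2) (sHat_le h 2) 2).trans (hl.trans (by
        have := mul_pos h₁ h₂
        nlinarith))
    have hs1 : (a / (a + 1)) ^ 2 ≤ sHat lam 1 ^ 2 :=
      pow_le_pow_left₀ (by positivity) (div_add_one_le_div_add_one ha hal) 2
    have hs0 : 0 ≤ sHat lam 2 ^ 2 := sq_nonneg _
    have hstar : 2 / τ ≤ sStar lam c₁ 1 := by
      have : 1 + 2 / τ ≤ (sHat lam 1 ^ 2 + c₁) / (sHat lam 2 ^ 2 + c₁) := by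
        rw [le_div_iff₀ (by linarith)]
        have : 0 ≤ 1 + 2 / τ := by positivity
        nlinarith
      simp only [sStar]
      linarith
    have h2 : sStar lam c₁ 2 ≤ κ * c₂ := (sStar_le h h₁ 2).trans (by
      rw [div_le_iff₀ h₁]; linarith)
    have hpos : 0 < 2 / τ := by positivity
    unfold ratio
    rw [div_le_iff₀ (by linarith)]
    have : τ * (2 / τ) = 2 := by field_simp
    nlinarith
  unfold tdrr
  apply le_antisymm
  · refine Finset.sup_le fun j hj => ?_
    rw [Finset.mem_filter] at hj
    by_contra hj2
    exact absurd hj.2 (not_le.2 (hfar j (not_le.1 hj2)))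
  · exact Finset.le_sup (f := id) (b := 1) (by simp [hp, hone])

end Criterion

/-! ### Eigenvalues of averages of rank one matrices -/

section Eigenvalues

open scoped ComplexOrder

variable {p : ℕ} {A : Matrix (Fin p) (Fin p) ℂ}

lemma orderedEigenvalue_of_lt (hA : A.IsHermitian) {j : ℕ} (hj : p < j) :
    orderedEigenvalue hA j = 0 := by
  rw [orderedEigenvalue, dif_neg (by omega)]

lemma orderedEigenvalue_nonneg (hA : A.PosSemidef) (j : ℕ) :
    0 ≤ orderedEigenvalue hA.isHermitian j := by
  unfold orderedEigenvalue
  split_ifs with h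
  · set i : Fin (Fintype.card (Fin p)) := ⟨j - 1, by rw [Fintype.card_fin]; omega⟩
    have := hA.eigenvalues_nonneg ((Fintype.equivOfCardEq (Fintype.card_fin _)) i)
    simpa [Matrix.IsHermitian.eigenvalues] using this
  · rfl

lemma orderedEigenvalue_succ_le (hA : A.PosSemidef) (j : ℕ) (hj : 1 ≤ j) :
    orderedEigenvalue hA.isHermitian (j + 1) ≤ orderedEigenvalue hA.isHermitian j := by
  by_cases h : j + 1 ≤ p
  · rw [orderedEigenvalue, orderedEigenvalue, dif_pos ⟨by omega, h⟩, dif_pos ⟨hj, by omega⟩]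
    apply hA.isHermitian.eigenvalues₀_antitone
    simp
  · rw [orderedEigenvalue_of_lt _ (by omega)]
    exact orderedEigenvalue_nonneg hA j

lemma eigenvalues_le_orderedEigenvalue_one (hA : A.IsHermitian) (i : Fin p) :
    hA.eigenvalues i ≤ orderedEigenvalue hA 1 := by
  have : 1 ≤ p := by have := i.2; omega
  rw [orderedEigenvalue, dif_pos ⟨le_rfl, this⟩]
  apply hA.eigenvalues₀_antitone
  simp [Fin.le_def]

lemma sum_orderedEigenvalue (hA : A.IsHermitian) :
    ∑ j ∈ Finset.Icc 1 p, orderedEigenvalue hA j = A.trace.re := by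
  have h1 : ∑ i, hA.eigenvalues i = A.trace.re := by
    rw [hA.trace_eq_sum_eigenvalues]
    simp
  rw [← h1]
  have h2 : ∑ i, hA.eigenvalues i = ∑ i, hA.eigenvalues₀ i := by
    unfold Matrix.IsHermitian.eigenvalues
    exact Equiv.sum_comp (Fintype.equivOfCardEq (Fintype.card_fin _)).symm hA.eigenvalues₀
  rw [h2]
  symm
  refine Finset.sum_bij (fun i _ => i.1 + 1) ?_ ?_ ?_ ?_
  · intro i _
    have := i.2.trans_eq (Fintype.card_fin p)
    simp; omega
  · intro a _ b _ h
    exact Fin.ext (by simpa using h)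
  · intro b hb
    rw [Finset.mem_Icc] at hb
    exact ⟨⟨b - 1, by rw [Fintype.card_fin]; omega⟩, Finset.mem_univ _, by simp; omega⟩
  · intro i _
    have := i.2.trans_eq (Fintype.card_fin p)
    rw [orderedEigenvalue, dif_pos (by omega)]
    simp

lemma orderedEigenvalue_one_le_trace (hA : A.PosSemidef) :
    orderedEigenvalue hA.isHermitian 1 ≤ A.trace.re := by
  rw [← sum_orderedEigenvalue hA.isHermitian]
  rcases Nat.lt_or_ge p 1 with h | h
  · rw [orderedEigenvalue_of_lt _ h]
    exact Finset.sum_nonneg fun j _ => orderedEigenvalue_nonneg hA j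
  · exact Finset.single_le_sum (f := orderedEigenvalue hA.isHermitian)
      (fun j _ => orderedEigenvalue_nonneg hA j) (by simp [h])

lemma trace_le_mul_orderedEigenvalue_one (hA : A.PosSemidef) :
    A.trace.re ≤ p * orderedEigenvalue hA.isHermitian 1 := by
  have h1 : ∑ i, hA.isHermitian.eigenvalues i = A.trace.re := by
    rw [hA.isHermitian.trace_eq_sum_eigenvalues]
    simp
  rw [← h1]
  simpa using Finset.sum_le_card_nsmul Finset.univ _ _
    (fun i _ => eigenvalues_le_orderedEigenvalue_one hA.isHermitian i)

lemma orderedEigenvalue_one_add_two_le_trace (hA : A.PosSemidef) (hp : 2 ≤ p) :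
    orderedEigenvalue hA.isHermitian 1 + orderedEigenvalue hA.isHermitian 2 ≤ A.trace.re := by
  rw [← sum_orderedEigenvalue hA.isHermitian]
  have h : ({1, 2} : Finset ℕ) ⊆ Finset.Icc 1 p := by
    intro j hj
    simp only [Finset.mem_insert, Finset.mem_singleton] at hj
    rw [Finset.mem_Icc]; omega
  refine le_trans (le_of_eq ?_) (Finset.sum_le_sum_of_subset_of_nonneg h
    fun j _ _ => orderedEigenvalue_nonneg hA j)
  simp

/-- The quadratic form of a Hermitian matrix is bounded by its largest eigenvalue. -/
lemma re_inner_mulVec_le (hA : A.IsHermitian) (x : EuclideanSpace ℂ (Fin p)) :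
    (star x.ofLp ⬝ᵥ A.mulVec x.ofLp).re ≤ orderedEigenvalue hA 1 * ‖x‖ ^ 2 := by
  set b := hA.eigenvectorBasis
  have hx : (star x.ofLp ⬝ᵥ A.mulVec x.ofLp) = inner ℂ x (Matrix.toEuclideanLin A x) := by
    rw [EuclideanSpace.inner_eq_star_dotProduct, dotProduct_comm]
    rfl
  have hsymm : (Matrix.toEuclideanLin A).IsSymmetric :=
    Matrix.isSymmetric_toEuclideanLin_iff.2 hA
  have hAb : ∀ i, Matrix.toEuclideanLin A (b i) = (hA.eigenvalues i : ℂ) • b i := fun i => by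
    have := hA.mulVec_eigenvectorBasis i
    ext1 j
    simpa [Matrix.toLpLin_apply] using congrFun this j
  have hterm : ∀ i, inner ℂ x (b i) * inner ℂ (b i) (Matrix.toEuclideanLin A x)
      = ((hA.eigenvalues i * ‖inner ℂ (b i) x‖ ^ 2 : ℝ) : ℂ) := fun i => by
    rw [← hsymm, hAb, inner_smul_left, ← inner_conj_symm x (b i), Complex.conj_ofReal,
      mul_left_comm, ← Complex.normSq_eq_conj_mul_self]
    push_cast
    rw [Complex.normSq_eq_norm_sq]
    push_cast
    rfl
  rw [hx, ← b.sum_inner_mul_inner x, Complex.re_sum]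
  simp only [hterm, Complex.ofReal_re]
  rw [← b.sum_sq_norm_inner_right x, Finset.mul_sum]
  exact Finset.sum_le_sum fun i _ => mul_le_mul_of_nonneg_right
    (eigenvalues_le_orderedEigenvalue_one hA i) (sq_nonneg _)

/-- The average of the rank one matrices `m_k m_kᴴ`, `k < n`. -/
noncomputable def outerAverage (n : ℕ) (m : ℕ → Fin p → ℂ) : Matrix (Fin p) (Fin p) ℂ :=
  fun a b => (n : ℂ)⁻¹ * ∑ k ∈ Finset.range n, m k a * star (m k b)

lemma outerAverage_posSemidef (n : ℕ) (m : ℕ → Fin p → ℂ) : (outerAverage n m).PosSemidef := by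
  have : outerAverage n m
      = ((n : ℝ)⁻¹ : ℝ) • ∑ k ∈ Finset.range n, Matrix.vecMulVec (m k) (star (m k)) := by
    ext a b
    simp [outerAverage, Matrix.sum_apply, Matrix.vecMulVec_apply]
  rw [this]
  exact (Matrix.posSemidef_sum _ fun k _ => Matrix.posSemidef_vecMulVec_self_star _).smul
    (by positivity)

lemma trace_outerAverage (n : ℕ) (m : ℕ → Fin p → ℂ) :
    (outerAverage n m).trace.re = (n : ℝ)⁻¹ * ∑ k ∈ Finset.range n, ∑ i, ‖m k i‖ ^ 2 := by
  have : (outerAverage n m).trace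
      = (((n : ℝ)⁻¹ * ∑ k ∈ Finset.range n, ∑ i, ‖m k i‖ ^ 2 : ℝ) : ℂ) := by
    simp only [Matrix.trace, Matrix.diag, outerAverage]
    rw [← Finset.mul_sum, Finset.sum_comm]
    push_cast
    congr 1
    refine Finset.sum_congr rfl fun k _ => Finset.sum_congr rfl fun i _ => ?_
    rw [← Complex.ofReal_pow, ← Complex.normSq_eq_norm_sq, ← Complex.mul_conj]
    rfl
  rw [this, Complex.ofReal_re]

lemma quadForm_outerAverage (n : ℕ) (m : ℕ → Fin p → ℂ) (x : Fin p → ℂ) :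
    (star x ⬝ᵥ (outerAverage n m).mulVec x).re
      = (n : ℝ)⁻¹ * ∑ k ∈ Finset.range n, ‖∑ i, star (x i) * m k i‖ ^ 2 := by
  have : (star x ⬝ᵥ (outerAverage n m).mulVec x)
      = (((n : ℝ)⁻¹ * ∑ k ∈ Finset.range n, ‖∑ i, star (x i) * m k i‖ ^ 2 : ℝ) : ℂ) := by
    push_cast
    have h : ∀ k, ((‖∑ i, star (x i) * m k i‖ : ℝ) : ℂ) ^ 2
        = ∑ i, ∑ j, star (x i) * (m k i * star (m k j) * x j) := fun k => by
      rw [← Complex.ofReal_pow, ← Complex.normSq_eq_norm_sq, ← Complex.mul_conj, map_sum,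
        Finset.sum_mul_sum]
      refine Finset.sum_congr rfl fun i _ => Finset.sum_congr rfl fun j _ => ?_
      simp
      ring
    simp only [h, dotProduct, Matrix.mulVec, outerAverage, Finset.mul_sum, Finset.sum_mul,
      Pi.star_apply]
    rw [Finset.sum_comm' (t' := Finset.univ) (s' := fun _ => Finset.range n) (by simp)]
    refine Finset.sum_congr rfl fun i _ => ?_
    rw [Finset.sum_comm]
    refine Finset.sum_congr rfl fun k _ => Finset.sum_congr rfl fun j _ => ?_
    ring
  rw [this, Complex.ofReal_re]

/-- The second eigenvalue of an average of outer products is at most the mean squared distance of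
the vectors from a fixed line: the trace minus the Rayleigh quotient at the direction of that line
is the mean squared norm of the components orthogonal to it. -/
lemma orderedEigenvalue_two_outerAverage_le (n : ℕ) (m : ℕ → Fin p → ℂ) (a : ℕ → ℂ)
    (w : Fin p → ℂ) :
    orderedEigenvalue (outerAverage_posSemidef n m).isHermitian 2
      ≤ (n : ℝ)⁻¹ * ∑ k ∈ Finset.range n, ∑ i, ‖m k i - a k * w i‖ ^ 2 := by
  set A := outerAverage n m
  have hA := outerAverage_posSemidef n m
  rcases Nat.lt_or_ge p 2 with hp | hp
  · rw [orderedEigenvalue_of_lt _ hp]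
    positivity
  have htr := orderedEigenvalue_one_add_two_le_trace hA hp
  rw [trace_outerAverage] at htr
  set W : ℝ := ∑ i, ‖w i‖ ^ 2 with hW
  have hWx : ‖(WithLp.toLp 2 w : EuclideanSpace ℂ (Fin p))‖ ^ 2 = W := by
    rw [EuclideanSpace.norm_sq_eq]
  have hray := re_inner_mulVec_le hA.isHermitian (WithLp.toLp 2 w)
  rw [hWx, quadForm_outerAverage] at hray
  have hW0 : 0 ≤ W := by positivity
  rcases hW0.eq_or_lt with h0 | hpos
  · have hw : ∀ i, w i = 0 := fun i => by
      have := (Finset.sum_eq_zero_iff_of_nonneg (fun i _ => sq_nonneg ‖w i‖)).1 h0.symm i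
        (Finset.mem_univ i)
      simpa using this
    simp only [hw, mul_zero, sub_zero]
    linarith [orderedEigenvalue_nonneg hA 1]
  have key : ∀ k, W * ∑ i, ‖m k i‖ ^ 2 - ‖∑ i, star (w i) * m k i‖ ^ 2
      ≤ W * ∑ i, ‖m k i - a k * w i‖ ^ 2 := fun k => by
    set c := ∑ i, star (w i) * m k i with hc
    have h1 : ∑ i, ‖m k i - a k * w i‖ ^ 2
        = ∑ i, ‖m k i‖ ^ 2 - 2 * (star (a k) * c).re + ‖a k‖ ^ 2 * W := by
      rw [hW, hc, Finset.mul_sum, Finset.mul_sum, Complex.re_sum, Finset.mul_sum,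
        ← Finset.sum_sub_distrib, ← Finset.sum_add_distrib]
      refine Finset.sum_congr rfl fun i _ => ?_
      simp only [← Complex.normSq_eq_norm_sq, Complex.normSq_apply, Complex.star_def,
        Complex.mul_re, Complex.mul_im, Complex.sub_re, Complex.sub_im, Complex.conj_re,
        Complex.conj_im]
      ring
    have h2 : 0 ≤ ‖c - W * a k‖ ^ 2 := sq_nonneg _
    have h3 : ‖c - W * a k‖ ^ 2 = ‖c‖ ^ 2 - 2 * W * (star (a k) * c).re + W ^ 2 * ‖a k‖ ^ 2 := by
      simp only [← Complex.normSq_eq_norm_sq, Complex.normSq_apply, Complex.star_def,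
        Complex.mul_re, Complex.mul_im, Complex.sub_re, Complex.sub_im, Complex.conj_re,
        Complex.conj_im, Complex.ofReal_re, Complex.ofReal_im]
      ring
    rw [h1]
    nlinarith
  have hsum : W * ((n : ℝ)⁻¹ * ∑ k ∈ Finset.range n, ∑ i, ‖m k i‖ ^ 2)
      - (n : ℝ)⁻¹ * ∑ k ∈ Finset.range n, ‖∑ i, star (w i) * m k i‖ ^ 2
      ≤ W * ((n : ℝ)⁻¹ * ∑ k ∈ Finset.range n, ∑ i, ‖m k i - a k * w i‖ ^ 2) := by
    have := mul_le_mul_of_nonneg_left (Finset.sum_le_sum fun k (_ : k ∈ Finset.range n) => key k)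
      (inv_nonneg.2 (Nat.cast_nonneg (α := ℝ) n))
    rw [Finset.sum_sub_distrib, ← Finset.mul_sum, ← Finset.mul_sum] at this
    linarith
  have hfin : W * orderedEigenvalue hA.isHermitian 2
      ≤ W * ((n : ℝ)⁻¹ * ∑ k ∈ Finset.range n, ∑ i, ‖m k i - a k * w i‖ ^ 2) := by
    nlinarith
  exact le_of_mul_le_mul_left hfin hpos

end Eigenvalues

/-! ### Probability tending to one and boundedness in probability -/

section InProbability

variable {Ω : Type*} [MeasurableSpace Ω] {P : Measure Ω}

/-- The events `A n` hold with probability tending to one. The events need not be measurable: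
the outer measure of their complements tends to zero. -/
def WithHighProb (P : Measure Ω) (A : ℕ → Ω → Prop) : Prop :=
  Tendsto (fun n => P {ω | ¬ A n ω}) atTop (𝓝 0)

/-- `f n` is bounded above in probability, that is `f n ≤ O_P(1)`. No measurability is assumed. -/
def BddInProb (P : Measure Ω) (f : ℕ → Ω → ℝ) : Prop :=
  ∀ κ : ℝ≥0∞, 0 < κ → ∃ C : ℝ, 0 ≤ C ∧ ∀ᶠ n in atTop, P {ω | C < f n ω} ≤ κ

lemma WithHighProb.mono {A B : ℕ → Ω → Prop} (h : WithHighProb P A)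
    (hAB : ∀ᶠ n in atTop, ∀ ω, A n ω → B n ω) : WithHighProb P B :=
  tendsto_of_tendsto_of_tendsto_of_le_of_le' tendsto_const_nhds h (Eventually.of_forall fun _ =>
    zero_le) (hAB.mono fun _ hn => measure_mono fun _ hω hA => hω (hn _ hA))

lemma WithHighProb.and {A B : ℕ → Ω → Prop} (hA : WithHighProb P A) (hB : WithHighProb P B) :
    WithHighProb P fun n ω => A n ω ∧ B n ω := by
  have h := Tendsto.add hA hB
  rw [add_zero] at h
  refine tendsto_of_tendsto_of_tendsto_of_le_of_le tendsto_const_nhds h (fun _ => zero_le)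
    fun n => (measure_mono ?_).trans (measure_union_le _ _)
  intro ω hω
  by_contra hc
  simp only [Set.mem_union, Set.mem_ofPred_eq, not_or, not_not] at hc
  exact hω hc

lemma withHighProb_of_ae {A : ℕ → Ω → Prop} (h : ∀ n, ∀ᵐ ω ∂P, A n ω) : WithHighProb P A := by
  have : (fun n => P {ω | ¬ A n ω}) = fun _ => 0 := funext fun n => h n
  rw [WithHighProb, this]
  exact tendsto_const_nhds

lemma withHighProb_of_eventually {A : ℕ → Ω → Prop} (h : ∀ᶠ n in atTop, ∀ ω, A n ω) :
    WithHighProb P A :=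
  (withHighProb_of_ae (A := fun _ _ => True) (by simp)).mono (h.mono fun _ hn ω _ => hn ω)

lemma WithHighProb.tendsto_one [IsProbabilityMeasure P] {A : ℕ → Ω → Prop}
    (h : WithHighProb P A) : Tendsto (fun n => P {ω | A n ω}) atTop (𝓝 1) := by
  have h1 : Tendsto (fun n => 1 - P {ω | ¬ A n ω}) atTop (𝓝 (1 - 0)) :=
    ENNReal.Tendsto.sub tendsto_const_nhds h (by simp)
  rw [tsub_zero] at h1
  refine tendsto_of_tendsto_of_tendsto_of_le_of_le h1 tendsto_const_nhds (fun n => ?_)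
    fun n => prob_le_one
  rw [tsub_le_iff_right, ← measure_univ (μ := P)]
  refine (measure_mono fun ω _ => ?_).trans (measure_union_le _ _)
  exact em _

/-- Events that hold with probability arbitrarily close to one, up to a choice of constants, hold
with probability tending to one. -/
lemma withHighProb_of_forall {A : ℕ → Ω → Prop}
    (h : ∀ κ : ℝ≥0∞, 0 < κ → ∀ᶠ n in atTop, P {ω | ¬ A n ω} ≤ κ) : WithHighProb P A :=
  ENNReal.tendsto_nhds_zero.2 h

lemma BddInProb.mono {f g : ℕ → Ω → ℝ} (hg : BddInProb P g)
    (h : WithHighProb P fun n ω => f n ω ≤ g n ω) : BddInProb P f := by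
  intro κ hκ
  obtain ⟨C, hC0, hC⟩ := hg (κ / 2) (ENNReal.half_pos hκ.ne')
  refine ⟨C, hC0, ?_⟩
  filter_upwards [hC, ENNReal.tendsto_nhds_zero.1 h (κ / 2) (ENNReal.half_pos hκ.ne')]
    with n h1 h2
  refine (measure_mono ?_).trans ((measure_union_le _ _).trans
    ((add_le_add h1 h2).trans (ENNReal.add_halves κ).le))
  intro ω hω
  by_contra hc
  simp only [Set.mem_union, Set.mem_ofPred_eq, not_or, not_not, not_lt] at hc hω
  linarith

lemma BddInProb.map₂ {f g : ℕ → Ω → ℝ} (hf : BddInProb P f) (hg : BddInProb P g)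
    {φ : ℝ → ℝ → ℝ} (hφ : ∀ a b, ∃ C, ∀ n ω, f n ω ≤ a → g n ω ≤ b → φ (f n ω) (g n ω) ≤ C) :
    BddInProb P fun n ω => φ (f n ω) (g n ω) := by
  intro κ hκ
  obtain ⟨a, -, ha⟩ := hf (κ / 2) (ENNReal.half_pos hκ.ne')
  obtain ⟨b, -, hb⟩ := hg (κ / 2) (ENNReal.half_pos hκ.ne')
  obtain ⟨C, hC⟩ := hφ a b
  refine ⟨max C 0, le_max_right _ _, ?_⟩
  filter_upwards [ha, hb] with n h1 h2
  refine (measure_mono ?_).trans ((measure_union_le _ _).trans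
    ((add_le_add h1 h2).trans (ENNReal.add_halves κ).le))
  intro ω hω
  by_contra hc
  simp only [Set.mem_union, Set.mem_ofPred_eq, not_or, not_lt] at hc hω
  exact absurd ((hC n ω hc.1 hc.2).trans (le_max_left C 0)) (not_le.2 hω)

lemma BddInProb.add {f g : ℕ → Ω → ℝ} (hf : BddInProb P f) (hg : BddInProb P g) :
    BddInProb P fun n ω => f n ω + g n ω :=
  hf.map₂ hg (φ := fun a b => a + b) fun a b => ⟨a + b, fun _ _ h1 h2 => add_le_add h1 h2⟩

lemma BddInProb.mul {f g : ℕ → Ω → ℝ} (hf : BddInProb P f) (hg : BddInProb P g)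
    (hf0 : ∀ n ω, 0 ≤ f n ω) (hg0 : ∀ n ω, 0 ≤ g n ω) :
    BddInProb P fun n ω => f n ω * g n ω :=
  hf.map₂ hg (φ := fun a b => a * b) fun a b => ⟨a * b, fun n ω h1 h2 =>
    mul_le_mul h1 h2 (hg0 n ω) ((hf0 n ω).trans h1)⟩

lemma BddInProb.const_mul {f : ℕ → Ω → ℝ} (hf : BddInProb P f) {c : ℝ} (hc : 0 ≤ c) :
    BddInProb P fun n ω => c * f n ω :=
  hf.map₂ hf (φ := fun a _ => c * a) fun a _ => ⟨c * a, fun _ _ h1 _ =>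
    mul_le_mul_of_nonneg_left h1 hc⟩

lemma BddInProb.sq_of_eventually_nonneg {f : ℕ → Ω → ℝ} (hf : BddInProb P f)
    (h0 : ∀ᶠ n in atTop, ∀ ω, 0 ≤ f n ω) : BddInProb P fun n ω => f n ω ^ 2 :=
  (hf.map₂ hf (φ := fun a _ => max a 0 ^ 2) fun a _ => ⟨max a 0 ^ 2, fun _ _ h _ =>
    pow_le_pow_left₀ (le_max_right _ _) (max_le_max_right 0 h) 2⟩).mono
    (withHighProb_of_eventually (h0.mono fun _ hn ω => by rw [max_eq_left (hn ω)]))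

lemma bddInProb_const (c : ℝ) : BddInProb P fun _ _ => c := by
  intro κ _
  refine ⟨max c 0, le_max_right _ _, Eventually.of_forall fun n => ?_⟩
  simp

lemma BddInProb.sum {ι : Type*} (s : Finset ι) {f : ι → ℕ → Ω → ℝ}
    (h : ∀ i ∈ s, BddInProb P (f i)) : BddInProb P fun n ω => ∑ i ∈ s, f i n ω := by
  classical
  induction s using Finset.induction_on with
  | empty => simpa using bddInProb_const 0
  | insert a s ha ih =>
    simp only [Finset.sum_insert ha]
    exact (h a (by simp)).add (ih fun i hi => h i (by simp [hi]))

/-- Markov's inequality. -/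
lemma bddInProb_of_integral_le [IsFiniteMeasure P] {f : ℕ → Ω → ℝ}
    {C : ℝ} (h0 : ∀ n ω, 0 ≤ f n ω)
    (hf : ∀ᶠ n in atTop, Integrable (f n) P ∧ ∫ ω, f n ω ∂P ≤ C) : BddInProb P f := by
  intro κ hκ
  rcases eq_or_ne κ ∞ with rfl | hκt
  · exact ⟨0, le_rfl, Eventually.of_forall fun _ => le_top⟩
  have hκ' : 0 < κ.toReal := ENNReal.toReal_pos hκ.ne' hκt
  refine ⟨(|C| + 1) / κ.toReal, by positivity, ?_⟩
  filter_upwards [hf] with n hn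
  have hpos : 0 < (|C| + 1) / κ.toReal := by positivity
  have hm := mul_meas_ge_le_integral_of_nonneg (Eventually.of_forall (h0 n)) hn.1
    ((|C| + 1) / κ.toReal)
  have hle : P.real {ω | (|C| + 1) / κ.toReal ≤ f n ω} ≤ κ.toReal := by
    have h1 : (|C| + 1) / κ.toReal * P.real {ω | (|C| + 1) / κ.toReal ≤ f n ω} ≤ |C| + 1 :=
      hm.trans (hn.2.trans (by linarith [le_abs_self C]))
    rw [div_mul_eq_mul_div, div_le_iff₀ hκ'] at h1
    exact le_of_mul_le_mul_left h1 (by positivity)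
  calc P {ω | (|C| + 1) / κ.toReal < f n ω}
      ≤ P {ω | (|C| + 1) / κ.toReal ≤ f n ω} := measure_mono fun ω hω => by
        rw [Set.mem_ofPred_eq] at hω ⊢
        exact hω.le
    _ ≤ κ := (ENNReal.toReal_le_toReal (measure_ne_top P _) hκt).1 hle

lemma BddInProb.withHighProb_mul_le {f : ℕ → Ω → ℝ} (hf : BddInProb P f) {a : ℕ → ℝ}
    (ha : Tendsto a atTop (𝓝 0)) (ha0 : ∀ᶠ n in atTop, 0 ≤ a n) {κ : ℝ} (hκ : 0 < κ) :
    WithHighProb P fun n ω => a n * f n ω ≤ κ := by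
  refine withHighProb_of_forall fun η hη => ?_
  obtain ⟨C, hC0, hC⟩ := hf η hη
  have : Tendsto (fun n => a n * C) atTop (𝓝 (0 * C)) := ha.mul_const C
  rw [zero_mul] at this
  filter_upwards [hC, ha0, this.eventually_le_const hκ] with n h1 h2 h3
  refine (measure_mono fun ω hω => ?_).trans h1
  by_contra hc
  exact hω ((mul_le_mul_of_nonneg_left (not_lt.1 hc) h2).trans h3)

end InProbability

/-! ### Averages over an i.i.d. sample -/

section Sample

variable {Ω : Type*} [MeasurableSpace Ω] {P : Measure Ω} {𝒵 : Type*} [MeasurableSpace 𝒵] {Z : ℕ → Ω → 𝒵}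

/-- `Z 0, Z 1, …` are independent with common law `ν`. -/
structure IsSample (P : Measure Ω) (Z : ℕ → Ω → 𝒵) (ν : Measure 𝒵) : Prop where
  measurable : ∀ j, Measurable (Z j)
  indep : iIndepFun Z P
  map_eq : ∀ j, P.map (Z j) = ν

variable {ν : Measure 𝒵}

lemma IsSample.integral_comp (hZ : IsSample P Z ν) (j : ℕ) {E : Type*} [NormedAddCommGroup E]
    [NormedSpace ℝ E] {f : 𝒵 → E} (hf : AEStronglyMeasurable f ν) :
    ∫ ω, f (Z j ω) ∂P = ∫ z, f z ∂ν := by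
  rw [← hZ.map_eq j] at hf ⊢
  exact (integral_map (hZ.measurable j).aemeasurable hf).symm

lemma IsSample.integrable_comp (hZ : IsSample P Z ν) (j : ℕ) {E : Type*} [NormedAddCommGroup E]
    {f : 𝒵 → E} (hf : Integrable f ν) : Integrable (fun ω => f (Z j ω)) P := by
  rw [← hZ.map_eq j] at hf
  exact hf.comp_measurable (hZ.measurable j)

lemma IsSample.identDistrib (hZ : IsSample P Z ν) (i : ℕ) {E : Type*} [MeasurableSpace E]
    {φ : 𝒵 → E} (hφ : Measurable φ) :
    IdentDistrib (fun ω => φ (Z i ω)) (fun ω => φ (Z 0 ω)) P P where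
  aemeasurable_fst := (hφ.comp (hZ.measurable i)).aemeasurable
  aemeasurable_snd := (hφ.comp (hZ.measurable 0)).aemeasurable
  map_eq := by
    change P.map (φ ∘ Z i) = P.map (φ ∘ Z 0)
    rw [← Measure.map_map hφ (hZ.measurable i), ← Measure.map_map hφ (hZ.measurable 0),
      hZ.map_eq, hZ.map_eq]

/-- `n⁻¹ ∑_{j<n} a_j`. -/
noncomputable def avg (n : ℕ) (a : ℕ → ℝ) : ℝ := (n : ℝ)⁻¹ * ∑ j ∈ Finset.range n, a j

lemma avg_nonneg {n : ℕ} {a : ℕ → ℝ} (h : ∀ j, 0 ≤ a j) : 0 ≤ avg n a :=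
  mul_nonneg (by positivity) (Finset.sum_nonneg fun j _ => h j)

lemma avg_le_avg {n : ℕ} {a b : ℕ → ℝ} (h : ∀ j < n, a j ≤ b j) : avg n a ≤ avg n b :=
  mul_le_mul_of_nonneg_left (Finset.sum_le_sum fun j hj => h j (Finset.mem_range.1 hj))
    (by positivity)

lemma avg_add (n : ℕ) (a b : ℕ → ℝ) : avg n (fun j => a j + b j) = avg n a + avg n b := by
  simp [avg, Finset.sum_add_distrib, mul_add]

lemma avg_const_mul (n : ℕ) (c : ℝ) (a : ℕ → ℝ) : avg n (fun j => c * a j) = c * avg n a := by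
  simp only [avg, ← Finset.mul_sum]; ring

lemma avg_const {n : ℕ} (hn : 1 ≤ n) (c : ℝ) : avg n (fun _ => c) = c := by
  have : (n : ℝ) ≠ 0 := by positivity
  simp [avg, this]

lemma IsSample.integrable_avg (hZ : IsSample P Z ν) (n : ℕ) {f : 𝒵 → ℝ} (hf : Integrable f ν) :
    Integrable (fun ω => avg n fun j => f (Z j ω)) P :=
  (integrable_finsetSum _ fun j _ => hZ.integrable_comp j hf).const_mul _

lemma IsSample.integral_avg (hZ : IsSample P Z ν) {n : ℕ} (hn : 1 ≤ n) {f : 𝒵 → ℝ}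
    (hf : Integrable f ν) : ∫ ω, avg n (fun j => f (Z j ω)) ∂P = ∫ z, f z ∂ν := by
  simp only [avg]
  rw [integral_const_mul, integral_finsetSum _ fun j _ => hZ.integrable_comp j hf]
  simp only [hZ.integral_comp _ hf.aestronglyMeasurable]
  have : (n : ℝ) ≠ 0 := by positivity
  simp [this]

variable [IsProbabilityMeasure P]

lemma IsSample.bddInProb_avg (hZ : IsSample P Z ν) {f : 𝒵 → ℝ} (hf : Integrable f ν)
    (h0 : ∀ z, 0 ≤ f z) : BddInProb P fun n ω => avg n fun j => f (Z j ω) := by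
  refine bddInProb_of_integral_le (C := ∫ z, f z ∂ν) (fun n ω => avg_nonneg fun j => h0 _) ?_
  filter_upwards [eventually_ge_atTop 1] with n hn
  exact ⟨hZ.integrable_avg n hf, (hZ.integral_avg hn hf).le⟩

/-- The expectation of a degenerate kernel product vanishes. -/
lemma IsSample.integral_kernel_mul_eq_zero (hZ : IsSample P Z ν) {f : 𝒵 → 𝒵 → ℝ}
    (hf : Measurable fun q : 𝒵 × 𝒵 => f q.1 q.2) (h0 : ∀ z', ∫ z, f z z' ∂ν = 0)
    {i j k : ℕ} (hij : i ≠ j) (hik : i ≠ k) :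
    ∫ ω, f (Z i ω) (Z k ω) * f (Z j ω) (Z k ω) ∂P = 0 := by
  have hind : IndepFun (Z i) (fun ω => (Z j ω, Z k ω)) P :=
    (hZ.indep.indepFun_prodMk hZ.measurable j k i hij.symm hik.symm).symm
  have hmjk : Measurable fun ω => (Z j ω, Z k ω) := (hZ.measurable j).prodMk (hZ.measurable k)
  have hprod := (indepFun_iff_map_prod_eq_prod_map_map (hZ.measurable i).aemeasurable
    hmjk.aemeasurable).1 hind
  have hg : Measurable fun q : 𝒵 × 𝒵 × 𝒵 => f q.1 q.2.2 * f q.2.1 q.2.2 :=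
    (hf.comp (measurable_fst.prodMk (measurable_snd.comp measurable_snd))).mul
      (hf.comp measurable_snd)
  have h1 : ∫ ω, f (Z i ω) (Z k ω) * f (Z j ω) (Z k ω) ∂P
      = ∫ q, f q.1 q.2.2 * f q.2.1 q.2.2 ∂(P.map fun ω => (Z i ω, Z j ω, Z k ω)) :=
    (integral_map ((hZ.measurable i).prodMk hmjk).aemeasurable hg.aestronglyMeasurable).symm
  rw [h1, hprod, hZ.map_eq]
  have : IsProbabilityMeasure ν := by
    rw [← hZ.map_eq 0]; exact Measure.isProbabilityMeasure_map (hZ.measurable 0).aemeasurable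
  have : IsProbabilityMeasure (P.map fun ω => (Z j ω, Z k ω)) :=
    Measure.isProbabilityMeasure_map hmjk.aemeasurable
  by_cases hint : Integrable (fun q : 𝒵 × 𝒵 × 𝒵 => f q.1 q.2.2 * f q.2.1 q.2.2)
      (ν.prod (P.map fun ω => (Z j ω, Z k ω)))
  · rw [integral_prod_symm _ hint]
    simp [integral_mul_const, h0]
  · exact integral_undef hint

/-- A sample average of a degenerate kernel, evaluated at the sample points themselves, has mean
square `O(1 / n)`: all cross terms vanish. -/
lemma IsSample.kernel_bound (hZ : IsSample P Z ν) {f : 𝒵 → 𝒵 → ℝ}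
    (hf : Measurable fun q : 𝒵 × 𝒵 => f q.1 q.2) (h0 : ∀ z', ∫ z, f z z' ∂ν = 0)
    {H : 𝒵 → ℝ} (hH : MemLp H 2 ν) (hfH : ∀ z z', |f z z'| ≤ H z) {n : ℕ} (hn : 1 ≤ n) :
    Integrable (fun ω => avg n fun k => avg n (fun j => f (Z j ω) (Z k ω)) ^ 2) P ∧
    n * ∫ ω, avg n (fun k => avg n (fun j => f (Z j ω) (Z k ω)) ^ 2) ∂P ≤ ∫ z, H z ^ 2 ∂ν := by
  have hmem : ∀ j k, MemLp (fun ω => f (Z j ω) (Z k ω)) 2 P := fun j k => by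
    have : MemLp (fun ω => H (Z j ω)) 2 P := by
      rw [← hZ.map_eq j] at hH
      exact hH.comp_of_map (hZ.measurable j).aemeasurable
    exact this.mono (hf.comp ((hZ.measurable j).prodMk (hZ.measurable k))).aestronglyMeasurable
      (Eventually.of_forall fun ω => (hfH _ _).trans (le_abs_self _))
  have hint : ∀ i j k, Integrable (fun ω => f (Z i ω) (Z k ω) * f (Z j ω) (Z k ω)) P :=
    fun i j k => (hmem i k).integrable_mul (hmem j k)
  have hcross : ∀ i j k, i ≠ j → ∫ ω, f (Z i ω) (Z k ω) * f (Z j ω) (Z k ω) ∂P = 0 := by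
    intro i j k hij
    by_cases hik : i = k
    · simp only [mul_comm (f (Z i _) _)]
      exact hZ.integral_kernel_mul_eq_zero hf h0 hij.symm (hik ▸ hij.symm)
    · exact hZ.integral_kernel_mul_eq_zero hf h0 hij hik
  have hdiag : ∀ i k, ∫ ω, f (Z i ω) (Z k ω) * f (Z i ω) (Z k ω) ∂P ≤ ∫ z, H z ^ 2 ∂ν := by
    intro i k
    rw [← hZ.integral_comp i hH.integrable_sq.aestronglyMeasurable]
    refine integral_mono (hint i i k) (hZ.integrable_comp i hH.integrable_sq) fun ω => ?_
    have := hfH (Z i ω) (Z k ω)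
    change _ ≤ H (Z i ω) ^ 2
    rw [← abs_mul_abs_self, sq]
    exact mul_self_le_mul_self (abs_nonneg _) this
  have hexp : ∀ k ω, avg n (fun j => f (Z j ω) (Z k ω)) ^ 2 = ((n : ℝ)⁻¹) ^ 2 *
      ∑ i ∈ Finset.range n, ∑ j ∈ Finset.range n, f (Z i ω) (Z k ω) * f (Z j ω) (Z k ω) := by
    intro k ω
    rw [avg, mul_pow, sq (∑ j ∈ _, _), Finset.sum_mul_sum]
  have hsq : ∀ k, Integrable (fun ω => avg n (fun j => f (Z j ω) (Z k ω)) ^ 2) P ∧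
      ∫ ω, avg n (fun j => f (Z j ω) (Z k ω)) ^ 2 ∂P ≤ (n : ℝ)⁻¹ * ∫ z, H z ^ 2 ∂ν := by
    intro k
    simp only [hexp]
    refine ⟨(integrable_finsetSum _ fun i _ => integrable_finsetSum _ fun j _ =>
      hint i j k).const_mul _, ?_⟩
    rw [integral_const_mul, integral_finsetSum _ fun i _ => integrable_finsetSum _ fun j _ =>
      hint i j k]
    have : ∀ i ∈ Finset.range n, ∫ ω, ∑ j ∈ Finset.range n, f (Z i ω) (Z k ω) * f (Z j ω) (Z k ω) ∂P
        ≤ ∫ z, H z ^ 2 ∂ν := by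
      intro i hi
      rw [integral_finsetSum _ fun j _ => hint i j k, Finset.sum_eq_single_of_mem i hi
        fun j _ hj => hcross i j k hj.symm]
      exact hdiag i k
    have hn0 : (n : ℝ) ≠ 0 := by positivity
    calc _ ≤ ((n : ℝ)⁻¹) ^ 2 * ∑ i ∈ Finset.range n, ∫ z, H z ^ 2 ∂ν :=
          mul_le_mul_of_nonneg_left (Finset.sum_le_sum this) (by positivity)
      _ = _ := by
        rw [Finset.sum_const, Finset.card_range, nsmul_eq_mul]
        field_simp
  have hn0 : (n : ℝ) ≠ 0 := by positivity
  refine ⟨(integrable_finsetSum _ fun k _ => (hsq k).1).const_mul _, ?_⟩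
  change n * ∫ ω, (n : ℝ)⁻¹ * _ ∂P ≤ _
  rw [integral_const_mul, integral_finsetSum _ fun k _ => (hsq k).1, ← mul_assoc,
    mul_inv_cancel₀ hn0, one_mul]
  refine (Finset.sum_le_sum fun k _ => (hsq k).2).trans ?_
  rw [Finset.sum_const, Finset.card_range, nsmul_eq_mul, ← mul_assoc, mul_inv_cancel₀ hn0, one_mul]

end Sample

/-! ### Envelopes and the uniform law of large numbers -/

section Uniform

variable {Ω : Type*} [MeasurableSpace Ω] {P : Measure Ω} {𝒵 : Type*} [MeasurableSpace 𝒵]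

/-- A function on a compact set that is continuous there and measurable in the sample point is
dominated by a measurable function of the sample point, integrable as soon as the expected
supremum is finite. The supremum over a countable dense set serves as this function, because
the lower integral of a supremum over the whole set says nothing about measurability. -/
lemma exists_envelope {E : Type*} [PseudoMetricSpace E] {K : Set E} (hK : IsCompact K)
    {Z : Ω → 𝒵} (hZ : Measurable Z) {f : 𝒵 → E → ℝ} (hmeas : ∀ θ ∈ K, Measurable fun z => f z θ)
    (hcont : ∀ z, ContinuousOn (f z) K) (h0 : ∀ z θ, 0 ≤ f z θ)
    (hfin : ∫⁻ ω, ⨆ θ ∈ K, ENNReal.ofReal (f (Z ω) θ) ∂P < ∞) :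
    ∃ H : 𝒵 → ℝ, Measurable H ∧ (∀ z, 0 ≤ H z) ∧ Integrable H (P.map Z) ∧
      ∀ z, ∀ θ ∈ K, f z θ ≤ H z := by
  rcases K.eq_empty_or_nonempty with rfl | hne
  · exact ⟨fun _ => 0, measurable_const, fun _ => le_rfl, integrable_zero _ _ _, by simp⟩
  have : Nonempty K := hne.to_subtype
  have : CompactSpace K := isCompact_iff_compactSpace.1 hK
  let D : ℕ → K := TopologicalSpace.denseSeq K
  have hD : DenseRange D := TopologicalSpace.denseRange_denseSeq K
  have hbdd : ∀ z, BddAbove (Set.range fun i => f z (D i)) := fun z => by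
    obtain ⟨C, hC⟩ := (hK.image_of_continuousOn (hcont z)).bddAbove
    exact ⟨C, by rintro _ ⟨i, rfl⟩; exact hC ⟨D i, (D i).2, rfl⟩⟩
  have hmH : Measurable fun z => ⨆ i, f z (D i) := Measurable.iSup fun i => hmeas _ (D i).2
  have h0H : ∀ z, 0 ≤ ⨆ i, f z (D i) := fun z => Real.iSup_nonneg fun i => h0 _ _
  refine ⟨fun z => ⨆ i, f z (D i), hmH, h0H, ?_, fun z θ hθ => ?_⟩
  · rw [integrable_map_measure hmH.aestronglyMeasurable hZ.aemeasurable]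
    refine ⟨(hmH.comp hZ).aestronglyMeasurable, ?_⟩
    refine (hasFiniteIntegral_iff_ofReal (f := (fun z => ⨆ i, f z (D i)) ∘ Z)
      (Eventually.of_forall fun ω => h0H (Z ω))).2 ?_
    refine lt_of_le_of_lt (lintegral_mono fun ω => ?_) hfin
    rcases eq_or_ne (⨆ θ ∈ K, ENNReal.ofReal (f (Z ω) θ)) ∞ with h | h
    · rw [h]; exact le_top
    rw [ENNReal.ofReal_le_iff_le_toReal h, Function.comp_apply]
    refine ciSup_le fun i => (ENNReal.ofReal_le_iff_le_toReal h).1 ?_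
    exact le_iSup₂_of_le (D i).1 (D i).2 le_rfl
  · have hc : Continuous fun θ : K => f z θ := (hcont z).domRestrict
    have hcl : IsClosed {θ : K | f z θ ≤ ⨆ i, f z (D i)} := isClosed_le hc continuous_const
    have : (⟨θ, hθ⟩ : K) ∈ closure (Set.range D) := hD ⟨θ, hθ⟩
    exact closure_minimal (by rintro _ ⟨i, rfl⟩; exact le_ciSup (hbdd z) i) hcl this

/-- A map into `C(K, ℝ)` is Borel measurable as soon as its evaluations are. -/
lemma measurable_continuousMap_of_eval {K : Type*} [MetricSpace K] [CompactSpace K]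
    [MeasurableSpace C(K, ℝ)] [BorelSpace C(K, ℝ)] {φ : 𝒵 → C(K, ℝ)}
    (h : ∀ k, Measurable fun z => φ z k) : Measurable φ := by
  have hdist : ∀ u : C(K, ℝ), Measurable fun z => dist (φ z) u := fun u => by
    refine measurable_of_Iic fun r => ?_
    rcases lt_or_ge r 0 with hr | hr
    · convert MeasurableSet.empty
      ext z
      simpa using hr.trans_le dist_nonneg
    rcases isEmpty_or_nonempty K with hK | hK
    · convert MeasurableSet.univ
      ext z
      simpa using (ContinuousMap.dist_le hr).2 fun k => hK.elim k
    let D : ℕ → K := TopologicalSpace.denseSeq K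
    have hD : DenseRange D := TopologicalSpace.denseRange_denseSeq K
    have : (fun z => dist (φ z) u) ⁻¹' Set.Iic r = ⋂ i, {z | dist (φ z (D i)) (u (D i)) ≤ r} := by
      ext z
      simp only [Set.mem_preimage, Set.mem_Iic, Set.mem_iInter, ContinuousMap.dist_le hr]
      refine ⟨fun hz i => hz _, fun hz k => ?_⟩
      have hcl : IsClosed {k : K | dist (φ z k) (u k) ≤ r} :=
        isClosed_le ((φ z).continuous.dist u.continuous) continuous_const
      exact closure_minimal (by rintro _ ⟨i, rfl⟩; exact hz i) hcl (hD k)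
    rw [this]
    exact MeasurableSet.iInter fun i =>
      measurableSet_le ((h _).dist measurable_const) measurable_const
  have hbasis : TopologicalSpace.IsTopologicalBasis
      {s : Set C(K, ℝ) | ∃ u r, s = Metric.ball u r} := by
    refine TopologicalSpace.isTopologicalBasis_of_isOpen_of_nhds ?_ ?_
    · rintro _ ⟨u, r, rfl⟩
      exact Metric.isOpen_ball
    · intro u s hu hs
      obtain ⟨r, hr, hrs⟩ := Metric.isOpen_iff.1 hs u hu
      exact ⟨_, ⟨u, r, rfl⟩, Metric.mem_ball_self hr, hrs⟩
  rw [BorelSpace.measurable_eq (α := C(K, ℝ)), hbasis.borel_eq_generateFrom]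
  refine measurable_generateFrom ?_
  rintro _ ⟨u, r, rfl⟩
  exact measurableSet_lt (hdist u) measurable_const

variable [IsProbabilityMeasure P] {Z : ℕ → Ω → 𝒵} {ν : Measure 𝒵}

/-- **Uniform law of large numbers** over a compact index space: the strong law in the separable
Banach space `C(K, ℝ)`. -/
lemma IsSample.uniform_lln (hZ : IsSample P Z ν) {K : Type*} [MetricSpace K] [CompactSpace K]
    {f : 𝒵 → K → ℝ} (hmeas : ∀ k, Measurable fun z => f z k) (hcont : ∀ z, Continuous (f z))
    {H : 𝒵 → ℝ} (hH : Integrable H ν) (hfH : ∀ᵐ z ∂ν, ∀ k, |f z k| ≤ H z) {κ : ℝ} (hκ : 0 < κ) :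
    WithHighProb P fun n ω => ∀ k, |avg n (fun j => f (Z j ω) k) - ∫ z, f z k ∂ν| < κ := by
  borelize C(K, ℝ)
  let φ : 𝒵 → C(K, ℝ) := fun z => ⟨f z, hcont z⟩
  have hφ : Measurable φ := measurable_continuousMap_of_eval hmeas
  have hφint : Integrable φ ν := by
    refine hH.mono hφ.aestronglyMeasurable ?_
    filter_upwards [hfH] with z hz
    rw [ContinuousMap.norm_le _ (norm_nonneg _)]
    exact fun k => (hz k).trans (le_abs_self _)
  have hlln := strong_law_ae (fun j ω => φ (Z j ω)) (hZ.integrable_comp 0 hφint)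
    (fun i j hij => (hZ.indep.indepFun hij).comp hφ hφ) fun i => hZ.identDistrib i hφ
  have hmeasn : ∀ n : ℕ, AEStronglyMeasurable
      (fun ω => (n : ℝ)⁻¹ • ∑ j ∈ Finset.range n, φ (Z j ω)) P := fun n => by
    have h := (Finset.measurable_sum (Finset.range n) fun j _ =>
      hφ.comp (hZ.measurable j)).const_smul ((n : ℝ)⁻¹)
    exact h.aestronglyMeasurable
  have hconv := tendstoInMeasure_of_tendsto_ae hmeasn hlln
  rw [tendstoInMeasure_iff_dist] at hconv
  refine tendsto_of_tendsto_of_tendsto_of_le_of_le tendsto_const_nhds (hconv κ hκ)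
    (fun _ => zero_le) fun n => measure_mono fun ω hω => ?_
  rw [Set.mem_ofPred_eq] at hω ⊢
  contrapose! hω
  intro k
  have hk := (ContinuousMap.dist_apply_le_dist k).trans_lt hω
  have hint : (∫ ω, φ (Z 0 ω) ∂P) k = ∫ z, f z k ∂ν := by
    rw [hZ.integral_comp 0 hφ.aestronglyMeasurable,
      ← ContinuousMap.evalCLM_apply ℝ, ← ContinuousLinearMap.integral_comp_comm _ hφint]
    rfl
  rw [hint, Real.dist_eq] at hk
  simpa [avg, φ] using hk

/-- The weak law of large numbers. -/
lemma IsSample.lln (hZ : IsSample P Z ν) {f : 𝒵 → ℝ} (hf : Integrable f ν) (hm : Measurable f)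
    {κ : ℝ} (hκ : 0 < κ) :
    WithHighProb P fun n ω => |avg n (fun j => f (Z j ω)) - ∫ z, f z ∂ν| < κ :=
  (hZ.uniform_lln (K := Unit) (f := fun z _ => f z) (fun _ => hm) (fun _ => continuous_const)
    hf.norm (Eventually.of_forall fun _ _ => le_rfl) hκ).mono
      (Eventually.of_forall fun _ _ h => h ())

end Uniform

/-! ### The characteristic exponential and its Taylor remainders -/

lemma norm_exp_I_sub_exp_I_le (a b : ℝ) :
    ‖Complex.exp (Complex.I * a) - Complex.exp (Complex.I * b)‖ ≤ |a - b| := by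
  have h : Complex.exp (Complex.I * a) - Complex.exp (Complex.I * b)
      = Complex.exp (Complex.I * b) * (Complex.exp (Complex.I * ((a - b : ℝ) : ℂ)) - 1) := by
    rw [mul_sub, ← Complex.exp_add, mul_one]
    congr 2
    push_cast
    ring
  rw [h, norm_mul, mul_comm Complex.I (b : ℂ), Complex.norm_exp_ofReal_mul_I, one_mul]
  exact Real.norm_exp_I_mul_ofReal_sub_one_le

lemma norm_exp_I_sub_one_le (a : ℝ) : ‖Complex.exp (Complex.I * a) - 1‖ ≤ |a| :=
  Real.norm_exp_I_mul_ofReal_sub_one_le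

lemma norm_exp_I_sub_one_sub_le (a : ℝ) :
    ‖Complex.exp (Complex.I * a) - 1 - Complex.I * a‖ ≤ 2 * |a| := by
  refine (norm_sub_le _ _).trans ?_
  have : ‖Complex.I * (a : ℂ)‖ = |a| := by simp
  rw [this]
  linarith [norm_exp_I_sub_one_le a]

/-- The first order Taylor remainder is of order `|a| ^ (3 / 2)` uniformly in `a`. -/
lemma norm_exp_I_sub_one_sub_le_sqrt (a : ℝ) :
    ‖Complex.exp (Complex.I * a) - 1 - Complex.I * a‖ ≤ 2 * (|a| * √|a|) := by
  rcases le_or_gt |a| 1 with h | h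
  · have hI : ‖Complex.I * (a : ℂ)‖ = |a| := by simp
    have h1 := Complex.norm_exp_sub_one_sub_id_le (x := Complex.I * a) (by rw [hI]; exact h)
    rw [hI] at h1
    have h2 : |a| ≤ √|a| := Real.le_sqrt_of_sq_le (by nlinarith [abs_nonneg a])
    have := mul_le_mul_of_nonneg_left h2 (abs_nonneg a)
    have := mul_nonneg (abs_nonneg a) (Real.sqrt_nonneg |a|)
    nlinarith
  · have h1 := norm_exp_I_sub_one_sub_le a
    have h2 : 1 ≤ √|a| := Real.one_le_sqrt.2 h.le
    nlinarith [abs_nonneg a]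

lemma norm_exp_I (a : ℝ) : ‖Complex.exp (Complex.I * a)‖ = 1 := by
  rw [mul_comm, Complex.norm_exp_ofReal_mul_I]

/-! ### The population version of the weighted residual process -/

section Population

variable {p : ℕ}

/-- The characteristic function `E exp(itε)` of the error distribution. -/
noncomputable def errCharFun (νE : Measure ℝ) (t : ℝ) : ℂ :=
  ∫ e, Complex.exp (Complex.I * t * e) ∂νE

/-- `E X_i exp(it(ε + D(X)))`, for independent `X` and `ε`. -/
noncomputable def popMean (νX : Measure (EuclideanSpace ℝ (Fin p))) (νE : Measure ℝ)
    (D : EuclideanSpace ℝ (Fin p) → ℝ) (i : Fin p) (t : ℝ) : ℂ :=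
  ∫ z, (z.1 i : ℂ) * Complex.exp (Complex.I * t * (z.2 + D z.1)) ∂(νX.prod νE)

variable {νX : Measure (EuclideanSpace ℝ (Fin p))} [IsProbabilityMeasure νX]
  {νE : Measure ℝ} [IsProbabilityMeasure νE] {D : EuclideanSpace ℝ (Fin p) → ℝ} {i : Fin p}

lemma measurable_coord (i : Fin p) : Measurable fun x : EuclideanSpace ℝ (Fin p) => x i := by
  fun_prop

lemma norm_errCharFun_le (t : ℝ) : ‖errCharFun νE t‖ ≤ 1 := by
  refine (norm_integral_le_of_norm_le_const (C := 1) (Eventually.of_forall fun e => ?_)).trans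
    (by simp)
  have := norm_exp_I (t * e)
  push_cast at this
  rw [← mul_assoc] at this
  exact this.le

lemma integrable_exp_I (t : ℝ) : Integrable (fun e : ℝ => Complex.exp (Complex.I * t * e)) νE := by
  refine Integrable.of_bound (C := 1) (by fun_prop) (Eventually.of_forall fun e => ?_)
  have := norm_exp_I (t * e)
  push_cast at this
  rw [← mul_assoc] at this
  exact this.le

lemma norm_errCharFun_sub_le (hE : Integrable (fun e => e) νE) (t t' : ℝ) :
    ‖errCharFun νE t - errCharFun νE t'‖ ≤ |t - t'| * ∫ e, |e| ∂νE := by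
  unfold errCharFun
  rw [← integral_sub (integrable_exp_I t) (integrable_exp_I t'), ← integral_const_mul]
  refine norm_integral_le_of_norm_le (hE.abs.const_mul _) (Eventually.of_forall fun e => ?_)
  have := norm_exp_I_sub_exp_I_le (t * e) (t' * e)
  push_cast at this
  rw [← mul_assoc, ← mul_assoc] at this
  rwa [← sub_mul, abs_mul] at this

omit [IsProbabilityMeasure νX] [IsProbabilityMeasure νE] in
lemma popMean_eq_mul [SFinite νX] [SFinite νE] (t : ℝ) : popMean νX νE D i t
    = (∫ x, (x i : ℂ) * Complex.exp (Complex.I * t * D x) ∂νX) * errCharFun νE t := by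
  unfold popMean errCharFun
  rw [← integral_prod_mul]
  congr 1
  ext z
  rw [mul_assoc (z.1 i : ℂ), ← Complex.exp_add]
  congr 2
  ring

/-- `E X_i (exp(itD(X)) - 1)`. -/
noncomputable def drift (νX : Measure (EuclideanSpace ℝ (Fin p)))
    (D : EuclideanSpace ℝ (Fin p) → ℝ) (i : Fin p) (t : ℝ) : ℂ :=
  ∫ x, (x i : ℂ) * (Complex.exp (Complex.I * t * D x) - 1) ∂νX

omit [IsProbabilityMeasure νX] in
lemma integrable_coord_mul_exp (hX : Integrable (fun x => x i) νX) (hD : Measurable D) (t : ℝ) :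
    Integrable (fun x => (x i : ℂ) * Complex.exp (Complex.I * t * D x)) νX := by
  refine hX.norm.mono' ?_ (Eventually.of_forall fun x => ?_)
  · have := measurable_coord i
    exact Measurable.aestronglyMeasurable (by fun_prop)
  · have := norm_exp_I (t * D x)
    push_cast at this
    rw [← mul_assoc] at this
    rw [norm_mul, this, mul_one, Complex.norm_real]

/-- As the covariate is centred, independent of the error, only the drift survives. -/
lemma popMean_eq (hX : Integrable (fun x => x i) νX) (h0 : ∫ x, x i ∂νX = 0) (hD : Measurable D)
    (t : ℝ) : popMean νX νE D i t = drift νX D i t * errCharFun νE t := by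
  rw [popMean_eq_mul]
  congr 1
  unfold drift
  simp only [mul_sub, mul_one]
  have h1 : ∫ x, (x i : ℂ) ∂νX = 0 := by
    rw [integral_complex_ofReal, h0, Complex.ofReal_zero]
  have h2 : Integrable (fun x => (x i : ℂ)) νX := hX.ofReal
  rw [integral_sub (integrable_coord_mul_exp hX hD t) h2, h1, sub_zero]

omit [IsProbabilityMeasure νX] in
lemma integrable_coord_mul_exp_sub_one (hX : Integrable (fun x => x i) νX) (hD : Measurable D)
    (t : ℝ) : Integrable (fun x => (x i : ℂ) * (Complex.exp (Complex.I * t * D x) - 1)) νX := by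
  simp only [mul_sub, mul_one]
  exact (integrable_coord_mul_exp hX hD t).sub hX.ofReal

omit [IsProbabilityMeasure νX] in
lemma norm_drift_sub_le (hX : Integrable (fun x => x i) νX) (hD : Measurable D)
    (hXD : Integrable (fun x => x i * D x) νX) (t t' : ℝ) :
    ‖drift νX D i t - drift νX D i t'‖ ≤ |t - t'| * ∫ x, |x i * D x| ∂νX := by
  unfold drift
  rw [← integral_sub (integrable_coord_mul_exp_sub_one hX hD t)
    (integrable_coord_mul_exp_sub_one hX hD t'), ← integral_const_mul]
  refine norm_integral_le_of_norm_le (hXD.abs.const_mul _) (Eventually.of_forall fun x => ?_)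
  have := norm_exp_I_sub_exp_I_le (t * D x) (t' * D x)
  push_cast at this
  rw [← mul_assoc, ← mul_assoc, ← sub_mul, abs_mul] at this
  rw [← mul_sub, sub_sub_sub_cancel_right, norm_mul, Complex.norm_real, Real.norm_eq_abs, abs_mul]
  nlinarith [abs_nonneg (x i)]

omit [IsProbabilityMeasure νX] in
lemma drift_zero : drift νX D i 0 = 0 := by simp [drift]

omit [IsProbabilityMeasure νX] in
lemma norm_drift_le (hX : Integrable (fun x => x i) νX) (hD : Measurable D)
    (hXD : Integrable (fun x => x i * D x) νX) (t : ℝ) :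
    ‖drift νX D i t‖ ≤ |t| * ∫ x, |x i * D x| ∂νX := by
  simpa [drift_zero] using norm_drift_sub_le hX hD hXD t 0

lemma norm_popMean_le (hX : Integrable (fun x => x i) νX) (h0 : ∫ x, x i ∂νX = 0)
    (hD : Measurable D) (hXD : Integrable (fun x => x i * D x) νX) (t : ℝ) :
    ‖popMean νX νE D i t‖ ≤ |t| * ∫ x, |x i * D x| ∂νX := by
  rw [popMean_eq hX h0 hD, norm_mul]
  exact (mul_le_of_le_one_right (norm_nonneg _) (norm_errCharFun_le t)).trans
    (norm_drift_le hX hD hXD t)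

lemma norm_popMean_sub_le (hX : Integrable (fun x => x i) νX) (h0 : ∫ x, x i ∂νX = 0)
    (hD : Measurable D) (hXD : Integrable (fun x => x i * D x) νX)
    (hE : Integrable (fun e => e) νE) (t t' : ℝ) :
    ‖popMean νX νE D i t - popMean νX νE D i t'‖
      ≤ |t - t'| * (1 + |t'| * ∫ e, |e| ∂νE) * ∫ x, |x i * D x| ∂νX := by
  rw [popMean_eq hX h0 hD, popMean_eq hX h0 hD]
  set A := ∫ x, |x i * D x| ∂νX
  have hsplit : drift νX D i t * errCharFun νE t - drift νX D i t' * errCharFun νE t'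
      = (drift νX D i t - drift νX D i t') * errCharFun νE t
        + drift νX D i t' * (errCharFun νE t - errCharFun νE t') := by ring
  rw [hsplit]
  refine (norm_add_le _ _).trans ?_
  rw [norm_mul, norm_mul]
  have h1 : ‖drift νX D i t - drift νX D i t'‖ * ‖errCharFun νE t‖ ≤ |t - t'| * A :=
    (mul_le_of_le_one_right (norm_nonneg _) (norm_errCharFun_le t)).trans
      (norm_drift_sub_le hX hD hXD t t')
  have h2 := mul_le_mul (norm_drift_le hX hD hXD t') (norm_errCharFun_sub_le hE t t')
    (norm_nonneg _) (by positivity)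
  calc _ ≤ |t - t'| * A + |t'| * A * (|t - t'| * ∫ e, |e| ∂νE) := add_le_add h1 h2
    _ = _ := by ring

/-- The linear approximation `i t E(exp(itε)) E(X_i D(X))` of `popMean`. -/
noncomputable def linMean (νX : Measure (EuclideanSpace ℝ (Fin p))) (νE : Measure ℝ)
    (D : EuclideanSpace ℝ (Fin p) → ℝ) (i : Fin p) (t : ℝ) : ℂ :=
  Complex.I * t * errCharFun νE t * ((∫ x, x i * D x ∂νX : ℝ) : ℂ)

lemma popMean_sub_linMean (hX : Integrable (fun x => x i) νX) (h0 : ∫ x, x i ∂νX = 0)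
    (hD : Measurable D) (hXD : Integrable (fun x => x i * D x) νX) (t : ℝ) :
    popMean νX νE D i t - linMean νX νE D i t
      = (∫ x, (x i : ℂ) * (Complex.exp (Complex.I * ((t * D x : ℝ) : ℂ)) - 1
          - Complex.I * ((t * D x : ℝ) : ℂ)) ∂νX) * errCharFun νE t := by
  have h : ∀ x, (x i : ℂ) * (Complex.exp (Complex.I * ((t * D x : ℝ) : ℂ)) - 1
          - Complex.I * ((t * D x : ℝ) : ℂ))
      = (x i : ℂ) * (Complex.exp (Complex.I * t * D x) - 1)
        - Complex.I * t * ((x i * D x : ℝ) : ℂ) := fun x => by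
    push_cast
    rw [← mul_assoc Complex.I (t : ℂ)]
    ring
  simp only [h]
  have h2 : Integrable (fun x => ((x i * D x : ℝ) : ℂ)) νX := hXD.ofReal
  rw [integral_sub (integrable_coord_mul_exp_sub_one hX hD t) (h2.const_mul _),
    integral_const_mul, integral_complex_ofReal, popMean_eq hX h0 hD]
  unfold linMean drift
  ring

lemma norm_popMean_sub_linMean_le (hX : Integrable (fun x => x i) νX) (h0 : ∫ x, x i ∂νX = 0)
    (hD : Measurable D) (hXD : Integrable (fun x => x i * D x) νX) (t : ℝ) :
    ‖popMean νX νE D i t - linMean νX νE D i t‖ ≤ 2 * |t| * ∫ x, |x i * D x| ∂νX := by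
  rw [popMean_sub_linMean hX h0 hD hXD, norm_mul]
  refine (mul_le_of_le_one_right (norm_nonneg _) (norm_errCharFun_le t)).trans ?_
  rw [← integral_const_mul]
  refine norm_integral_le_of_norm_le (hXD.abs.const_mul _) (Eventually.of_forall fun x => ?_)
  have := norm_exp_I_sub_one_sub_le (t * D x)
  rw [norm_mul, Complex.norm_real, Real.norm_eq_abs, abs_mul (x i)]
  rw [abs_mul] at this
  nlinarith [abs_nonneg (x i)]

/-- Cauchy–Schwarz for nonnegative functions. -/
lemma sq_integral_mul_le {α : Type*} [MeasurableSpace α] {μ : Measure α} {f g : α → ℝ}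
    (hf : MemLp f 2 μ) (hg : MemLp g 2 μ) (hf0 : ∀ x, 0 ≤ f x) (hg0 : ∀ x, 0 ≤ g x) :
    (∫ x, f x * g x ∂μ) ^ 2 ≤ (∫ x, f x ^ 2 ∂μ) * ∫ x, g x ^ 2 ∂μ := by
  have h := integral_mul_le_Lp_mul_Lq_of_nonneg (μ := μ) (f := f) (g := g)
    Real.HolderConjugate.two_two (Eventually.of_forall hf0) (Eventually.of_forall hg0)
    (by simpa using hf) (by simpa using hg)
  have hfi : 0 ≤ ∫ x, f x ^ 2 ∂μ := integral_nonneg fun x => sq_nonneg _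
  have hgi : 0 ≤ ∫ x, g x ^ 2 ∂μ := integral_nonneg fun x => sq_nonneg _
  simp only [Real.rpow_ofNat] at h
  rw [← Real.sqrt_eq_rpow, ← Real.sqrt_eq_rpow] at h
  have h0 : 0 ≤ ∫ x, f x * g x ∂μ := integral_nonneg fun x => mul_nonneg (hf0 x) (hg0 x)
  calc _ ≤ (√(∫ x, f x ^ 2 ∂μ) * √(∫ x, g x ^ 2 ∂μ)) ^ 2 := pow_le_pow_left₀ h0 h 2
    _ = _ := by rw [mul_pow, Real.sq_sqrt hfi, Real.sq_sqrt hgi]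

/-- The Taylor remainder of order `3 / 2` needs only a second moment of `D(X)`, the remaining
integrability being taken from the covariate. -/
lemma sq_norm_popMean_sub_linMean_le (hX : Integrable (fun x => x i) νX) (h0 : ∫ x, x i ∂νX = 0)
    (hD : Measurable D) (hXD : Integrable (fun x => x i * D x) νX) (hD2 : MemLp D 2 νX)
    (hXXD : Integrable (fun x => x i ^ 2 * |D x|) νX) (t : ℝ) :
    ‖popMean νX νE D i t - linMean νX νE D i t‖ ^ 2
      ≤ 4 * |t| ^ 3 * ((∫ x, x i ^ 2 * |D x| ∂νX) * ∫ x, D x ^ 2 ∂νX) := by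
  rw [popMean_sub_linMean hX h0 hD hXD, norm_mul]
  have hm := measurable_coord i
  have hL : MemLp (fun x => |x i| * √|D x|) 2 νX := by
    rw [memLp_two_iff_integrable_sq (Measurable.aestronglyMeasurable (by fun_prop))]
    refine hXXD.congr (Eventually.of_forall fun x => ?_)
    simp only [mul_pow, sq_abs, Real.sq_sqrt (abs_nonneg _)]
  have hcs := sq_integral_mul_le hL hD2.norm (fun x => by positivity) (fun x => norm_nonneg _)
  simp only [mul_pow, sq_abs, Real.sq_sqrt (abs_nonneg _), Real.norm_eq_abs] at hcs
  have hint : Integrable (fun x => |x i| * √|D x| * |D x|) νX := by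
    have := hL.integrable_mul hD2.norm
    exact this
  have hb : ‖∫ x, (x i : ℂ) * (Complex.exp (Complex.I * ((t * D x : ℝ) : ℂ)) - 1
          - Complex.I * ((t * D x : ℝ) : ℂ)) ∂νX‖
      ≤ 2 * (|t| * √|t|) * ∫ x, |x i| * √|D x| * |D x| ∂νX := by
    rw [← integral_const_mul]
    refine norm_integral_le_of_norm_le (hint.const_mul _) (Eventually.of_forall fun x => ?_)
    have := norm_exp_I_sub_one_sub_le_sqrt (t * D x)
    rw [norm_mul, Complex.norm_real, Real.norm_eq_abs]
    rw [abs_mul, Real.sqrt_mul (abs_nonneg t)] at this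
    calc _ ≤ |x i| * (2 * (|t| * |D x| * (√|t| * √|D x|))) :=
          mul_le_mul_of_nonneg_left this (abs_nonneg _)
      _ = _ := by ring
  have hle : _ * ‖errCharFun νE t‖ ≤ _ :=
    (mul_le_of_le_one_right (norm_nonneg _) (norm_errCharFun_le t)).trans hb
  calc _ ≤ (2 * (|t| * √|t|) * ∫ x, |x i| * √|D x| * |D x| ∂νX) ^ 2 :=
        pow_le_pow_left₀ (by positivity) hle 2
    _ = 4 * (|t| ^ 2 * √|t| ^ 2) * (∫ x, |x i| * √|D x| * |D x| ∂νX) ^ 2 := by ring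
    _ ≤ _ := by
      rw [Real.sq_sqrt (abs_nonneg _), ← pow_succ]
      exact mul_le_mul_of_nonneg_left hcs (by positivity)

end Population

/-! ### Fluctuations of the weighted residual process -/

section Fluctuation

variable {Ω : Type*} [MeasurableSpace Ω] {P : Measure Ω} [IsProbabilityMeasure P] {p : ℕ}
  {νX : Measure (EuclideanSpace ℝ (Fin p))} [IsProbabilityMeasure νX]
  {νE : Measure ℝ} [IsProbabilityMeasure νE]
  {Z : ℕ → Ω → EuclideanSpace ℝ (Fin p) × ℝ}

omit [IsProbabilityMeasure νX] [IsProbabilityMeasure νE] in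
lemma measurable_popMean [SFinite νX] [SFinite νE] {D : EuclideanSpace ℝ (Fin p) → ℝ}
    (hD : Measurable D) (i : Fin p) : Measurable (popMean νX νE D i) := by
  have hm := measurable_coord i
  have : StronglyMeasurable fun q : ℝ × (EuclideanSpace ℝ (Fin p) × ℝ) =>
      (q.2.1 i : ℂ) * Complex.exp (Complex.I * q.1 * (q.2.2 + D q.2.1)) :=
    Measurable.stronglyMeasurable (by fun_prop)
  exact this.integral_prod_right'.measurable

lemma norm_popMean_le_const {D : EuclideanSpace ℝ (Fin p) → ℝ} (i : Fin p)
    (hX : Integrable (fun x => x i) νX) (t : ℝ) :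
    ‖popMean νX νE D i t‖ ≤ ∫ x, |x i| ∂νX := by
  have h : ∫ x, |x i| ∂νX = ∫ z, |z.1 i| ∂(νX.prod νE) := by
    rw [integral_fun_fst (μ := νX) (ν := νE) (f := fun x : EuclideanSpace ℝ (Fin p) => |x i|)]
    simp
  rw [h]
  refine norm_integral_le_of_norm_le (hX.abs.comp_fst νE) (Eventually.of_forall fun z => ?_)
  have := norm_exp_I (t * (z.2 + D z.1))
  push_cast at this
  rw [← mul_assoc] at this
  rw [norm_mul, this, mul_one, Complex.norm_real, Real.norm_eq_abs]

lemma exp_I_mul_mul (t a : ℝ) : Complex.exp (Complex.I * t * a)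
    = (Real.cos (t * a) : ℂ) + (Real.sin (t * a) : ℂ) * Complex.I := by
  rw [mul_assoc, ← Complex.ofReal_mul, mul_comm, Complex.exp_mul_I, Complex.ofReal_cos,
    Complex.ofReal_sin]

lemma mHat_re (n : ℕ) (x : ℕ → EuclideanSpace ℝ (Fin p)) (e : ℕ → ℝ) (t : ℝ) (i : Fin p) :
    (mHat n x e t i).re = avg n fun j => x j i * Real.cos (t * e j) := by
  have : ((n : ℂ)⁻¹) = (((n : ℝ)⁻¹ : ℝ) : ℂ) := by push_cast; rfl
  simp only [mHat, exp_I_mul_mul, this, Complex.re_ofReal_mul, Complex.re_sum, avg]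
  simp [-Complex.ofReal_cos, -Complex.ofReal_sin]

lemma mHat_im (n : ℕ) (x : ℕ → EuclideanSpace ℝ (Fin p)) (e : ℕ → ℝ) (t : ℝ) (i : Fin p) :
    (mHat n x e t i).im = avg n fun j => x j i * Real.sin (t * e j) := by
  have : ((n : ℂ)⁻¹) = (((n : ℝ)⁻¹ : ℝ) : ℂ) := by push_cast; rfl
  simp only [mHat, exp_I_mul_mul, this, Complex.im_ofReal_mul, Complex.im_sum, avg]
  simp [-Complex.ofReal_cos, -Complex.ofReal_sin]

lemma avg_sub_const {n : ℕ} (hn : 1 ≤ n) (a : ℕ → ℝ) (c : ℝ) :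
    avg n (fun j => a j - c) = avg n a - c := by
  have := avg_add n a fun _ => -c
  rw [avg_const hn] at this
  simpa [sub_eq_add_neg] using this

/-- With a deterministic drift, the weighted residual process evaluated at the residuals deviates
from its population version by `O_P(n^{-1/2})` in mean square. The real and imaginary parts are
averages of degenerate kernels. -/
lemma IsSample.bddInProb_mHat_sub_popMean (hZ : IsSample P Z (νX.prod νE))
    {D : ℕ → EuclideanSpace ℝ (Fin p) → ℝ} (hD : ∀ n, Measurable (D n)) (i : Fin p)
    (hX : MemLp (fun x => x i) 2 νX) :
    BddInProb P fun n ω => n * avg n fun k => ‖mHat n (fun j => (Z j ω).1)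
      (fun j => (Z j ω).2 + D n (Z j ω).1) ((Z k ω).2 + D n (Z k ω).1) i
      - popMean νX νE (D n) i ((Z k ω).2 + D n (Z k ω).1)‖ ^ 2 := by
  have hm := measurable_coord i
  have hX1 : Integrable (fun x => x i) νX := hX.integrable one_le_two
  set A := ∫ x, |x i| ∂νX
  set H : EuclideanSpace ℝ (Fin p) × ℝ → ℝ := fun z => |z.1 i| + A
  have hH : MemLp H 2 (νX.prod νE) := (hX.norm.comp_fst νE).add (memLp_const A)
  refine bddInProb_of_integral_le (C := 2 * ∫ z, H z ^ 2 ∂(νX.prod νE))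
    (fun n ω => mul_nonneg (Nat.cast_nonneg n) (avg_nonneg fun k => sq_nonneg _)) ?_
  filter_upwards [eventually_ge_atTop 1] with n hn
  set q : EuclideanSpace ℝ (Fin p) × ℝ → ℝ := fun z => z.2 + D n z.1
  have hq : Measurable q := measurable_snd.add ((hD n).comp measurable_fst)
  set μ := popMean νX νE (D n) i
  have hμ : Measurable μ := measurable_popMean (hD n) i
  have hμA : ∀ t, ‖μ t‖ ≤ A := norm_popMean_le_const i hX1
  set fc : EuclideanSpace ℝ (Fin p) × ℝ → EuclideanSpace ℝ (Fin p) × ℝ → ℝ :=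
    fun z z' => z.1 i * Real.cos (q z' * q z) - (μ (q z')).re
  set fs : EuclideanSpace ℝ (Fin p) × ℝ → EuclideanSpace ℝ (Fin p) × ℝ → ℝ :=
    fun z z' => z.1 i * Real.sin (q z' * q z) - (μ (q z')).im
  have hfc : Measurable fun y : (EuclideanSpace ℝ (Fin p) × ℝ) × _ => fc y.1 y.2 := by
    simp only [fc]; fun_prop
  have hfs : Measurable fun y : (EuclideanSpace ℝ (Fin p) × ℝ) × _ => fs y.1 y.2 := by
    simp only [fs]; fun_prop
  have hXf : Integrable (fun z : EuclideanSpace ℝ (Fin p) × ℝ => z.1 i) (νX.prod νE) :=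
    hX1.comp_fst νE
  have hic : ∀ t, Integrable (fun z : EuclideanSpace ℝ (Fin p) × ℝ =>
      z.1 i * Real.cos (t * q z)) (νX.prod νE) := fun t =>
    hXf.norm.mono' (Measurable.aestronglyMeasurable (by fun_prop))
      (Eventually.of_forall fun z => by
        rw [norm_mul]
        exact mul_le_of_le_one_right (norm_nonneg _) (Real.abs_cos_le_one _))
  have his : ∀ t, Integrable (fun z : EuclideanSpace ℝ (Fin p) × ℝ =>
      z.1 i * Real.sin (t * q z)) (νX.prod νE) := fun t =>
    hXf.norm.mono' (Measurable.aestronglyMeasurable (by fun_prop))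
      (Eventually.of_forall fun z => by
        rw [norm_mul]
        exact mul_le_of_le_one_right (norm_nonneg _) (Real.abs_sin_le_one _))
  have hμe : ∀ t, μ t = ((∫ z, z.1 i * Real.cos (t * q z) ∂(νX.prod νE) : ℝ) : ℂ)
      + ((∫ z, z.1 i * Real.sin (t * q z) ∂(νX.prod νE) : ℝ) : ℂ) * Complex.I := fun t => by
    have h1 : Integrable (fun z : EuclideanSpace ℝ (Fin p) × ℝ =>
      ((z.1 i * Real.cos (t * q z) : ℝ) : ℂ)) (νX.prod νE) := (hic t).ofReal
    have h2 : Integrable (fun z : EuclideanSpace ℝ (Fin p) × ℝ =>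
      ((z.1 i * Real.sin (t * q z) : ℝ) : ℂ) * Complex.I) (νX.prod νE) :=
      (his t).ofReal.mul_const _
    rw [← integral_complex_ofReal, ← integral_complex_ofReal, ← integral_mul_const,
      ← integral_add h1 h2]
    simp only [μ, popMean]
    congr 1
    ext z
    have := exp_I_mul_mul t (q z)
    simp only [q] at this ⊢
    push_cast at this ⊢
    rw [this]
    ring
  have h0c : ∀ z', ∫ z, fc z z' ∂(νX.prod νE) = 0 := fun z' => by
    simp only [fc]
    rw [integral_sub (hic _) (integrable_const _), hμe]
    simp
  have h0s : ∀ z', ∫ z, fs z z' ∂(νX.prod νE) = 0 := fun z' => by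
    simp only [fs]
    rw [integral_sub (his _) (integrable_const _), hμe]
    simp
  have hHc : ∀ z z', |fc z z'| ≤ H z := fun z z' => by
    refine (abs_sub _ _).trans (add_le_add ?_ ((Complex.abs_re_le_norm _).trans (hμA _)))
    rw [abs_mul]
    exact mul_le_of_le_one_right (abs_nonneg _) (Real.abs_cos_le_one _)
  have hHs : ∀ z z', |fs z z'| ≤ H z := fun z z' => by
    refine (abs_sub _ _).trans (add_le_add ?_ ((Complex.abs_im_le_norm _).trans (hμA _)))
    rw [abs_mul]
    exact mul_le_of_le_one_right (abs_nonneg _) (Real.abs_sin_le_one _)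
  have hc := hZ.kernel_bound hfc h0c hH hHc hn
  have hs := hZ.kernel_bound hfs h0s hH hHs hn
  have heq : ∀ ω, (n : ℝ) * avg n (fun k => ‖mHat n (fun j => (Z j ω).1)
      (fun j => (Z j ω).2 + D n (Z j ω).1) ((Z k ω).2 + D n (Z k ω).1) i
      - μ ((Z k ω).2 + D n (Z k ω).1)‖ ^ 2)
      = n * avg n (fun k => avg n (fun j => fc (Z j ω) (Z k ω)) ^ 2)
        + n * avg n (fun k => avg n (fun j => fs (Z j ω) (Z k ω)) ^ 2) := fun ω => by
    rw [← mul_add, ← avg_add]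
    congr 2
    ext k
    rw [avg_sub_const hn, avg_sub_const hn, ← Complex.normSq_eq_norm_sq, Complex.normSq_apply,
      Complex.sub_re, Complex.sub_im, mHat_re, mHat_im, sq, sq]
  simp only [heq]
  refine ⟨(hc.1.const_mul _).add (hs.1.const_mul _), ?_⟩
  rw [integral_add (hc.1.const_mul _) (hs.1.const_mul _), integral_const_mul, integral_const_mul]
  linarith [hc.2, hs.2]

/-- Perturbing the residuals by `h F_j` perturbs the weighted residual process, evaluated at the
residuals themselves, by at most `h V_k n⁻¹ ∑_j |x_j| V_j`, where `V_j = |η_j| + F_j`. -/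
lemma norm_mHat_sub_mHat_le {n : ℕ} {x : ℕ → EuclideanSpace ℝ (Fin p)} {e η F : ℕ → ℝ} {h : ℝ}
    (hh0 : 0 ≤ h) (hh1 : h ≤ 1) (hF : ∀ j, 0 ≤ F j) (he : ∀ j < n, |e j - η j| ≤ h * F j)
    {k : ℕ} (hk : k < n) (i : Fin p) :
    ‖mHat n x e (e k) i - mHat n x η (η k) i‖
      ≤ h * (|η k| + F k) * avg n fun j => |x j i| * (|η j| + F j) := by
  have hterm : ∀ j < n, |e k * e j - η k * η j| ≤ h * ((|η k| + F k) * (|η j| + F j)) := by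
    intro j hj
    have h1 := he k hk
    have h2 := he j hj
    have hFk := hF k
    have hFj := hF j
    have heq : e k * e j - η k * η j
        = η k * (e j - η j) + (e k - η k) * (e j - η j) + (e k - η k) * η j := by ring
    have a1 : |η k * (e j - η j)| ≤ |η k| * (h * F j) := by
      rw [abs_mul]; exact mul_le_mul_of_nonneg_left h2 (abs_nonneg _)
    have a2 : |(e k - η k) * (e j - η j)| ≤ h * F k * F j := by
      rw [abs_mul]
      refine (mul_le_mul h1 h2 (abs_nonneg _) (by positivity)).trans ?_
      have : 0 ≤ h * F k * F j := by positivity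
      nlinarith
    have a3 : |(e k - η k) * η j| ≤ h * F k * |η j| := by
      rw [abs_mul]; exact mul_le_mul_of_nonneg_right h1 (abs_nonneg _)
    rw [heq]
    refine (abs_add_three _ _ _).trans ?_
    have : 0 ≤ h * (|η k| * |η j|) := by positivity
    nlinarith
  have hsub : mHat n x e (e k) i - mHat n x η (η k) i
      = (n : ℂ)⁻¹ * ∑ j ∈ Finset.range n, (x j i : ℂ) *
        (Complex.exp (Complex.I * ((e k * e j : ℝ) : ℂ))
          - Complex.exp (Complex.I * ((η k * η j : ℝ) : ℂ))) := by
    simp only [mHat]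
    rw [← mul_sub, ← Finset.sum_sub_distrib]
    congr 1
    refine Finset.sum_congr rfl fun j _ => ?_
    push_cast
    rw [mul_sub, mul_assoc Complex.I, mul_assoc Complex.I]
  rw [hsub, norm_mul, norm_inv, Complex.norm_natCast, avg, mul_left_comm]
  refine mul_le_mul_of_nonneg_left ?_ (by positivity)
  refine (norm_sum_le _ _).trans ?_
  rw [Finset.mul_sum]
  refine Finset.sum_le_sum fun j hj => ?_
  rw [norm_mul, Complex.norm_real, Real.norm_eq_abs]
  have := (norm_exp_I_sub_exp_I_le _ _).trans (hterm j (Finset.mem_range.1 hj))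
  calc _ ≤ |x j i| * (h * ((|η k| + F k) * (|η j| + F j))) :=
        mul_le_mul_of_nonneg_left this (abs_nonneg _)
    _ = _ := by ring

/-- Conditions on a sequence of drifts `D n`, of order `δ n`, in the model with residuals
`ε + D n (X)`; `U` is a square integrable bound for `D n / δ n`. -/
structure DriftConditions (νX : Measure (EuclideanSpace ℝ (Fin p))) (νE : Measure ℝ)
    (D : ℕ → EuclideanSpace ℝ (Fin p) → ℝ) (U : EuclideanSpace ℝ (Fin p) → ℝ)
    (δ : ℕ → ℝ) : Prop where
  coord_sq : ∀ i, MemLp (fun x => x i) 2 νX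
  coord_mean : ∀ i, ∫ x, x i ∂νX = 0
  err_sq : MemLp (fun e => e) 2 νE
  measurable_drift : ∀ n, Measurable (D n)
  bound_nonneg : ∀ x, 0 ≤ U x
  bound_sq : MemLp U 2 νX
  drift_le : ∀ᶠ n in atTop, ∀ x, |D n x| ≤ δ n * U x
  scale_pos : ∀ᶠ n in atTop, 0 < δ n
  scale_le : ∀ᶠ n in atTop, δ n ≤ 1

/-- The residuals `e n j`, `j < n`, differ from `ε_j + D n (X_j)` by at most
`O_P(n^{-1/2}) F(X_j)`. -/
structure ResidualConditions (P : Measure Ω) (Z : ℕ → Ω → EuclideanSpace ℝ (Fin p) × ℝ)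
    (νX : Measure (EuclideanSpace ℝ (Fin p))) (D : ℕ → EuclideanSpace ℝ (Fin p) → ℝ)
    (e : ℕ → ℕ → Ω → ℝ) (F : EuclideanSpace ℝ (Fin p) → ℝ) (h : ℕ → Ω → ℝ) : Prop where
  bound_nonneg : ∀ x, 0 ≤ F x
  bound_sq : MemLp F 2 νX
  rate_nonneg : ∀ n ω, 0 ≤ h n ω
  rate : BddInProb P fun n ω => n * h n ω ^ 2
  residual_sub_le : WithHighProb P fun n ω =>
    ∀ j < n, |e n j ω - ((Z j ω).2 + D n (Z j ω).1)| ≤ h n ω * F (Z j ω).1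

variable {D : ℕ → EuclideanSpace ℝ (Fin p) → ℝ} {U F : EuclideanSpace ℝ (Fin p) → ℝ}
  {δ : ℕ → ℝ} {e : ℕ → ℕ → Ω → ℝ} {h : ℕ → Ω → ℝ}

lemma norm_add_sq_le_two {E : Type*} [SeminormedAddCommGroup E] (a b : E) :
    ‖a + b‖ ^ 2 ≤ 2 * ‖a‖ ^ 2 + 2 * ‖b‖ ^ 2 := by
  have := pow_le_pow_left₀ (norm_nonneg _) (norm_add_le a b) 2
  nlinarith [sq_nonneg (‖a‖ - ‖b‖)]

lemma DriftConditions.memLp_envelope (hDr : DriftConditions νX νE D U δ) (hF : MemLp F 2 νX) :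
    MemLp (fun z : EuclideanSpace ℝ (Fin p) × ℝ => |z.2| + U z.1 + F z.1) 2 (νX.prod νE) :=
  ((hDr.err_sq.norm.comp_snd νX).add (hDr.bound_sq.comp_fst νE)).add (hF.comp_fst νE)

/-- The weighted residual process, evaluated at the residuals, deviates by `O_P(n^{-1/2})` in mean
square from its population version at the drift `D n`. -/
lemma ResidualConditions.bddInProb_mHat_sub (hZ : IsSample P Z (νX.prod νE))
    (hDr : DriftConditions νX νE D U δ) (hRe : ResidualConditions P Z νX D e F h) (i : Fin p) :
    BddInProb P fun n ω => n * avg n fun k => ‖mHat n (fun j => (Z j ω).1)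
      (fun j => e n j ω) (e n k ω) i
      - popMean νX νE (D n) i ((Z k ω).2 + D n (Z k ω).1)‖ ^ 2 := by
  set V : EuclideanSpace ℝ (Fin p) × ℝ → ℝ := fun z => |z.2| + U z.1 + F z.1 with hVdef
  have hV : MemLp V 2 (νX.prod νE) := hDr.memLp_envelope hRe.bound_sq
  have hV0 : ∀ z, 0 ≤ V z := fun z =>
    add_nonneg (add_nonneg (abs_nonneg _) (hDr.bound_nonneg _)) (hRe.bound_nonneg _)
  have hXf : MemLp (fun z : EuclideanSpace ℝ (Fin p) × ℝ => z.1 i) 2 (νX.prod νE) :=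
    (hDr.coord_sq i).comp_fst νE
  have bV := hZ.bddInProb_avg hV.integrable_sq fun z => sq_nonneg _
  have bXV : BddInProb P fun n ω => avg n fun j => |(Z j ω).1 i| * V (Z j ω) :=
    hZ.bddInProb_avg (f := fun z => |z.1 i| * V z) (hXf.norm.integrable_mul hV)
      fun z => mul_nonneg (abs_nonneg _) (hV0 z)
  have hXV0 : ∀ n ω, 0 ≤ avg n fun j => |(Z j ω).1 i| * V (Z j ω) := fun n ω =>
    avg_nonneg fun j => mul_nonneg (abs_nonneg _) (hV0 _)
  have hV20 : ∀ n ω, 0 ≤ avg n fun j => V (Z j ω) ^ 2 := fun n ω =>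
    avg_nonneg fun j => sq_nonneg _
  have hnh : ∀ (n : ℕ) ω, 0 ≤ (n : ℝ) * h n ω ^ 2 := fun n ω => by positivity
  have b1 := ((hRe.rate.mul bV hnh hV20).mul (bXV.mul bXV hXV0 hXV0)
    (fun n ω => mul_nonneg (hnh n ω) (hV20 n ω))
    (fun n ω => mul_nonneg (hXV0 n ω) (hXV0 n ω))).const_mul zero_le_two
  have b2 := (hZ.bddInProb_mHat_sub_popMean hDr.measurable_drift i (hDr.coord_sq i)).const_mul
    zero_le_two
  have hsmall : WithHighProb P fun n ω => ((n : ℝ)⁻¹) * (n * h n ω ^ 2) ≤ 1 :=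
    hRe.rate.withHighProb_mul_le tendsto_inv_atTop_nhds_zero_nat
      (Eventually.of_forall fun n => by positivity) one_pos
  refine (b1.add b2).mono ?_
  refine (hsmall.and hRe.residual_sub_le).mono ?_
  filter_upwards [eventually_ge_atTop 1, hDr.drift_le, hDr.scale_le] with n hn hD hδ ω ⟨h1, h2⟩
  have hn0 : (n : ℝ) ≠ 0 := by positivity
  have hh1 : h n ω ≤ 1 := by
    rw [← mul_assoc, inv_mul_cancel₀ hn0, one_mul] at h1
    exact (sq_le_one_iff₀ (hRe.rate_nonneg n ω)).1 h1
  set W := avg n fun j => |(Z j ω).1 i| * V (Z j ω)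
  have hηV : ∀ j, |(Z j ω).2 + D n (Z j ω).1| + F (Z j ω).1 ≤ V (Z j ω) := fun j => by
    have h3 := hD (Z j ω).1
    have h4 := hDr.bound_nonneg (Z j ω).1
    have h5 := abs_add_le (Z j ω).2 (D n (Z j ω).1)
    simp only [hVdef]
    nlinarith
  have hk : ∀ k < n, ‖mHat n (fun j => (Z j ω).1) (fun j => e n j ω) (e n k ω) i
      - popMean νX νE (D n) i ((Z k ω).2 + D n (Z k ω).1)‖ ^ 2
      ≤ 2 * (h n ω ^ 2 * W ^ 2) * V (Z k ω) ^ 2 + 2 * ‖mHat n (fun j => (Z j ω).1)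
      (fun j => (Z j ω).2 + D n (Z j ω).1) ((Z k ω).2 + D n (Z k ω).1) i
      - popMean νX νE (D n) i ((Z k ω).2 + D n (Z k ω).1)‖ ^ 2 := by
    intro k hk
    rw [← sub_add_sub_cancel _ (mHat n (fun j => (Z j ω).1)
      (fun j => (Z j ω).2 + D n (Z j ω).1) ((Z k ω).2 + D n (Z k ω).1) i)]
    refine (norm_add_sq_le_two _ _).trans ?_
    have hb := norm_mHat_sub_mHat_le (x := fun j => (Z j ω).1) (e := fun j => e n j ω)
      (η := fun j => (Z j ω).2 + D n (Z j ω).1) (F := fun j => F (Z j ω).1)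
      (hRe.rate_nonneg n ω) hh1 (fun j => hRe.bound_nonneg _) h2 hk i
    have hW : (avg n fun j => |(Z j ω).1 i| * (|(Z j ω).2 + D n (Z j ω).1| + F (Z j ω).1)) ≤ W :=
      avg_le_avg fun j _ => mul_le_mul_of_nonneg_left (hηV j) (abs_nonneg _)
    have hb2 := hb.trans (mul_le_mul (mul_le_mul_of_nonneg_left (hηV k) (hRe.rate_nonneg n ω)) hW
      (avg_nonneg fun j => mul_nonneg (abs_nonneg _)
        (add_nonneg (abs_nonneg _) (hRe.bound_nonneg _)))
      (mul_nonneg (hRe.rate_nonneg n ω) (hV0 _)))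
    have hb3 := pow_le_pow_left₀ (norm_nonneg _) hb2 2
    have : (h n ω * V (Z k ω) * W) ^ 2 = (h n ω ^ 2 * W ^ 2) * V (Z k ω) ^ 2 := by ring
    rw [this] at hb3
    linarith
  have := mul_le_mul_of_nonneg_left (avg_le_avg hk) (Nat.cast_nonneg (α := ℝ) n)
  rw [avg_add, avg_const_mul, avg_const_mul] at this
  refine this.trans (le_of_eq ?_)
  ring

end Fluctuation

/-! ### Eigenvalues of the estimated target matrix -/

section Eigenvalues

variable {Ω : Type*} [MeasurableSpace Ω] {P : Measure Ω} [IsProbabilityMeasure P] {p : ℕ}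
  {νX : Measure (EuclideanSpace ℝ (Fin p))} [IsProbabilityMeasure νX]
  {νE : Measure ℝ} [IsProbabilityMeasure νE]
  {Z : ℕ → Ω → EuclideanSpace ℝ (Fin p) × ℝ}
  {D : ℕ → EuclideanSpace ℝ (Fin p) → ℝ} {U F : EuclideanSpace ℝ (Fin p) → ℝ}
  {δ : ℕ → ℝ} {e : ℕ → ℕ → Ω → ℝ} {h : ℕ → Ω → ℝ}

/-- The `j`-th largest eigenvalue of `M̂_n` for the sample `Z` and residuals `e n j`. -/
noncomputable def sampleEigenvalue (Z : ℕ → Ω → EuclideanSpace ℝ (Fin p) × ℝ)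
    (e : ℕ → ℕ → Ω → ℝ) (n : ℕ) (ω : Ω) : ℕ → ℝ :=
  orderedEigenvalue (MHat_isHermitian n (fun j => (Z j ω).1) fun j => e n j ω)

/-- `m̂_n` at the `k`-th residual. -/
noncomputable def sampleMean (Z : ℕ → Ω → EuclideanSpace ℝ (Fin p) × ℝ)
    (e : ℕ → ℕ → Ω → ℝ) (n : ℕ) (ω : Ω) (k : ℕ) : Fin p → ℂ :=
  mHat n (fun j => (Z j ω).1) (fun j => e n j ω) (e n k ω)

omit [MeasurableSpace Ω] in
lemma sampleEigenvalue_nonneg (n : ℕ) (ω : Ω) (j : ℕ) : 0 ≤ sampleEigenvalue Z e n ω j :=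
  orderedEigenvalue_nonneg (outerAverage_posSemidef n (sampleMean Z e n ω)) j

omit [MeasurableSpace Ω] in
lemma sampleEigenvalue_succ_le (n : ℕ) (ω : Ω) (j : ℕ) (hj : 1 ≤ j) :
    sampleEigenvalue Z e n ω (j + 1) ≤ sampleEigenvalue Z e n ω j :=
  orderedEigenvalue_succ_le (outerAverage_posSemidef n (sampleMean Z e n ω)) j hj

omit [MeasurableSpace Ω] in
lemma sampleEigenvalue_one_le (n : ℕ) (ω : Ω) : sampleEigenvalue Z e n ω 1
    ≤ avg n fun k => ∑ i, ‖sampleMean Z e n ω k i‖ ^ 2 :=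
  (orderedEigenvalue_one_le_trace (outerAverage_posSemidef n (sampleMean Z e n ω))).trans
    (trace_outerAverage n _).le

omit [MeasurableSpace Ω] in
lemma le_sampleEigenvalue_one (n : ℕ) (ω : Ω) :
    (avg n fun k => ∑ i, ‖sampleMean Z e n ω k i‖ ^ 2) ≤ p * sampleEigenvalue Z e n ω 1 :=
  (trace_outerAverage n _).ge.trans
    (trace_le_mul_orderedEigenvalue_one (outerAverage_posSemidef n (sampleMean Z e n ω)))

omit [MeasurableSpace Ω] in
lemma sampleEigenvalue_two_le (n : ℕ) (ω : Ω) (a : ℕ → ℂ) (w : Fin p → ℂ) :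
    sampleEigenvalue Z e n ω 2 ≤ avg n fun k => ∑ i, ‖sampleMean Z e n ω k i - a k * w i‖ ^ 2 :=
  orderedEigenvalue_two_outerAverage_le n (sampleMean Z e n ω) a w

lemma avg_sum {ι : Type*} (s : Finset ι) (n : ℕ) (a : ℕ → ι → ℝ) :
    avg n (fun k => ∑ i ∈ s, a k i) = ∑ i ∈ s, avg n fun k => a k i := by
  simp only [avg]
  rw [Finset.sum_comm, Finset.mul_sum]

lemma ResidualConditions.bddInProb_sum_sampleMean_sub (hZ : IsSample P Z (νX.prod νE))
    (hDr : DriftConditions νX νE D U δ) (hRe : ResidualConditions P Z νX D e F h) :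
    BddInProb P fun n ω => n * avg n fun k => ∑ i, ‖sampleMean Z e n ω k i
      - popMean νX νE (D n) i ((Z k ω).2 + D n (Z k ω).1)‖ ^ 2 := by
  simp only [avg_sum, Finset.mul_sum]
  exact BddInProb.sum _ fun i _ => hRe.bddInProb_mHat_sub hZ hDr i

omit [IsProbabilityMeasure νE] in
lemma DriftConditions.integrable_coord (hDr : DriftConditions νX νE D U δ) (i : Fin p) :
    Integrable (fun x => x i) νX := (hDr.coord_sq i).integrable one_le_two

omit [IsProbabilityMeasure νX] in
lemma DriftConditions.integrable_err (hDr : DriftConditions νX νE D U δ) :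
    Integrable (fun e => e) νE := hDr.err_sq.integrable one_le_two

omit [IsProbabilityMeasure νX] [IsProbabilityMeasure νE] in
lemma DriftConditions.integrable_coord_mul_bound (hDr : DriftConditions νX νE D U δ) (i : Fin p) :
    Integrable (fun x => |x i| * U x) νX :=
  (hDr.coord_sq i).norm.integrable_mul hDr.bound_sq

omit [IsProbabilityMeasure νX] [IsProbabilityMeasure νE] in
/-- The drift is square integrable, with `E|X_i D_n(X)| = O(δ n)`. -/
lemma DriftConditions.eventually_moments (hDr : DriftConditions νX νE D U δ) (i : Fin p) :
    ∀ᶠ n in atTop, MemLp (D n) 2 νX ∧ Integrable (fun x => x i * D n x) νX ∧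
      ∫ x, |x i * D n x| ∂νX ≤ δ n * ∫ x, |x i| * U x ∂νX := by
  filter_upwards [hDr.drift_le] with n hn
  have h1 : MemLp (D n) 2 νX := (hDr.bound_sq.const_mul (δ n)).mono
    (hDr.measurable_drift n).aestronglyMeasurable
    (Eventually.of_forall fun x => (hn x).trans (le_abs_self _))
  have h2 : Integrable (fun x => x i * D n x) νX := (hDr.coord_sq i).integrable_mul h1
  refine ⟨h1, h2, ?_⟩
  rw [← integral_const_mul]
  refine integral_mono h2.abs ((hDr.integrable_coord_mul_bound i).const_mul _) fun x => ?_
  simp only [abs_mul]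
  have := mul_le_mul_of_nonneg_left (hn x) (abs_nonneg (x i))
  linarith

/-- Under drifts of order `n^{-1/2}` all eigenvalues are `O_P(1/n)`. -/
lemma bddInProb_sampleEigenvalue_one (hZ : IsSample P Z (νX.prod νE))
    (hDr : DriftConditions νX νE D U δ) (hRe : ResidualConditions P Z νX D e F h) {K : ℝ}
    (hδ : ∀ᶠ n : ℕ in atTop, n * δ n ^ 2 ≤ K) :
    BddInProb P fun n ω => n * sampleEigenvalue Z e n ω 1 := by
  set V : EuclideanSpace ℝ (Fin p) × ℝ → ℝ := fun z => |z.2| + U z.1 + F z.1 with hVdef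
  have hV : MemLp V 2 (νX.prod νE) := hDr.memLp_envelope hRe.bound_sq
  have bV := hZ.bddInProb_avg hV.integrable_sq fun z => sq_nonneg _
  set A : Fin p → ℝ := fun i => ∫ x, |x i| * U x ∂νX
  have b1 := (hRe.bddInProb_sum_sampleMean_sub hZ hDr).const_mul zero_le_two
  have b2 := bV.const_mul (c := 2 * (|K| * ∑ i, A i ^ 2)) (by positivity)
  refine (b1.add b2).mono (withHighProb_of_eventually ?_)
  have hall : ∀ᶠ n in atTop, ∀ i, MemLp (D n) 2 νX ∧ Integrable (fun x => x i * D n x) νX ∧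
      ∫ x, |x i * D n x| ∂νX ≤ δ n * ∫ x, |x i| * U x ∂νX :=
    eventually_all.2 fun i => hDr.eventually_moments i
  filter_upwards [hδ, hDr.drift_le, hDr.scale_le, hDr.scale_pos, hall]
    with n hn hD hδ1 hδ0 hmom ω
  have hk : ∀ k < n, ∑ i, ‖sampleMean Z e n ω k i‖ ^ 2
      ≤ 2 * ∑ i, ‖sampleMean Z e n ω k i
        - popMean νX νE (D n) i ((Z k ω).2 + D n (Z k ω).1)‖ ^ 2
        + 2 * (δ n ^ 2 * ∑ i, A i ^ 2) * V (Z k ω) ^ 2 := by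
    intro k _
    rw [Finset.mul_sum, Finset.mul_sum, Finset.mul_sum, Finset.sum_mul, ← Finset.sum_add_distrib]
    refine Finset.sum_le_sum fun i _ => ?_
    set t := (Z k ω).2 + D n (Z k ω).1 with ht
    have htV : |t| ≤ V (Z k ω) := by
      have h3 := hD (Z k ω).1
      have h4 := hDr.bound_nonneg (Z k ω).1
      have h6 := hRe.bound_nonneg (Z k ω).1
      have h5 := abs_add_le (Z k ω).2 (D n (Z k ω).1)
      simp only [hVdef, ht]
      nlinarith
    have hpm : ‖popMean νX νE (D n) i t‖ ≤ V (Z k ω) * (δ n * A i) :=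
      (norm_popMean_le (hDr.integrable_coord i) (hDr.coord_mean i) (hDr.measurable_drift n)
        (hmom i).2.1 t).trans (mul_le_mul htV (hmom i).2.2
          (integral_nonneg fun x => abs_nonneg _) ((abs_nonneg _).trans htV))
    have hpm2 := pow_le_pow_left₀ (norm_nonneg _) hpm 2
    have hsplit := norm_add_sq_le_two (sampleMean Z e n ω k i - popMean νX νE (D n) i t)
      (popMean νX νE (D n) i t)
    rw [sub_add_cancel] at hsplit
    refine hsplit.trans ?_
    have : (V (Z k ω) * (δ n * A i)) ^ 2 = δ n ^ 2 * A i ^ 2 * V (Z k ω) ^ 2 := by ring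
    rw [this] at hpm2
    linarith
  have h1 := (sampleEigenvalue_one_le (Z := Z) (e := e) n ω).trans (avg_le_avg hk)
  rw [avg_add, avg_const_mul, avg_const_mul] at h1
  have h2 := mul_le_mul_of_nonneg_left h1 (Nat.cast_nonneg (α := ℝ) n)
  refine h2.trans ?_
  have hS : 0 ≤ ∑ i, A i ^ 2 := Finset.sum_nonneg fun i _ => sq_nonneg _
  have hVa : 0 ≤ avg n fun k => V (Z k ω) ^ 2 := avg_nonneg fun k => sq_nonneg _
  have h3 : (n * δ n ^ 2) * ((∑ i, A i ^ 2) * avg n fun k => V (Z k ω) ^ 2)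
      ≤ |K| * ((∑ i, A i ^ 2) * avg n fun k => V (Z k ω) ^ 2) :=
    mul_le_mul_of_nonneg_right (hn.trans (le_abs_self K)) (mul_nonneg hS hVa)
  nlinarith

/-- With a fourth moment of the covariate and a third moment of the error, the second eigenvalue
is `O_P(1/n + δ n ^ 3)`: up to this order the population version of the weighted residual process
moves along a line. -/
lemma bddInProb_sampleEigenvalue_two (hZ : IsSample P Z (νX.prod νE))
    (hDr : DriftConditions νX νE D U δ) (hRe : ResidualConditions P Z νX D e F h)
    (hX4 : ∀ i, MemLp (fun x => x i) 4 νX) (hE3 : MemLp (fun e => e) 3 νE) :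
    BddInProb P fun n ω => ((n : ℝ)⁻¹ + δ n ^ 3)⁻¹ * sampleEigenvalue Z e n ω 2 := by
  have hXXU : ∀ i, Integrable (fun x => x i ^ 2 * U x) νX := fun i => by
    have h2 : MemLp (fun x => x i ^ 2) 2 νX := by
      rw [memLp_two_iff_integrable_sq
        ((measurable_coord i).pow_const 2).aestronglyMeasurable]
      have := (hX4 i).integrable_norm_pow (by norm_num)
      refine this.congr (Eventually.of_forall fun x => ?_)
      simp only [Real.norm_eq_abs, ← pow_mul]
      exact Even.pow_abs (by decide) _
    exact h2.integrable_mul hDr.bound_sq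
  set A : Fin p → ℝ := fun i => ∫ x, |x i| * U x ∂νX
  set B : Fin p → ℝ := fun i => (∫ x, x i ^ 2 * U x ∂νX) * ∫ x, U x ^ 2 ∂νX
  have hB0 : ∀ i, 0 ≤ B i := fun i => mul_nonneg
    (integral_nonneg fun x => mul_nonneg (sq_nonneg _) (hDr.bound_nonneg x))
    (integral_nonneg fun x => sq_nonneg _)
  set G : EuclideanSpace ℝ (Fin p) × ℝ → ℝ := fun z =>
    (32 * ∑ i, B i) * |z.2| ^ 3 + (16 * ∑ i, A i ^ 2) * U z.1 ^ 2 with hG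
  have hSB : 0 ≤ ∑ i, B i := Finset.sum_nonneg fun i _ => hB0 i
  have hSA : 0 ≤ ∑ i, A i ^ 2 := Finset.sum_nonneg fun i _ => sq_nonneg _
  have hG0 : ∀ z, 0 ≤ G z := fun z => by simp only [hG]; positivity
  have hE3i : Integrable (fun e : ℝ => |e| ^ 3) νE := by
    simpa using hE3.integrable_norm_pow (by norm_num)
  have hGi : Integrable G (νX.prod νE) :=
    ((hE3i.comp_snd νX).const_mul _).add ((hDr.bound_sq.integrable_sq.comp_fst νE).const_mul _)
  have b1 := (hRe.bddInProb_sum_sampleMean_sub hZ hDr).const_mul zero_le_two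
  have b2 := (hZ.bddInProb_avg hGi hG0).const_mul zero_le_two
  refine (b1.add b2).mono (withHighProb_of_eventually ?_)
  have hall : ∀ᶠ n in atTop, ∀ i, MemLp (D n) 2 νX ∧ Integrable (fun x => x i * D n x) νX ∧
      ∫ x, |x i * D n x| ∂νX ≤ δ n * ∫ x, |x i| * U x ∂νX :=
    eventually_all.2 fun i => hDr.eventually_moments i
  filter_upwards [eventually_ge_atTop 1, hDr.drift_le, hDr.scale_le, hDr.scale_pos, hall]
    with n hn1 hD hδ1 hδ0 hmom ω
  -- the population version minus its linear part, in mean square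
  have hlin : ∀ z : EuclideanSpace ℝ (Fin p) × ℝ, ∑ i, ‖popMean νX νE (D n) i (z.2 + D n z.1)
      - linMean νX νE (D n) i (z.2 + D n z.1)‖ ^ 2 ≤ δ n ^ 3 * G z := by
    intro z
    set t := z.2 + D n z.1 with ht
    have hU0 := hDr.bound_nonneg z.1
    -- where the drift exceeds the error, `t` is itself of order `δ n` and the trivial bound of the
    -- remainder suffices; elsewhere the remainder of order `3 / 2` is integrable
    rcases le_total |D n z.1| |z.2| with hc | hc
    · have ht2 : |t| ≤ 2 * |z.2| := (abs_add_le _ _).trans (by linarith)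
      have ht3 : |t| ^ 3 ≤ 8 * |z.2| ^ 3 := by
        refine (pow_le_pow_left₀ (abs_nonneg _) ht2 3).trans (le_of_eq (by ring))
      have hi : ∀ i, ‖popMean νX νE (D n) i t - linMean νX νE (D n) i t‖ ^ 2
          ≤ δ n ^ 3 * (32 * |z.2| ^ 3 * B i) := by
        intro i
        have hXXD : Integrable (fun x => x i ^ 2 * |D n x|) νX :=
          ((hXXU i).const_mul (δ n)).mono' (Measurable.aestronglyMeasurable (by
              have := measurable_coord i
              have := hDr.measurable_drift n
              fun_prop))
            (Eventually.of_forall fun x => by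
              rw [Real.norm_eq_abs, abs_of_nonneg (by positivity)]
              have := mul_le_mul_of_nonneg_left (hD x) (sq_nonneg (x i))
              linarith)
        refine (sq_norm_popMean_sub_linMean_le (hDr.integrable_coord i) (hDr.coord_mean i)
          (hDr.measurable_drift n) (hmom i).2.1 (hmom i).1 hXXD t).trans ?_
        have h1 : ∫ x, x i ^ 2 * |D n x| ∂νX ≤ δ n * ∫ x, x i ^ 2 * U x ∂νX := by
          rw [← integral_const_mul]
          refine integral_mono hXXD ((hXXU i).const_mul _) fun x => ?_
          have := mul_le_mul_of_nonneg_left (hD x) (sq_nonneg (x i))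
          change _ ≤ δ n * (x i ^ 2 * U x)
          linarith
        have h2 : ∫ x, D n x ^ 2 ∂νX ≤ δ n ^ 2 * ∫ x, U x ^ 2 ∂νX := by
          rw [← integral_const_mul]
          refine integral_mono (hmom i).1.integrable_sq (hDr.bound_sq.integrable_sq.const_mul _)
            fun x => ?_
          have := pow_le_pow_left₀ (abs_nonneg _) (hD x) 2
          rw [sq_abs, mul_pow] at this
          exact this
        have h3 := mul_le_mul h1 h2 (integral_nonneg fun x => sq_nonneg _)
          (mul_nonneg hδ0.le (integral_nonneg fun x => mul_nonneg (sq_nonneg _)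
            (hDr.bound_nonneg x)))
        have h4 : δ n * (∫ x, x i ^ 2 * U x ∂νX) * (δ n ^ 2 * ∫ x, U x ^ 2 ∂νX)
            = δ n ^ 3 * B i := by simp only [B]; ring
        rw [h4] at h3
        calc _ ≤ 4 * (8 * |z.2| ^ 3) * (δ n ^ 3 * B i) :=
              mul_le_mul (by linarith) h3 (mul_nonneg (integral_nonneg fun x => by positivity)
                (integral_nonneg fun x => sq_nonneg _)) (by positivity)
          _ = _ := by ring
      refine (Finset.sum_le_sum fun i _ => hi i).trans ?_
      rw [← Finset.mul_sum, ← Finset.mul_sum]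
      refine mul_le_mul_of_nonneg_left ?_ (by positivity)
      simp only [hG]
      have : 0 ≤ (16 * ∑ i, A i ^ 2) * U z.1 ^ 2 := by positivity
      linarith
    · have ht2 : |t| ≤ 2 * (δ n * U z.1) := (abs_add_le _ _).trans (by linarith [hD z.1])
      have hi : ∀ i, ‖popMean νX νE (D n) i t - linMean νX νE (D n) i t‖ ^ 2
          ≤ δ n ^ 3 * (16 * A i ^ 2 * U z.1 ^ 2) := by
        intro i
        have h1 := norm_popMean_sub_linMean_le (νE := νE) (hDr.integrable_coord i)
          (hDr.coord_mean i) (hDr.measurable_drift n) (hmom i).2.1 t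
        have h2 : 2 * |t| * ∫ x, |x i * D n x| ∂νX ≤ 2 * (2 * (δ n * U z.1)) * (δ n * A i) :=
          mul_le_mul (by linarith) (hmom i).2.2 (integral_nonneg fun x => abs_nonneg _)
            (by positivity)
        have h3 := pow_le_pow_left₀ (norm_nonneg _) (h1.trans h2) 2
        refine h3.trans ?_
        have h4 : δ n ^ 4 ≤ δ n ^ 3 := pow_le_pow_of_le_one hδ0.le hδ1 (by norm_num)
        calc _ = δ n ^ 4 * (16 * A i ^ 2 * U z.1 ^ 2) := by ring
          _ ≤ _ := mul_le_mul_of_nonneg_right h4 (by positivity)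
      refine (Finset.sum_le_sum fun i _ => hi i).trans ?_
      rw [← Finset.mul_sum, ← Finset.sum_mul, ← Finset.mul_sum]
      refine mul_le_mul_of_nonneg_left ?_ (by positivity)
      simp only [hG]
      have : 0 ≤ (32 * ∑ i, B i) * |z.2| ^ 3 := by positivity
      linarith
  have hk : ∀ k < n, ∑ i, ‖sampleMean Z e n ω k i - Complex.I * ((Z k ω).2 + D n (Z k ω).1 : ℝ)
        * errCharFun νE ((Z k ω).2 + D n (Z k ω).1) * ((∫ x, x i * D n x ∂νX : ℝ) : ℂ)‖ ^ 2
      ≤ 2 * ∑ i, ‖sampleMean Z e n ω k i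
        - popMean νX νE (D n) i ((Z k ω).2 + D n (Z k ω).1)‖ ^ 2
        + (2 * δ n ^ 3) * G (Z k ω) := by
    intro k _
    have h1 := hlin (Z k ω)
    have h2 : ∀ i, ‖sampleMean Z e n ω k i - Complex.I * ((Z k ω).2 + D n (Z k ω).1 : ℝ)
        * errCharFun νE ((Z k ω).2 + D n (Z k ω).1) * ((∫ x, x i * D n x ∂νX : ℝ) : ℂ)‖ ^ 2
        ≤ 2 * ‖sampleMean Z e n ω k i
          - popMean νX νE (D n) i ((Z k ω).2 + D n (Z k ω).1)‖ ^ 2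
          + 2 * ‖popMean νX νE (D n) i ((Z k ω).2 + D n (Z k ω).1)
            - linMean νX νE (D n) i ((Z k ω).2 + D n (Z k ω).1)‖ ^ 2 := fun i => by
      have := norm_add_sq_le_two (sampleMean Z e n ω k i
          - popMean νX νE (D n) i ((Z k ω).2 + D n (Z k ω).1))
        (popMean νX νE (D n) i ((Z k ω).2 + D n (Z k ω).1)
            - linMean νX νE (D n) i ((Z k ω).2 + D n (Z k ω).1))
      rw [sub_add_sub_cancel] at this
      exact this
    refine (Finset.sum_le_sum fun i _ => h2 i).trans ?_
    rw [Finset.sum_add_distrib, ← Finset.mul_sum, ← Finset.mul_sum]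
    linarith
  -- the linear part at the `k`-th residual is a multiple of the fixed vector `E (X D n (X))`
  have h1 := (sampleEigenvalue_two_le (Z := Z) (e := e) n ω
    (fun k => Complex.I * ((Z k ω).2 + D n (Z k ω).1 : ℝ)
        * errCharFun νE ((Z k ω).2 + D n (Z k ω).1))
    (fun i => ((∫ x, x i * D n x ∂νX : ℝ) : ℂ))).trans (avg_le_avg hk)
  rw [avg_add, avg_const_mul, avg_const_mul] at h1
  have hn0 : (0 : ℝ) < n := by positivity
  have hr : (0 : ℝ) < (n : ℝ)⁻¹ + δ n ^ 3 := by positivity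
  rw [inv_mul_le_iff₀ hr]
  refine h1.trans ?_
  have ha : 0 ≤ avg n fun k => ∑ i, ‖sampleMean Z e n ω k i
        - popMean νX νE (D n) i ((Z k ω).2 + D n (Z k ω).1)‖ ^ 2 :=
    avg_nonneg fun k => Finset.sum_nonneg fun i _ => sq_nonneg _
  have hb : 0 ≤ avg n fun k => G (Z k ω) := avg_nonneg fun k => hG0 _
  set a := avg n fun k => ∑ i, ‖sampleMean Z e n ω k i
        - popMean νX νE (D n) i ((Z k ω).2 + D n (Z k ω).1)‖ ^ 2
  set b := avg n fun k => G (Z k ω)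
  have hinv : (n : ℝ)⁻¹ * n = 1 := inv_mul_cancel₀ hn0.ne'
  have e1 : ((n : ℝ)⁻¹ + δ n ^ 3) * (2 * (n * a) + 2 * b)
      = 2 * ((n : ℝ)⁻¹ * n) * a + 2 * δ n ^ 3 * b + 2 * (δ n ^ 3 * (n * a) + (n : ℝ)⁻¹ * b) := by
    ring
  rw [e1, hinv]
  have : 0 ≤ δ n ^ 3 * (n * a) + (n : ℝ)⁻¹ * b := by positivity
  linarith

end Eigenvalues

/-! ### The dominant eigenvalue under larger drifts -/

section Dominant

variable {Ω : Type*} [MeasurableSpace Ω] {P : Measure Ω} [IsProbabilityMeasure P] {p : ℕ}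
  {νX : Measure (EuclideanSpace ℝ (Fin p))} [IsProbabilityMeasure νX]
  {νE : Measure ℝ} [IsProbabilityMeasure νE]
  {Z : ℕ → Ω → EuclideanSpace ℝ (Fin p) × ℝ}
  {D : ℕ → EuclideanSpace ℝ (Fin p) → ℝ} {U F Dlim : EuclideanSpace ℝ (Fin p) → ℝ}
  {δ : ℕ → ℝ} {e : ℕ → ℕ → Ω → ℝ} {h : ℕ → Ω → ℝ}

omit [IsProbabilityMeasure νX] [IsProbabilityMeasure νE] in
lemma measurable_errCharFun [SFinite νE] : Measurable (errCharFun νE) := by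
  have : StronglyMeasurable fun q : ℝ × ℝ => Complex.exp (Complex.I * q.1 * q.2) :=
    Measurable.stronglyMeasurable (by fun_prop)
  exact this.integral_prod_right'.measurable

/-- The rescaled population version of the weighted residual process converges to
`i t E(exp(itε)) E(X_i Dlim(X))`. -/
lemma DriftConditions.tendsto_popMean_div (hDr : DriftConditions νX νE D U δ)
    (hδ : Tendsto δ atTop (𝓝 0)) (hlim : ∀ x, Tendsto (fun n => D n x / δ n) atTop (𝓝 (Dlim x)))
    (i : Fin p) (t : ℝ) :
    Tendsto (fun n => popMean νX νE (D n) i t / δ n) atTop (𝓝 (linMean νX νE Dlim i t)) := by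
  have hD0 : ∀ x, Tendsto (fun n => D n x) atTop (𝓝 0) := fun x => by
    have := (hlim x).mul hδ
    rw [mul_zero] at this
    refine this.congr' ?_
    filter_upwards [hDr.scale_pos] with n hn
    field_simp
  have hmain : Tendsto (fun n => ∫ x, (x i : ℂ) *
      ((Complex.exp (Complex.I * t * D n x) - 1) / δ n) ∂νX) atTop
      (𝓝 (∫ x, (x i : ℂ) * (Complex.I * t * Dlim x) ∂νX)) := by
    refine tendsto_integral_filter_of_dominated_convergence (fun x => |x i| * (|t| * U x)) ?_ ?_ ?_
      (Eventually.of_forall fun x => ?_)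
    · refine Eventually.of_forall fun n => Measurable.aestronglyMeasurable ?_
      have := measurable_coord i
      have := hDr.measurable_drift n
      fun_prop
    · filter_upwards [hDr.drift_le, hDr.scale_pos] with n hn hpos
      refine Eventually.of_forall fun x => ?_
      rw [norm_mul, norm_div, Complex.norm_real, Complex.norm_real, Real.norm_eq_abs,
        Real.norm_eq_abs, abs_of_pos hpos]
      refine mul_le_mul_of_nonneg_left ?_ (abs_nonneg _)
      rw [div_le_iff₀ hpos]
      have := norm_exp_I_sub_one_le (t * D n x)
      push_cast at this
      rw [← mul_assoc, abs_mul] at this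
      nlinarith [hn x, abs_nonneg t]
    · have := (hDr.integrable_coord_mul_bound i).const_mul |t|
      refine this.congr (Eventually.of_forall fun x => ?_)
      simp only; ring
    · refine Tendsto.const_mul _ ?_
      have h1 : Tendsto (fun n => Complex.I * t * ((D n x / δ n : ℝ) : ℂ)) atTop
          (𝓝 (Complex.I * t * Dlim x)) :=
        ((Complex.continuous_ofReal.tendsto _).comp (hlim x)).const_mul _
      have h2 : Tendsto (fun n => (Complex.exp (Complex.I * ((t * D n x : ℝ) : ℂ)) - 1
          - Complex.I * ((t * D n x : ℝ) : ℂ)) / δ n) atTop (𝓝 0) := by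
        have h3 : Tendsto (fun n => 2 * (|t| * |D n x / δ n| * √|t * D n x|)) atTop (𝓝 0) := by
          have h4 : Tendsto (fun n => √|t * D n x|) atTop (𝓝 0) := by
            have := ((hD0 x).const_mul t).abs.sqrt
            simpa using this
          have := (((hlim x).abs.const_mul |t|).mul h4).const_mul 2
          simpa using this
        refine squeeze_zero_norm' ?_ h3
        filter_upwards [hDr.scale_pos] with n hpos
        rw [norm_div, Complex.norm_real, Real.norm_eq_abs, abs_of_pos hpos, div_le_iff₀ hpos]
        refine (norm_exp_I_sub_one_sub_le_sqrt _).trans (le_of_eq ?_)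
        rw [abs_div, abs_of_pos hpos, abs_mul]
        field_simp
      have h5 := h1.add h2
      rw [add_zero] at h5
      refine h5.congr fun n => ?_
      push_cast
      rw [← mul_assoc Complex.I (t : ℂ)]
      ring
  have hlinE : linMean νX νE Dlim i t
      = (∫ x, (x i : ℂ) * (Complex.I * t * Dlim x) ∂νX) * errCharFun νE t := by
    unfold linMean
    rw [← integral_complex_ofReal, ← integral_const_mul, ← integral_mul_const]
    congr 1
    ext x
    push_cast
    ring
  rw [hlinE]
  refine (hmain.mul_const _).congr fun n => ?_
  rw [popMean_eq (hDr.integrable_coord i) (hDr.coord_mean i) (hDr.measurable_drift n)]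
  unfold drift
  rw [mul_div_right_comm, ← integral_div]
  congr 2
  ext x
  ring

/-- Averages of nonnegative functions whose expectations tend to zero are small in probability. -/
lemma IsSample.withHighProb_avg_le {𝒵 : Type*} [MeasurableSpace 𝒵] {ν : Measure 𝒵}
    {Z : ℕ → Ω → 𝒵} (hZ : IsSample P Z ν) {f : ℕ → 𝒵 → ℝ} (h0 : ∀ n z, 0 ≤ f n z)
    (hf : ∀ᶠ n in atTop, Integrable (f n) ν) (hlim : Tendsto (fun n => ∫ z, f n z ∂ν) atTop (𝓝 0))
    {κ : ℝ} (hκ : 0 < κ) : WithHighProb P fun n ω => avg n (fun j => f n (Z j ω)) ≤ κ := by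
  refine withHighProb_of_forall fun η hη => ?_
  rcases eq_or_ne η ∞ with rfl | hηt
  · exact Eventually.of_forall fun _ => le_top
  have hη' : 0 < η.toReal := ENNReal.toReal_pos hη.ne' hηt
  filter_upwards [hf, hlim.eventually_le_const (mul_pos hκ hη'), eventually_ge_atTop 1]
    with n hn hle hn1
  have hm := mul_meas_ge_le_integral_of_nonneg
    (Eventually.of_forall fun ω => avg_nonneg (n := n) fun j => h0 n (Z j ω))
    (hZ.integrable_avg n hn) κ
  rw [hZ.integral_avg hn1 hn] at hm
  have hr := le_of_mul_le_mul_left (hm.trans hle) hκ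
  refine (measure_mono fun ω hω => ?_).trans
    ((ENNReal.toReal_le_toReal (measure_ne_top P _) hηt).1 hr)
  rw [Set.mem_ofPred_eq] at hω ⊢
  exact (not_le.1 hω).le

omit [IsProbabilityMeasure νX] in
lemma norm_linMean_le (i : Fin p) (t : ℝ) :
    ‖linMean νX νE Dlim i t‖ ≤ |t| * |∫ x, x i * Dlim x ∂νX| := by
  unfold linMean
  rw [norm_mul, norm_mul, norm_mul, Complex.norm_I, one_mul, Complex.norm_real, Complex.norm_real,
    Real.norm_eq_abs, Real.norm_eq_abs]
  exact mul_le_mul_of_nonneg_right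
    (mul_le_of_le_one_right (abs_nonneg _) (norm_errCharFun_le t)) (abs_nonneg _)

omit [IsProbabilityMeasure νX] in
lemma measurable_linMean (i : Fin p) : Measurable (linMean νX νE Dlim i) := by
  have := measurable_errCharFun (νE := νE)
  unfold linMean
  fun_prop

lemma DriftConditions.withHighProb_popMean_div_sub (hZ : IsSample P Z (νX.prod νE))
    (hDr : DriftConditions νX νE D U δ) (hδ : Tendsto δ atTop (𝓝 0))
    (hlim : ∀ x, Tendsto (fun n => D n x / δ n) atTop (𝓝 (Dlim x))) (i : Fin p) {κ : ℝ}
    (hκ : 0 < κ) :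
    WithHighProb P fun n ω => (avg n fun k =>
      ‖popMean νX νE (D n) i (Z k ω).2 / δ n - linMean νX νE Dlim i (Z k ω).2‖ ^ 2) ≤ κ := by
  set v := |∫ x, x i * Dlim x ∂νX|
  set A := ∫ x, |x i| * U x ∂νX
  have hmL : Measurable (linMean νX νE Dlim i) := measurable_linMean i
  have hE2 : Integrable (fun t : ℝ => t ^ 2) νE := hDr.err_sq.integrable_sq
  have hm : ∀ n, Measurable fun t =>
      ‖popMean νX νE (D n) i t / δ n - linMean νX νE Dlim i t‖ ^ 2 := fun n =>
    (((measurable_popMean (hDr.measurable_drift n) i).div_const _).sub hmL).norm.pow_const 2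
  have hb : ∀ᶠ n in atTop, ∀ t, ‖‖popMean νX νE (D n) i t / δ n
      - linMean νX νE Dlim i t‖ ^ 2‖ ≤ t ^ 2 * (A + v) ^ 2 := by
    filter_upwards [hDr.eventually_moments i, hDr.scale_pos] with n hn hpos t
    rw [Real.norm_eq_abs, abs_of_nonneg (sq_nonneg _), ← sq_abs t, ← mul_pow]
    refine pow_le_pow_left₀ (norm_nonneg _) ((norm_sub_le _ _).trans ?_) 2
    rw [mul_add]
    refine add_le_add ?_ (norm_linMean_le i t)
    rw [norm_div, Complex.norm_real, Real.norm_eq_abs, abs_of_pos hpos, div_le_iff₀ hpos]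
    refine (norm_popMean_le (hDr.integrable_coord i) (hDr.coord_mean i)
      (hDr.measurable_drift n) hn.2.1 t).trans ?_
    have := mul_le_mul_of_nonneg_left hn.2.2 (abs_nonneg t)
    linarith
  have hint : ∀ᶠ n in atTop, Integrable (fun t =>
      ‖popMean νX νE (D n) i t / δ n - linMean νX νE Dlim i t‖ ^ 2) νE := by
    filter_upwards [hb] with n hn
    exact (hE2.mul_const _).mono' (hm n).aestronglyMeasurable (Eventually.of_forall hn)
  refine hZ.withHighProb_avg_le (f := fun n z =>
    ‖popMean νX νE (D n) i z.2 / δ n - linMean νX νE Dlim i z.2‖ ^ 2)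
    (fun n z => sq_nonneg _) (hint.mono fun n hn => hn.comp_snd νX) ?_ hκ
  have heq : ∀ n, ∫ z, ‖popMean νX νE (D n) i z.2 / δ n - linMean νX νE Dlim i z.2‖ ^ 2
      ∂(νX.prod νE) = ∫ t, ‖popMean νX νE (D n) i t / δ n - linMean νX νE Dlim i t‖ ^ 2 ∂νE :=
    fun n => by
      rw [integral_fun_snd (μ := νX) (ν := νE) (f := fun t =>
        ‖popMean νX νE (D n) i t / δ n - linMean νX νE Dlim i t‖ ^ 2)]
      simp
  simp only [heq]
  have := tendsto_integral_filter_of_dominated_convergence (fun t => t ^ 2 * (A + v) ^ 2)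
    (Eventually.of_forall fun n => (hm n).aestronglyMeasurable)
    (hb.mono fun n hn => Eventually.of_forall hn) (hE2.mul_const _)
    (Eventually.of_forall fun t =>
      ((hDr.tendsto_popMean_div hδ hlim i t).sub_const (linMean νX νE Dlim i t)).norm.pow 2)
  simpa using this

/-- If the limiting drift is correlated with the covariate, the largest eigenvalue is at least of
order `δ n ^ 2`. -/
lemma exists_le_sampleEigenvalue_one (hZ : IsSample P Z (νX.prod νE))
    (hDr : DriftConditions νX νE D U δ) (hRe : ResidualConditions P Z νX D e F h)
    (hδ : Tendsto δ atTop (𝓝 0)) (hnδ : Tendsto (fun n : ℕ => (n : ℝ) * δ n ^ 2) atTop atTop)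
    (hlim : ∀ x, Tendsto (fun n => D n x / δ n) atTop (𝓝 (Dlim x))) {i : Fin p}
    (hpos : 0 < ∫ t, ‖linMean νX νE Dlim i t‖ ^ 2 ∂νE) :
    ∃ c, 0 < c ∧ WithHighProb P fun n ω => c * δ n ^ 2 ≤ sampleEigenvalue Z e n ω 1 := by
  set E₀ := ∫ t, ‖linMean νX νE Dlim i t‖ ^ 2 ∂νE
  set v := |∫ x, x i * Dlim x ∂νX|
  set A := ∫ x, |x i| * U x ∂νX
  have hA0 : 0 ≤ A := integral_nonneg fun x => mul_nonneg (abs_nonneg _) (hDr.bound_nonneg x)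
  set C := ∫ e, |e| ∂νE
  have hC0 : 0 ≤ C := integral_nonneg fun x => abs_nonneg _
  have hmL : Measurable (linMean νX νE Dlim i) := measurable_linMean i
  have hE2 : Integrable (fun t : ℝ => t ^ 2) νE := hDr.err_sq.integrable_sq
  -- three error terms, each with the factor `3`, then cost `E₀ / 8` in total
  set κ := E₀ / 72 with hκdef
  have hκ : 0 < κ := by positivity
  -- the limiting mean square
  have hLi : Integrable (fun t => ‖linMean νX νE Dlim i t‖ ^ 2) νE :=
    (hE2.mul_const (v ^ 2)).mono' (hmL.norm.pow_const 2).aestronglyMeasurable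
      (Eventually.of_forall fun t => by
        rw [Real.norm_eq_abs, abs_of_nonneg (sq_nonneg _)]
        refine (pow_le_pow_left₀ (norm_nonneg _) (norm_linMean_le i t) 2).trans (le_of_eq ?_)
        rw [mul_pow, sq_abs])
  have w0 : WithHighProb P fun n ω =>
      |avg n (fun k => ‖linMean νX νE Dlim i (Z k ω).2‖ ^ 2) - E₀| < E₀ / 2 := by
    have h1 : ∫ z, ‖linMean νX νE Dlim i z.2‖ ^ 2 ∂(νX.prod νE) = E₀ := by
      rw [integral_fun_snd (μ := νX) (ν := νE) (f := fun t => ‖linMean νX νE Dlim i t‖ ^ 2)]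
      simp [E₀]
    rw [← h1]
    exact hZ.lln (f := fun z => ‖linMean νX νE Dlim i z.2‖ ^ 2) (hLi.comp_snd νX)
      ((hmL.comp measurable_snd).norm.pow_const 2) (by rw [h1]; positivity)
  -- the fluctuations
  have w1 : WithHighProb P fun n ω => ((n : ℝ) * δ n ^ 2)⁻¹ * (n * avg n fun k =>
      ‖sampleMean Z e n ω k i - popMean νX νE (D n) i ((Z k ω).2 + D n (Z k ω).1)‖ ^ 2) ≤ κ :=
    (hRe.bddInProb_mHat_sub hZ hDr i).withHighProb_mul_le
      (a := fun n : ℕ => ((n : ℝ) * δ n ^ 2)⁻¹) (tendsto_inv_atTop_zero.comp hnδ)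
      (Eventually.of_forall fun n => by positivity) hκ
  -- the drift in the argument
  have w2 : WithHighProb P fun n ω => δ n ^ 2 * (avg n fun k =>
      A ^ 2 * (U (Z k ω).1 ^ 2 * (1 + |(Z k ω).2| * C) ^ 2)) ≤ κ := by
    have hi : Integrable (fun z : EuclideanSpace ℝ (Fin p) × ℝ =>
        A ^ 2 * (U z.1 ^ 2 * (1 + |z.2| * C) ^ 2)) (νX.prod νE) := by
      have h1 : MemLp (fun t : ℝ => |t| * C) 2 νE := hDr.err_sq.norm.mul_const C
      have h2 : MemLp (fun t : ℝ => 1 + |t| * C) 2 νE := (memLp_const (1 : ℝ)).add h1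
      have h3 : Integrable (fun x => U x ^ 2) νX := hDr.bound_sq.integrable_sq
      have h4 : Integrable (fun t : ℝ => (1 + |t| * C) ^ 2) νE := h2.integrable_sq
      exact (h3.mul_prod h4).const_mul (A ^ 2)
    refine (hZ.bddInProb_avg hi fun z => by positivity).withHighProb_mul_le ?_
      (Eventually.of_forall fun n => sq_nonneg _) hκ
    simpa using hδ.pow 2
  -- the rescaled population version
  have w3 : WithHighProb P fun n ω => (avg n fun k =>
      ‖popMean νX νE (D n) i (Z k ω).2 / δ n - linMean νX νE Dlim i (Z k ω).2‖ ^ 2) ≤ κ :=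
    hDr.withHighProb_popMean_div_sub hZ hδ hlim i hκ
  have hp : 0 < (p : ℝ) := Nat.cast_pos.2 (Nat.pos_of_ne_zero fun h0 => by
    subst h0; exact i.elim0)
  refine ⟨E₀ / (8 * p), by positivity, ?_⟩
  refine (((w0.and w1).and w2).and w3).mono ?_
  filter_upwards [eventually_ge_atTop 1, hDr.scale_pos, hDr.drift_le, hDr.eventually_moments i]
    with n hn1 hδ0 hD hmom ω ⟨⟨⟨h0, h1⟩, h2⟩, h3⟩
  have hn0 : (0 : ℝ) < n := by positivity
  set a1 := avg n fun k =>
      ‖sampleMean Z e n ω k i - popMean νX νE (D n) i ((Z k ω).2 + D n (Z k ω).1)‖ ^ 2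
  set a2 := avg n fun k => A ^ 2 * (U (Z k ω).1 ^ 2 * (1 + |(Z k ω).2| * C) ^ 2)
  set a3 := avg n fun k =>
      ‖popMean νX νE (D n) i (Z k ω).2 / δ n - linMean νX νE Dlim i (Z k ω).2‖ ^ 2
  set a0 := avg n fun k => ‖linMean νX νE Dlim i (Z k ω).2‖ ^ 2
  have hk : ∀ k < n, (δ n ^ 2 / 2) * ‖linMean νX νE Dlim i (Z k ω).2‖ ^ 2
      ≤ ((‖sampleMean Z e n ω k i‖ ^ 2
        + 3 * ‖sampleMean Z e n ω k i - popMean νX νE (D n) i ((Z k ω).2 + D n (Z k ω).1)‖ ^ 2)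
        + 3 * δ n ^ 4 * (A ^ 2 * (U (Z k ω).1 ^ 2 * (1 + |(Z k ω).2| * C) ^ 2)))
        + 3 * δ n ^ 2 *
          ‖popMean νX νE (D n) i (Z k ω).2 / δ n - linMean νX νE Dlim i (Z k ω).2‖ ^ 2 := by
    intro k _
    set m := sampleMean Z e n ω k i
    set m1 := popMean νX νE (D n) i ((Z k ω).2 + D n (Z k ω).1)
    set m2 := popMean νX νE (D n) i (Z k ω).2
    set l := linMean νX νE Dlim i (Z k ω).2
    have hb2 : ‖m1 - m2‖ ≤ δ n ^ 2 * (A * (U (Z k ω).1 * (1 + |(Z k ω).2| * C))) := by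
      refine (norm_popMean_sub_le (hDr.integrable_coord i) (hDr.coord_mean i)
        (hDr.measurable_drift n) hmom.2.1 hDr.integrable_err _ _).trans ?_
      rw [add_sub_cancel_left]
      have hC1 : 0 ≤ 1 + |(Z k ω).2| * C := by positivity
      calc _ ≤ (δ n * U (Z k ω).1) * (1 + |(Z k ω).2| * C) * (δ n * A) :=
            mul_le_mul (mul_le_mul_of_nonneg_right (hD _) hC1) hmom.2.2
              (integral_nonneg fun x => abs_nonneg _)
              (mul_nonneg (mul_nonneg hδ0.le (hDr.bound_nonneg _)) hC1)
        _ = _ := by ring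
    have hb2' : ‖m1 - m2‖ ^ 2
        ≤ δ n ^ 4 * (A ^ 2 * (U (Z k ω).1 ^ 2 * (1 + |(Z k ω).2| * C) ^ 2)) :=
      (pow_le_pow_left₀ (norm_nonneg _) hb2 2).trans (le_of_eq (by ring))
    have hδc : (δ n : ℂ) ≠ 0 := by exact_mod_cast hδ0.ne'
    have hb3 : ‖m2 - δ n * l‖ = δ n * ‖m2 / δ n - l‖ := by
      have : m2 - δ n * l = δ n * (m2 / δ n - l) := by field_simp
      rw [this, norm_mul, Complex.norm_real, Real.norm_eq_abs, abs_of_pos hδ0]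
    have hbl : ‖(δ n : ℂ) * l‖ = δ n * ‖l‖ := by
      rw [norm_mul, Complex.norm_real, Real.norm_eq_abs, abs_of_pos hδ0]
    have htri : ‖(δ n : ℂ) * l‖ ≤ ‖m‖ + (‖m - m1‖ + ‖m1 - m2‖ + ‖m2 - δ n * l‖) := by
      have : (δ n : ℂ) * l = m - (m - m1) - (m1 - m2) - (m2 - δ n * l) := by ring
      have q0 := congrArg norm this
      have q1 := norm_sub_le (m - (m - m1) - (m1 - m2)) (m2 - δ n * l)
      have q2 := norm_sub_le (m - (m - m1)) (m1 - m2)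
      have q3 := norm_sub_le m (m - m1)
      linarith
    have hsq := pow_le_pow_left₀ (norm_nonneg _) htri 2
    rw [hbl, hb3] at hsq
    set r1 := ‖m - m1‖
    set r2 := ‖m1 - m2‖
    set r3 := ‖m2 / δ n - l‖
    have hexp : (‖m‖ + (r1 + r2 + δ n * r3)) ^ 2
        ≤ 2 * ‖m‖ ^ 2 + 6 * (r1 ^ 2 + r2 ^ 2 + (δ n * r3) ^ 2) := by
      nlinarith [sq_nonneg (‖m‖ - (r1 + r2 + δ n * r3)), sq_nonneg (r1 - r2),
        sq_nonneg (r1 - δ n * r3), sq_nonneg (r2 - δ n * r3)]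
    have e1 : (δ n * ‖l‖) ^ 2 = δ n ^ 2 * ‖l‖ ^ 2 := by ring
    have e2 : (δ n * r3) ^ 2 = δ n ^ 2 * r3 ^ 2 := by ring
    rw [e1] at hsq
    rw [e2] at hexp
    linarith
  have hav := avg_le_avg hk
  rw [avg_add, avg_add, avg_add, avg_const_mul n (δ n ^ 2 / 2), avg_const_mul n 3,
    avg_const_mul n (3 * δ n ^ 4), avg_const_mul n (3 * δ n ^ 2)] at hav
  have hone : (avg n fun k => ‖sampleMean Z e n ω k i‖ ^ 2) ≤ p * sampleEigenvalue Z e n ω 1 :=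
    (avg_le_avg fun k _ => Finset.single_le_sum (f := fun i => ‖sampleMean Z e n ω k i‖ ^ 2)
      (fun i _ => sq_nonneg _) (Finset.mem_univ i)).trans (le_sampleEigenvalue_one n ω)
  have h1' : a1 ≤ κ * δ n ^ 2 := by
    have e1 : ((n : ℝ) * δ n ^ 2)⁻¹ * (n * a1) = a1 / δ n ^ 2 := by field_simp
    rw [e1, div_le_iff₀ (by positivity)] at h1
    exact h1
  have h2' : δ n ^ 4 * a2 ≤ κ * δ n ^ 2 := by
    have := mul_le_mul_of_nonneg_left h2 (sq_nonneg (δ n))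
    calc _ = δ n ^ 2 * (δ n ^ 2 * a2) := by ring
      _ ≤ _ := by linarith
  have h3' : δ n ^ 2 * a3 ≤ κ * δ n ^ 2 := by
    have := mul_le_mul_of_nonneg_left h3 (sq_nonneg (δ n))
    linarith
  have h0' : E₀ / 2 ≤ a0 := by have := (abs_lt.1 h0).1; linarith
  have h0'' : δ n ^ 2 / 2 * (E₀ / 2) ≤ δ n ^ 2 / 2 * a0 :=
    mul_le_mul_of_nonneg_left h0' (by positivity)
  have hfin : E₀ / 8 * δ n ^ 2 ≤ p * sampleEigenvalue Z e n ω 1 := by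
    have : κ * δ n ^ 2 = E₀ * δ n ^ 2 / 72 := by rw [hκdef]; ring
    nlinarith [mul_pos hpos (pow_pos hδ0 2)]
  have e9 : E₀ / (8 * p) * δ n ^ 2 = (E₀ / 8 * δ n ^ 2) / p := by field_simp
  rw [e9, div_le_iff₀ hp]
  linarith

end Dominant

/-! ### The ridge ratio criterion at eigenvalues of known order -/

section Dimension

variable {Ω : Type*} [MeasurableSpace Ω] {P : Measure Ω} [IsProbabilityMeasure P] {p : ℕ}
  {Z : ℕ → Ω → EuclideanSpace ℝ (Fin p) × ℝ} {δ : ℕ → ℝ} {e : ℕ → ℕ → Ω → ℝ}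
  {c₁ c₂ : ℕ → ℝ} {τ : ℝ}

omit [IsProbabilityMeasure P] in
/-- Eigenvalues of order `1/n` have squares that are negligible against `c₁ c₂`, so that no ratio
falls below the threshold. -/
lemma withHighProb_tdrr_eq_zero
    (hlam : BddInProb P fun n ω => n * sampleEigenvalue Z e n ω 1)
    (hc₁ : ∀ᶠ n in atTop, 0 < c₁ n) (hc₂ : ∀ᶠ n in atTop, 0 < c₂ n) (hτ₀ : 0 < τ) (hτ₁ : τ < 1)
    (hc : Tendsto (fun n : ℕ => (n : ℝ) ^ 2 * c₁ n * c₂ n) atTop atTop) :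
    WithHighProb P fun n ω => tdrr p (sampleEigenvalue Z e n ω) (c₁ n) (c₂ n) τ = 0 := by
  have h0 : ∀ (n : ℕ) (ω : Ω), 0 ≤ (n : ℝ) * sampleEigenvalue Z e n ω 1 := fun n ω =>
    mul_nonneg (Nat.cast_nonneg n) (sampleEigenvalue_nonneg n ω 1)
  have hsmall := (hlam.mul hlam h0 h0).withHighProb_mul_le (tendsto_inv_atTop_zero.comp hc)
    (hc.eventually_ge_atTop 0 |>.mono fun n hn => inv_nonneg.2 hn)
    (κ := (1 - τ) / 2) (by linarith)
  refine hsmall.mono ?_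
  filter_upwards [hc₁, hc₂, eventually_ge_atTop 1] with n h1 h2 hn ω hω
  have hn0 : (0 : ℝ) < n := by positivity
  refine tdrr_eq_zero p (sampleEigenvalue_nonneg n ω) (sampleEigenvalue_succ_le n ω) h1 h2 hτ₀
    (κ := (1 - τ) / 2) (by nlinarith) ?_
  have heq : ((n : ℝ) ^ 2 * c₁ n * c₂ n)⁻¹ * (n * sampleEigenvalue Z e n ω 1
      * (n * sampleEigenvalue Z e n ω 1)) = sampleEigenvalue Z e n ω 1 ^ 2 / (c₁ n * c₂ n) := by
    field_simp
  have hω' : ((n : ℝ) ^ 2 * c₁ n * c₂ n)⁻¹ * (n * sampleEigenvalue Z e n ω 1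
      * (n * sampleEigenvalue Z e n ω 1)) ≤ (1 - τ) / 2 := hω
  rw [heq, div_le_iff₀ (mul_pos h1 h2)] at hω'
  exact hω'

omit [IsProbabilityMeasure P] in
/-- The square of the first eigenvalue dominates the ridge `c₁`, and the squares of the others are
negligible against `c₁ c₂`. -/
lemma withHighProb_tdrr_eq_one (hp : 1 ≤ p)
    (hδ₀ : ∀ᶠ n in atTop, 0 < δ n) (hδ₁ : ∀ᶠ n in atTop, δ n ≤ 1)
    (hnδ : Tendsto (fun n : ℕ => (n : ℝ) * δ n ^ 2) atTop atTop)
    (hlam₁ : ∃ c, 0 < c ∧ WithHighProb P fun n ω => c * δ n ^ 2 ≤ sampleEigenvalue Z e n ω 1)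
    (hlam₂ : BddInProb P fun n ω => ((n : ℝ)⁻¹ + δ n ^ 3)⁻¹ * sampleEigenvalue Z e n ω 2)
    (hc₁ : ∀ᶠ n in atTop, 0 < c₁ n) (hc₂ : ∀ᶠ n in atTop, 0 < c₂ n) (hτ₀ : 0 < τ) (hτ₁ : τ < 1)
    (hc₁δ : c₁ =o[atTop] (fun n => δ n ^ 4)) (hc₂0 : Tendsto c₂ atTop (𝓝 0))
    (hcn : Tendsto (fun n : ℕ => (n : ℝ) * c₁ n * c₂ n / δ n ^ 2) atTop atTop)
    (hcδ : Tendsto (fun n : ℕ => c₁ n * c₂ n / δ n ^ 6) atTop atTop) :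
    WithHighProb P fun n ω => tdrr p (sampleEigenvalue Z e n ω) (c₁ n) (c₂ n) τ = 1 := by
  obtain ⟨c, hc, hlam₁⟩ := hlam₁
  -- times `c₁ n * c₂ n` this is `2 * (δ n ^ 2 / n + δ n ^ 6)`, a bound for `(1 / n + δ n ^ 3) ^ 2`
  have ha : Tendsto (fun n : ℕ => 2 * ((n : ℝ) * c₁ n * c₂ n / δ n ^ 2)⁻¹
      + 2 * (c₁ n * c₂ n / δ n ^ 6)⁻¹) atTop (𝓝 0) := by
    have := ((tendsto_inv_atTop_zero.comp hcn).const_mul 2).add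
      ((tendsto_inv_atTop_zero.comp hcδ).const_mul 2)
    simpa using this
  have h0 : ∀ᶠ n : ℕ in atTop, 0 ≤ 2 * ((n : ℝ) * c₁ n * c₂ n / δ n ^ 2)⁻¹
      + 2 * (c₁ n * c₂ n / δ n ^ 6)⁻¹ := by
    filter_upwards [hc₁, hc₂] with n h1 h2
    positivity
  have h3 : BddInProb P fun n ω =>
      (((n : ℝ)⁻¹ + δ n ^ 3)⁻¹ * sampleEigenvalue Z e n ω 2) ^ 2 := by
    refine hlam₂.sq_of_eventually_nonneg ?_
    filter_upwards [hδ₀] with n hn ω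
    have := sampleEigenvalue_nonneg (Z := Z) (e := e) n ω 2
    positivity
  have hsmall := h3.withHighProb_mul_le ha h0 (κ := (1 - τ) / 2) (by linarith)
  -- the lower bound `c δ²` of the first eigenvalue after the transformation `lam / (lam + 1)`
  set K := 2 * (1 + 2 / τ) with hK
  have hK0 : 0 < K := by positivity
  have hc₁' : ∀ᶠ n in atTop, K * c₁ n ≤ (c / (c + 1)) ^ 2 * δ n ^ 4 := by
    have hb := hc₁δ.bound (c := (c / (c + 1)) ^ 2 / K) (by positivity)
    filter_upwards [hb] with n hn
    rw [Real.norm_eq_abs, Real.norm_eq_abs, abs_of_nonneg (by positivity : 0 ≤ δ n ^ 4)] at hn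
    have := (le_abs_self _).trans hn
    rw [div_mul_eq_mul_div, le_div_iff₀ hK0] at this
    linarith
  refine (hlam₁.and hsmall).mono ?_
  filter_upwards [hc₁, hc₂, eventually_ge_atTop 1, hδ₀, hδ₁, hc₂0.eventually_le_const one_pos,
    hc₁', hnδ.eventually_ge_atTop 1] with n h1 h2 hn hd0 hd1 hc21 hcK hnd ω ⟨hω1, hω2⟩
  have hn0 : (0 : ℝ) < n := by positivity
  refine tdrr_eq_one hp (sampleEigenvalue_nonneg n ω) (sampleEigenvalue_succ_le n ω) h1 h2 hc21
    hτ₀ (κ := (1 - τ) / 2) (by linarith) (by nlinarith) ?_ (a := c * δ n ^ 2) (by positivity) hω1 ?_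
  · set l := sampleEigenvalue Z e n ω 2
    have hr : 0 < (n : ℝ)⁻¹ + δ n ^ 3 := by positivity
    have e1 : l ^ 2 = ((n : ℝ)⁻¹ + δ n ^ 3) ^ 2 * (((n : ℝ)⁻¹ + δ n ^ 3)⁻¹ * l) ^ 2 := by
      field_simp
    have e2 : ((n : ℝ)⁻¹ + δ n ^ 3) ^ 2 ≤ (2 * ((n : ℝ) * c₁ n * c₂ n / δ n ^ 2)⁻¹
      + 2 * (c₁ n * c₂ n / δ n ^ 6)⁻¹) * (c₁ n * c₂ n) := by
      have e3 : (2 * ((n : ℝ) * c₁ n * c₂ n / δ n ^ 2)⁻¹ + 2 * (c₁ n * c₂ n / δ n ^ 6)⁻¹)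
          * (c₁ n * c₂ n) = 2 * (δ n ^ 2 * (n : ℝ)⁻¹) + 2 * (δ n ^ 3) ^ 2 := by
        field_simp
      have e4 : (n : ℝ)⁻¹ ≤ δ n ^ 2 := by
        rw [inv_le_iff_one_le_mul₀ hn0]; linarith
      have e5 : (n : ℝ)⁻¹ * (n : ℝ)⁻¹ ≤ δ n ^ 2 * (n : ℝ)⁻¹ :=
        mul_le_mul_of_nonneg_right e4 (by positivity)
      rw [e3]
      nlinarith [sq_nonneg ((n : ℝ)⁻¹ - δ n ^ 3)]
    rw [e1]
    have e6 := mul_le_mul_of_nonneg_right e2 (sq_nonneg (((n : ℝ)⁻¹ + δ n ^ 3)⁻¹ * l))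
    refine e6.trans ?_
    have e7 := mul_le_mul_of_nonneg_right hω2 (mul_pos h1 h2).le
    linarith
  · have e1 : c / (c + 1) * δ n ^ 2 ≤ c * δ n ^ 2 / (c * δ n ^ 2 + 1) := by
      rw [div_mul_eq_mul_div]
      refine div_le_div_of_nonneg_left (by positivity) (by positivity) ?_
      have : δ n ^ 2 ≤ 1 := pow_le_one₀ hd0.le hd1
      nlinarith
    have e2 := pow_le_pow_left₀ (by positivity) e1 2
    have e3 : (c / (c + 1) * δ n ^ 2) ^ 2 = (c / (c + 1)) ^ 2 * δ n ^ 4 := by ring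
    rw [e3] at e2
    refine le_trans (le_of_eq ?_) (hcK.trans e2)
    rw [hK]; ring

end Dimension

/-! ### The population least squares criterion under local alternatives -/

section Regression

variable {d : ℕ} {𝒳 : Type*} [MeasurableSpace 𝒳]

/-- The residual `g(x, θ₀) + s ℓ(x) + e - g(x, θ)` at `z = (x, e)`, for the parameter `θ` in the
local alternative model of size `s`. -/
def resid (g : 𝒳 → EuclideanSpace ℝ (Fin d) → ℝ) (ℓ : 𝒳 → ℝ) (θ₀ : EuclideanSpace ℝ (Fin d))
    (s : ℝ) (θ : EuclideanSpace ℝ (Fin d)) (z : 𝒳 × ℝ) : ℝ :=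
  z.2 + s * ℓ z.1 - (g z.1 θ - g z.1 θ₀)

/-- Conditions on a regression model with independent covariate law `νX` and error law `νE`, with
gradient `gd` and Hessian `gdd` on the closed ball of radius `r` around `θ₀`, and with dominating
functions `Gs, F, J, H` in place of the moments of suprema. -/
structure RegressionConditions (νX : Measure 𝒳) (νE : Measure ℝ)
    (g : 𝒳 → EuclideanSpace ℝ (Fin d) → ℝ) (ℓ : 𝒳 → ℝ)
    (gd : 𝒳 → EuclideanSpace ℝ (Fin d) → EuclideanSpace ℝ (Fin d))
    (gdd : 𝒳 → EuclideanSpace ℝ (Fin d) →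
      EuclideanSpace ℝ (Fin d) →L[ℝ] EuclideanSpace ℝ (Fin d))
    (Θ : Set (EuclideanSpace ℝ (Fin d))) (θ₀ : EuclideanSpace ℝ (Fin d)) (r : ℝ)
    (Gs F : 𝒳 → ℝ) (J H : 𝒳 × ℝ → ℝ) : Prop where
  compact_param : IsCompact Θ
  radius_pos : 0 < r
  ball_subset : Metric.closedBall θ₀ r ⊆ Θ
  measurable_g : ∀ θ ∈ Θ, Measurable fun x => g x θ
  continuousOn_g : ∀ x, ContinuousOn (g x) Θ
  measurable_ell : Measurable ℓ
  ell_sq : MemLp ℓ 2 νX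
  err_sq : MemLp (fun e => e) 2 νE
  err_mean : ∫ e, e ∂νE = 0
  g_le : ∀ x, ∀ θ ∈ Θ, |g x θ| ≤ Gs x
  g_env_sq : MemLp Gs 2 νX
  grad_le : ∀ x, ∀ θ ∈ Metric.closedBall θ₀ r, ‖gd x θ‖ ≤ F x
  grad_env_sq : MemLp F 2 νX
  resid_grad_le : ∀ z : 𝒳 × ℝ, ∀ θ ∈ Metric.closedBall θ₀ r, ∀ s ∈ Set.Icc (0 : ℝ) 1,
    resid g ℓ θ₀ s θ z ^ 2 * ‖gd z.1 θ‖ ^ 2 ≤ J z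
  resid_grad_env : Integrable J (νX.prod νE)
  resid_hess_le : ∀ᵐ z ∂(νX.prod νE), ∀ θ ∈ Metric.closedBall θ₀ r, ∀ s ∈ Set.Icc (0 : ℝ) 1,
    |resid g ℓ θ₀ s θ z| * ‖gdd z.1 θ‖ ≤ H z
  resid_hess_env : Integrable H (νX.prod νE)
  hasGradientAt : ∀ x, ∀ θ ∈ Metric.closedBall θ₀ r, HasGradientAt (g x) (gd x θ) θ
  hasFDerivAt : ∀ x, ∀ θ ∈ Metric.closedBall θ₀ r, HasFDerivAt (gd x) (gdd x θ) θ
  continuousOn_hess : ∀ x, ContinuousOn (gdd x) (Metric.closedBall θ₀ r)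
  measurable_grad : ∀ θ ∈ Metric.closedBall θ₀ r, Measurable fun x => gd x θ
  measurable_hess : ∀ θ ∈ Metric.closedBall θ₀ r, ∀ u, Measurable fun x => gdd x θ u
  unique_min : ∀ θ ∈ Θ, θ ≠ θ₀ → ∫ z, resid g ℓ θ₀ 0 θ₀ z ^ 2 ∂(νX.prod νE)
    < ∫ z, resid g ℓ θ₀ 0 θ z ^ 2 ∂(νX.prod νE)
  gram_nonsingular : IsUnit (Matrix.of fun a b => ∫ x, gd x θ₀ a * gd x θ₀ b ∂νX)

variable {νX : Measure 𝒳} [IsProbabilityMeasure νX] {νE : Measure ℝ} [IsProbabilityMeasure νE]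
  {g : 𝒳 → EuclideanSpace ℝ (Fin d) → ℝ} {ℓ : 𝒳 → ℝ}
  {gd : 𝒳 → EuclideanSpace ℝ (Fin d) → EuclideanSpace ℝ (Fin d)}
  {gdd : 𝒳 → EuclideanSpace ℝ (Fin d) → EuclideanSpace ℝ (Fin d) →L[ℝ] EuclideanSpace ℝ (Fin d)}
  {Θ : Set (EuclideanSpace ℝ (Fin d))} {θ₀ : EuclideanSpace ℝ (Fin d)} {r : ℝ}
  {Gs F : 𝒳 → ℝ} {J H : 𝒳 × ℝ → ℝ}

/-- The population criterion `E (Y - g(X, θ))²` in the local alternative model of size `s`. -/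
noncomputable def criterion (νX : Measure 𝒳) (νE : Measure ℝ)
    (g : 𝒳 → EuclideanSpace ℝ (Fin d) → ℝ) (ℓ : 𝒳 → ℝ) (θ₀ : EuclideanSpace ℝ (Fin d))
    (θ : EuclideanSpace ℝ (Fin d)) (s : ℝ) : ℝ :=
  ∫ z, resid g ℓ θ₀ s θ z ^ 2 ∂(νX.prod νE)

namespace RegressionConditions

section Basic

omit [IsProbabilityMeasure νX] [IsProbabilityMeasure νE]

variable (hM : RegressionConditions νX νE g ℓ gd gdd Θ θ₀ r Gs F J H)
include hM

lemma mem_param : θ₀ ∈ Θ := hM.ball_subset (Metric.mem_closedBall_self hM.radius_pos.le)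

lemma mem_ball : θ₀ ∈ Metric.closedBall θ₀ r := Metric.mem_closedBall_self hM.radius_pos.le

lemma grad_env_nonneg (x : 𝒳) : 0 ≤ F x := (norm_nonneg _).trans (hM.grad_le x θ₀ hM.mem_ball)

lemma measurable_resid {θ : EuclideanSpace ℝ (Fin d)} (hθ : θ ∈ Θ) (s : ℝ) :
    Measurable (resid g ℓ θ₀ s θ) := by
  have h1 := (hM.measurable_g θ hθ).comp (measurable_fst : Measurable (Prod.fst : 𝒳 × ℝ → 𝒳))
  have h2 := (hM.measurable_g θ₀ hM.mem_param).comp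
    (measurable_fst : Measurable (Prod.fst : 𝒳 × ℝ → 𝒳))
  have h3 := hM.measurable_ell.comp (measurable_fst : Measurable (Prod.fst : 𝒳 × ℝ → 𝒳))
  exact (measurable_snd.add (h3.const_mul s)).sub (h1.sub h2)

lemma continuousOn_resid (z : 𝒳 × ℝ) :
    ContinuousOn (fun k : EuclideanSpace ℝ (Fin d) × ℝ => resid g ℓ θ₀ k.2 k.1 z)
      (Θ ×ˢ Set.univ) := by
  have h1 : ContinuousOn (fun k : EuclideanSpace ℝ (Fin d) × ℝ => g z.1 k.1) (Θ ×ˢ Set.univ) :=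
    (hM.continuousOn_g z.1).comp continuousOn_fst fun k hk => hk.1
  exact (continuousOn_const.add (continuousOn_snd.mul continuousOn_const)).sub
    (h1.sub continuousOn_const)

lemma abs_resid_le {θ : EuclideanSpace ℝ (Fin d)} (hθ : θ ∈ Θ) {s : ℝ} (hs : s ∈ Set.Icc (0 : ℝ) 1)
    (z : 𝒳 × ℝ) : |resid g ℓ θ₀ s θ z| ≤ |z.2| + |ℓ z.1| + 2 * Gs z.1 := by
  have h1 := hM.g_le z.1 θ hθ
  have h2 := hM.g_le z.1 θ₀ hM.mem_param
  have h3 : |s * ℓ z.1| ≤ |ℓ z.1| := by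
    rw [abs_mul, abs_of_nonneg hs.1]
    exact mul_le_of_le_one_left (abs_nonneg _) hs.2
  unfold resid
  have h4 := abs_sub (z.2 + s * ℓ z.1) (g z.1 θ - g z.1 θ₀)
  have h5 := abs_add_le z.2 (s * ℓ z.1)
  have h6 := abs_sub (g z.1 θ) (g z.1 θ₀)
  linarith

lemma abs_sub_le {θ θ' : EuclideanSpace ℝ (Fin d)} (hθ : θ ∈ Metric.closedBall θ₀ r)
    (hθ' : θ' ∈ Metric.closedBall θ₀ r) (x : 𝒳) : |g x θ' - g x θ| ≤ F x * ‖θ' - θ‖ :=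
  (convex_closedBall θ₀ r).norm_image_sub_le_of_norm_hasFDerivWithin_le
    (f := g x) (f' := fun θ => InnerProductSpace.toDual ℝ _ (gd x θ))
    (fun y hy => (hM.hasGradientAt x y hy).hasFDerivAt.hasFDerivWithinAt)
    (fun y hy => by rw [LinearIsometryEquiv.norm_map]; exact hM.grad_le x y hy) hθ hθ'

lemma continuousOn_grad (x : 𝒳) : ContinuousOn (gd x) (Metric.closedBall θ₀ r) :=
  fun θ hθ => (hM.hasFDerivAt x θ hθ).continuousAt.continuousWithinAt

end Basic

section Criterion

variable (hM : RegressionConditions νX νE g ℓ gd gdd Θ θ₀ r Gs F J H)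
include hM

lemma memLp_resid_env :
    MemLp (fun z : 𝒳 × ℝ => |z.2| + |ℓ z.1| + 2 * Gs z.1) 2 (νX.prod νE) :=
  ((hM.err_sq.norm.comp_snd νX).add (hM.ell_sq.norm.comp_fst νE)).add
    ((hM.g_env_sq.comp_fst νE).const_mul 2)

lemma memLp_resid {θ : EuclideanSpace ℝ (Fin d)} (hθ : θ ∈ Θ) {s : ℝ}
    (hs : s ∈ Set.Icc (0 : ℝ) 1) : MemLp (resid g ℓ θ₀ s θ) 2 (νX.prod νE) :=
  hM.memLp_resid_env.mono (hM.measurable_resid hθ s).aestronglyMeasurable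
    (Eventually.of_forall fun z => (hM.abs_resid_le hθ hs z).trans (le_abs_self _))

lemma continuousOn_criterion :
    ContinuousOn (fun k : EuclideanSpace ℝ (Fin d) × ℝ => criterion νX νE g ℓ θ₀ k.1 k.2)
      (Θ ×ˢ Set.Icc 0 1) := by
  unfold criterion
  refine continuousOn_of_dominated (bound := fun z => (|z.2| + |ℓ z.1| + 2 * Gs z.1) ^ 2)
    (fun k hk => ((hM.measurable_resid hk.1 k.2).pow_const 2).aestronglyMeasurable)
    (fun k hk => Eventually.of_forall fun z => ?_) hM.memLp_resid_env.integrable_sq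
    (Eventually.of_forall fun z => ((hM.continuousOn_resid z).mono fun k hk => ⟨hk.1, trivial⟩).pow 2)
  rw [Real.norm_eq_abs, abs_of_nonneg (sq_nonneg _), ← sq_abs]
  exact pow_le_pow_left₀ (abs_nonneg _) (hM.abs_resid_le hk.1 hk.2 z) 2

/-- Near-minimizers of the criterion for small `s` are close to `θ₀`. The function
`max (q(θ, s) - q(θ₀, s)) 0 + s` is continuous and positive on the compact set of all `(θ, s)` with
`θ` bounded away from `θ₀`. -/
lemma exists_separation {ρ : ℝ} (hρ : 0 < ρ) : ∃ κ, 0 < κ ∧ ∀ θ ∈ Θ, ∀ s ∈ Set.Icc (0 : ℝ) 1,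
    s < κ → criterion νX νE g ℓ θ₀ θ s ≤ criterion νX νE g ℓ θ₀ θ₀ s + κ → dist θ θ₀ < ρ := by
  set A : Set (EuclideanSpace ℝ (Fin d) × ℝ) :=
    (Θ ∩ {θ | ρ ≤ dist θ θ₀}) ×ˢ Set.Icc (0 : ℝ) 1
  have hA : IsCompact A := (hM.compact_param.inter_right
    (isClosed_le continuous_const (continuous_id.dist continuous_const))).prod isCompact_Icc
  set φ : EuclideanSpace ℝ (Fin d) × ℝ → ℝ := fun k =>
    max (criterion νX νE g ℓ θ₀ k.1 k.2 - criterion νX νE g ℓ θ₀ θ₀ k.2) 0 + k.2 with hφ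
  have hAΘ : ∀ k ∈ A, k ∈ Θ ×ˢ Set.Icc (0 : ℝ) 1 := fun k hk => ⟨hk.1.1, hk.2⟩
  have hφc : ContinuousOn φ A := by
    have h1 := hM.continuousOn_criterion.mono hAΘ
    have h2 : ContinuousOn (fun k : EuclideanSpace ℝ (Fin d) × ℝ =>
        criterion νX νE g ℓ θ₀ θ₀ k.2) A :=
      hM.continuousOn_criterion.comp (f := fun k : EuclideanSpace ℝ (Fin d) × ℝ => (θ₀, k.2))
        (by fun_prop) fun k hk => ⟨hM.mem_param, hk.2⟩
    exact ((h1.sub h2).sup continuousOn_const).add continuousOn_snd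
  rcases A.eq_empty_or_nonempty with hne | hne
  · refine ⟨1, one_pos, fun θ hθ s hs _ _ => ?_⟩
    by_contra hd
    have : (θ, s) ∈ A := ⟨⟨hθ, not_lt.1 hd⟩, hs⟩
    rw [hne] at this
    exact this
  obtain ⟨k₀, hk₀, hmin⟩ := hA.exists_isMinOn hne hφc
  have hpos : 0 < φ k₀ := by
    rcases hk₀.2.1.eq_or_lt with h0 | h0
    · have hne : k₀.1 ≠ θ₀ := fun h => by
        have := hk₀.1.2
        rw [Set.mem_ofPred_eq, h, dist_self] at this
        linarith
      have := hM.unique_min k₀.1 hk₀.1.1 hne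
      have h1 : 0 < criterion νX νE g ℓ θ₀ k₀.1 k₀.2 - criterion νX νE g ℓ θ₀ θ₀ k₀.2 := by
        rw [← h0]
        exact sub_pos.2 this
      exact add_pos_of_pos_of_nonneg (lt_max_of_lt_left h1) hk₀.2.1
    · exact add_pos_of_nonneg_of_pos (le_max_right _ _) h0
  refine ⟨φ k₀ / 3, by positivity, fun θ hθ s hs hsκ hle => ?_⟩
  by_contra hd
  have h1 := hmin (show (θ, s) ∈ A from ⟨⟨hθ, not_lt.1 hd⟩, hs⟩)
  have h2 : φ (θ, s) ≤ φ k₀ / 3 + φ k₀ / 3 := by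
    simp only [hφ] at hle hsκ ⊢
    exact add_le_add (max_le (by linarith) (by positivity)) hsκ.le
  have h3 : φ k₀ ≤ φ (θ, s) := h1
  linarith

/-- Minimizers of the population criteria exist. -/
lemma exists_minimizer : ∃ θs : ℝ → EuclideanSpace ℝ (Fin d), (∀ s, θs s ∈ Θ) ∧
    ∀ s ∈ Set.Icc (0 : ℝ) 1, ∀ θ ∈ Θ,
      criterion νX νE g ℓ θ₀ (θs s) s ≤ criterion νX νE g ℓ θ₀ θ s := by
  have : ∀ s : ℝ, ∃ θ' ∈ Θ, s ∈ Set.Icc (0 : ℝ) 1 → ∀ θ ∈ Θ,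
      criterion νX νE g ℓ θ₀ θ' s ≤ criterion νX νE g ℓ θ₀ θ s := by
    intro s
    by_cases hs : s ∈ Set.Icc (0 : ℝ) 1
    · obtain ⟨θ', h1, h2⟩ := hM.compact_param.exists_isMinOn ⟨θ₀, hM.mem_param⟩
        (f := fun θ => criterion νX νE g ℓ θ₀ θ s)
        (hM.continuousOn_criterion.comp (f := fun θ : EuclideanSpace ℝ (Fin d) => (θ, s))
          (by fun_prop) fun θ hθ => ⟨hθ, hs⟩)
      exact ⟨θ', h1, fun _ θ hθ => h2 hθ⟩
    · exact ⟨θ₀, hM.mem_param, fun h => absurd h hs⟩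
  choose θs h1 h2 using this
  exact ⟨θs, h1, h2⟩

omit [IsProbabilityMeasure νX] [IsProbabilityMeasure νE] in
lemma hasDerivAt_resid {θ u : EuclideanSpace ℝ (Fin d)} {t : ℝ}
    (ht : θ + t • u ∈ Metric.closedBall θ₀ r) (s : ℝ) (z : 𝒳 × ℝ) :
    HasDerivAt (fun t : ℝ => resid g ℓ θ₀ s (θ + t • u) z)
      (-inner ℝ (gd z.1 (θ + t • u)) u) t := by
  have h1 : HasDerivAt (fun t : ℝ => θ + t • u) u t := by
    simpa using ((hasDerivAt_id t).smul_const u).const_add θ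
  have h2 := (hM.hasGradientAt z.1 _ ht).hasFDerivAt.comp_hasDerivAt t h1
  rw [InnerProductSpace.toDual_apply_apply] at h2
  exact (h2.sub_const (g z.1 θ₀)).const_sub (z.2 + s * ℓ z.1)

omit [IsProbabilityMeasure νX] [IsProbabilityMeasure νE] in
lemma abs_resid_mul_inner_le {θ u : EuclideanSpace ℝ (Fin d)} (hθ : θ ∈ Metric.closedBall θ₀ r)
    {s : ℝ} (hs : s ∈ Set.Icc (0 : ℝ) 1) (z : 𝒳 × ℝ) :
    |resid g ℓ θ₀ s θ z * inner ℝ (gd z.1 θ) u| ≤ √(J z) * ‖u‖ := by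
  have h1 : |resid g ℓ θ₀ s θ z| * ‖gd z.1 θ‖ ≤ √(J z) := by
    refine Real.le_sqrt_of_sq_le ?_
    rw [mul_pow, sq_abs]
    exact hM.resid_grad_le z θ hθ s hs
  rw [abs_mul]
  calc _ ≤ |resid g ℓ θ₀ s θ z| * (‖gd z.1 θ‖ * ‖u‖) :=
        mul_le_mul_of_nonneg_left (abs_real_inner_le_norm _ _) (abs_nonneg _)
    _ = |resid g ℓ θ₀ s θ z| * ‖gd z.1 θ‖ * ‖u‖ := by ring
    _ ≤ _ := mul_le_mul_of_nonneg_right h1 (norm_nonneg _)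

omit [IsProbabilityMeasure νX] [IsProbabilityMeasure νE] in
lemma resid_grad_env_nonneg (z : 𝒳 × ℝ) : 0 ≤ J z :=
  le_trans (by positivity) (hM.resid_grad_le z θ₀ hM.mem_ball 0 ⟨le_rfl, zero_le_one⟩)

omit [IsProbabilityMeasure νX] [IsProbabilityMeasure νE] in
lemma memLp_sqrt_env : MemLp (fun z => √(J z)) 2 (νX.prod νE) := by
  rw [memLp_two_iff_integrable_sq
    (Real.continuous_sqrt.comp_aestronglyMeasurable hM.resid_grad_env.aestronglyMeasurable)]
  refine hM.resid_grad_env.congr (Eventually.of_forall fun z => ?_)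
  exact (Real.sq_sqrt (hM.resid_grad_env_nonneg z)).symm

omit [IsProbabilityMeasure νX] [IsProbabilityMeasure νE] in
lemma measurable_inner_grad {θ : EuclideanSpace ℝ (Fin d)} (hθ : θ ∈ Metric.closedBall θ₀ r)
    (u : EuclideanSpace ℝ (Fin d)) : Measurable fun z : 𝒳 × ℝ => inner ℝ (gd z.1 θ) u :=
  ((hM.measurable_grad θ hθ).comp measurable_fst).inner measurable_const

/-- The first order condition at a minimizer of the criterion. -/
lemma integral_resid_mul_inner_eq_zero {θ : EuclideanSpace ℝ (Fin d)} {s : ℝ}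
    (hs : s ∈ Set.Icc (0 : ℝ) 1) (hθ : dist θ θ₀ < r)
    (hmin : ∀ θ' ∈ Θ, criterion νX νE g ℓ θ₀ θ s ≤ criterion νX νE g ℓ θ₀ θ' s)
    (u : EuclideanSpace ℝ (Fin d)) :
    ∫ z, resid g ℓ θ₀ s θ z * inner ℝ (gd z.1 θ) u ∂(νX.prod νE) = 0 := by
  have hcont : Continuous fun t : ℝ => θ + t • u := by fun_prop
  have hnhds : {t : ℝ | θ + t • u ∈ Metric.ball θ₀ r} ∈ 𝓝 (0 : ℝ) :=
    hcont.continuousAt.preimage_mem_nhds (by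
      simpa using Metric.isOpen_ball.mem_nhds (show θ ∈ Metric.ball θ₀ r from hθ))
  have hball : ∀ t ∈ {t : ℝ | θ + t • u ∈ Metric.ball θ₀ r},
      θ + t • u ∈ Metric.closedBall θ₀ r := fun t ht => Metric.ball_subset_closedBall ht
  have h0 : (0 : ℝ) ∈ {t : ℝ | θ + t • u ∈ Metric.ball θ₀ r} := mem_of_mem_nhds hnhds
  have hder := hasDerivAt_integral_of_dominated_loc_of_deriv_le (μ := νX.prod νE) (x₀ := (0 : ℝ))
    (F := fun t z => resid g ℓ θ₀ s (θ + t • u) z ^ 2)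
    (F' := fun t z => -2 * (resid g ℓ θ₀ s (θ + t • u) z * inner ℝ (gd z.1 (θ + t • u)) u))
    (bound := fun z => 2 * (√(J z) * ‖u‖)) hnhds
    (Filter.mem_of_superset hnhds fun t ht =>
      ((hM.measurable_resid (hM.ball_subset (hball t ht)) s).pow_const 2).aestronglyMeasurable)
    ((hM.memLp_resid (hM.ball_subset (hball 0 h0)) hs).integrable_sq)
    (((hM.measurable_resid (hM.ball_subset (hball 0 h0)) s).mul
      (hM.measurable_inner_grad (hball 0 h0) u)).const_mul (-2)).aestronglyMeasurable
    (Eventually.of_forall fun z t ht => by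
      have := hM.abs_resid_mul_inner_le (u := u) (hball t ht) hs z
      rw [Real.norm_eq_abs, abs_mul, abs_neg, abs_two]
      linarith)
    (((hM.memLp_sqrt_env.integrable one_le_two).mul_const ‖u‖).const_mul 2)
    (Eventually.of_forall fun z t ht => by
      have := (hM.hasDerivAt_resid (hball t ht) s z).pow 2
      refine this.congr_deriv ?_
      simp only [Nat.cast_ofNat, Nat.add_one_sub_one, pow_one]
      ring)
  have hloc : IsLocalMin (fun t : ℝ => ∫ z, resid g ℓ θ₀ s (θ + t • u) z ^ 2 ∂(νX.prod νE)) 0 := by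
    refine Filter.mem_of_superset hnhds fun t ht => ?_
    have := hmin _ (hM.ball_subset (hball t ht))
    simpa [criterion] using this
  have hz := hloc.hasDerivAt_eq_zero hder.2
  rw [integral_const_mul] at hz
  simpa using hz

end Criterion

end RegressionConditions

end Regression

/-! ### The drift of the pseudo-true parameter -/

section PseudoTrue

variable {d : ℕ} {𝒳 : Type*} [MeasurableSpace 𝒳]
  {νX : Measure 𝒳} [IsProbabilityMeasure νX] {νE : Measure ℝ} [IsProbabilityMeasure νE]
  {g : 𝒳 → EuclideanSpace ℝ (Fin d) → ℝ} {ℓ : 𝒳 → ℝ}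
  {gd : 𝒳 → EuclideanSpace ℝ (Fin d) → EuclideanSpace ℝ (Fin d)}
  {gdd : 𝒳 → EuclideanSpace ℝ (Fin d) → EuclideanSpace ℝ (Fin d) →L[ℝ] EuclideanSpace ℝ (Fin d)}
  {Θ : Set (EuclideanSpace ℝ (Fin d))} {θ₀ : EuclideanSpace ℝ (Fin d)} {r : ℝ}
  {Gs F : 𝒳 → ℝ} {J H : 𝒳 × ℝ → ℝ}

namespace RegressionConditions

variable (hM : RegressionConditions νX νE g ℓ gd gdd Θ θ₀ r Gs F J H)
include hM

/-- Minimizers for sizes tending to zero converge to `θ₀`. -/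
lemma tendsto_minimizer {δ : ℕ → ℝ} (hδ₀ : ∀ᶠ n in atTop, 0 < δ n) (hδ : Tendsto δ atTop (𝓝 0))
    {θs : ℝ → EuclideanSpace ℝ (Fin d)} (hθs : ∀ s, θs s ∈ Θ)
    (hmin : ∀ s ∈ Set.Icc (0 : ℝ) 1, ∀ θ ∈ Θ,
      criterion νX νE g ℓ θ₀ (θs s) s ≤ criterion νX νE g ℓ θ₀ θ s) :
    Tendsto (fun n => θs (δ n)) atTop (𝓝 θ₀) := by
  rw [Metric.tendsto_nhds]
  intro ρ hρ
  obtain ⟨κ, hκ, h⟩ := hM.exists_separation hρ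
  filter_upwards [hδ₀, hδ.eventually_lt_const hκ, hδ.eventually_lt_const one_pos] with n h0 h1 h2
  exact h _ (hθs _) (δ n) ⟨h0.le, h2.le⟩ h1
    ((hmin (δ n) ⟨h0.le, h2.le⟩ θ₀ hM.mem_param).trans (by linarith))

omit [IsProbabilityMeasure νX] [IsProbabilityMeasure νE] in
lemma abs_grad_apply_le {θ : EuclideanSpace ℝ (Fin d)} (hθ : θ ∈ Metric.closedBall θ₀ r) (x : 𝒳)
    (a : Fin d) : |gd x θ a| ≤ F x := by
  have := PiLp.norm_apply_le (gd x θ) a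
  rw [Real.norm_eq_abs] at this
  exact this.trans (hM.grad_le x θ hθ)

omit [IsProbabilityMeasure νX] [IsProbabilityMeasure νE] in
lemma measurable_grad_apply {θ : EuclideanSpace ℝ (Fin d)} (hθ : θ ∈ Metric.closedBall θ₀ r)
    (a : Fin d) : Measurable fun x => gd x θ a :=
  (measurable_coord a).comp (hM.measurable_grad θ hθ)

omit [IsProbabilityMeasure νX] [IsProbabilityMeasure νE] in
lemma memLp_grad_apply {θ : EuclideanSpace ℝ (Fin d)} (hθ : θ ∈ Metric.closedBall θ₀ r)
    (a : Fin d) : MemLp (fun x => gd x θ a) 2 νX :=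
  hM.grad_env_sq.mono (hM.measurable_grad_apply hθ a).aestronglyMeasurable
    (Eventually.of_forall fun x => (hM.abs_grad_apply_le hθ x a).trans (le_abs_self _))

omit [IsProbabilityMeasure νX] [IsProbabilityMeasure νE] in
lemma memLp_sub {θ : EuclideanSpace ℝ (Fin d)} (hθ : θ ∈ Metric.closedBall θ₀ r) :
    MemLp (fun x => g x θ - g x θ₀) 2 νX := by
  refine (hM.grad_env_sq.mul_const ‖θ - θ₀‖).mono
    ((hM.measurable_g θ (hM.ball_subset hθ)).sub
      (hM.measurable_g θ₀ hM.mem_param)).aestronglyMeasurable (Eventually.of_forall fun x => ?_)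
  exact (hM.abs_sub_le hM.mem_ball hθ x).trans (le_abs_self _)

omit [IsProbabilityMeasure νX] [IsProbabilityMeasure νE] in
lemma memLp_inner_grad (u : EuclideanSpace ℝ (Fin d)) :
    MemLp (fun x => inner ℝ (gd x θ₀) u) 2 νX :=
  (hM.grad_env_sq.mul_const ‖u‖).mono
    ((hM.measurable_grad θ₀ hM.mem_ball).inner measurable_const).aestronglyMeasurable
    (Eventually.of_forall fun x => (abs_real_inner_le_norm _ _).trans
      ((mul_le_mul_of_nonneg_right (hM.grad_le x θ₀ hM.mem_ball) (norm_nonneg _)).trans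
        (le_abs_self _)))

/-- The first order condition, integrated over the error. -/
lemma integral_sub_mul_grad {θ : EuclideanSpace ℝ (Fin d)} {s : ℝ}
    (hs : s ∈ Set.Icc (0 : ℝ) 1) (hθ : dist θ θ₀ < r)
    (hmin : ∀ θ' ∈ Θ, criterion νX νE g ℓ θ₀ θ s ≤ criterion νX νE g ℓ θ₀ θ' s) (a : Fin d) :
    ∫ x, (g x θ - g x θ₀) * gd x θ a ∂νX = s * ∫ x, ℓ x * gd x θ a ∂νX := by
  have hθ' : θ ∈ Metric.closedBall θ₀ r := hθ.le
  have h := hM.integral_resid_mul_inner_eq_zero hs hθ hmin (EuclideanSpace.single a 1)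
  have hin : ∀ x, inner ℝ (gd x θ) (EuclideanSpace.single a (1 : ℝ)) = gd x θ a := fun x => by
    rw [EuclideanSpace.inner_single_right]; simp
  simp only [hin] at h
  have hg := hM.memLp_grad_apply hθ' a
  have i1 : Integrable (fun z : 𝒳 × ℝ => gd z.1 θ a * z.2) (νX.prod νE) :=
    (hg.integrable one_le_two).mul_prod (hM.err_sq.integrable one_le_two)
  have j2 : Integrable (fun x => ℓ x * gd x θ a) νX := hM.ell_sq.integrable_mul hg
  have j3 : Integrable (fun x => (g x θ - g x θ₀) * gd x θ a) νX :=
    (hM.memLp_sub hθ').integrable_mul hg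
  have i2 : Integrable (fun z : 𝒳 × ℝ => s * (ℓ z.1 * gd z.1 θ a)) (νX.prod νE) :=
    (j2.comp_fst νE).const_mul s
  have i3 : Integrable (fun z : 𝒳 × ℝ => (g z.1 θ - g z.1 θ₀) * gd z.1 θ a) (νX.prod νE) :=
    j3.comp_fst νE
  have hexp : ∀ z : 𝒳 × ℝ, resid g ℓ θ₀ s θ z * gd z.1 θ a
      = gd z.1 θ a * z.2 + s * (ℓ z.1 * gd z.1 θ a) - (g z.1 θ - g z.1 θ₀) * gd z.1 θ a :=
    fun z => by unfold resid; ring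
  simp only [hexp] at h
  have i12 : Integrable (fun z : 𝒳 × ℝ => gd z.1 θ a * z.2 + s * (ℓ z.1 * gd z.1 θ a))
    (νX.prod νE) := i1.add i2
  rw [integral_sub i12 i3, integral_add i1 i2, integral_const_mul,
    integral_prod_mul (fun x => gd x θ a) (fun e : ℝ => e), hM.err_mean,
    integral_fun_fst (μ := νX) (ν := νE) (f := fun x => ℓ x * gd x θ a),
    integral_fun_fst (μ := νX) (ν := νE) (f := fun x => (g x θ - g x θ₀) * gd x θ a)] at h
  simp only [probReal_univ, one_smul, mul_zero, zero_add] at h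
  linarith

omit [IsProbabilityMeasure νX] [IsProbabilityMeasure νE] in
/-- The linearization error in the first order condition is `o(‖θ - θ₀‖)`. -/
lemma isLittleO_linearization {θ : ℕ → EuclideanSpace ℝ (Fin d)} (hθ : Tendsto θ atTop (𝓝 θ₀))
    (a : Fin d) :
    (fun n => ∫ x, (g x (θ n) - g x θ₀) * gd x (θ n) a ∂νX
      - ∫ x, inner ℝ (gd x θ₀) (θ n - θ₀) * gd x θ₀ a ∂νX) =o[atTop] fun n => θ n - θ₀ := by
  have hball : ∀ᶠ n in atTop, θ n ∈ Metric.closedBall θ₀ r :=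
    hθ (Metric.closedBall_mem_nhds θ₀ hM.radius_pos)
  set f : ℕ → 𝒳 → ℝ := fun n x => (g x (θ n) - g x θ₀) * gd x (θ n) a
    - inner ℝ (gd x θ₀) (θ n - θ₀) * gd x θ₀ a with hf
  have hint : ∀ᶠ n in atTop, ∫ x, f n x ∂νX = ∫ x, (g x (θ n) - g x θ₀) * gd x (θ n) a ∂νX
      - ∫ x, inner ℝ (gd x θ₀) (θ n - θ₀) * gd x θ₀ a ∂νX := by
    filter_upwards [hball] with n hn
    exact integral_sub ((hM.memLp_sub hn).integrable_mul (hM.memLp_grad_apply hn a))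
      ((hM.memLp_inner_grad _).integrable_mul (hM.memLp_grad_apply hM.mem_ball a))
  refine IsLittleO.congr' ?_ hint EventuallyEq.rfl
  -- dominated convergence for the difference quotients
  have hlim : Tendsto (fun n => ∫ x, ‖θ n - θ₀‖⁻¹ * f n x ∂νX) atTop (𝓝 (∫ _, (0 : ℝ) ∂νX)) := by
    refine tendsto_integral_filter_of_dominated_convergence (fun x => 2 * F x ^ 2) ?_ ?_
      (hM.grad_env_sq.integrable_sq.const_mul 2) (Eventually.of_forall fun x => ?_)
    · filter_upwards [hball] with n hn
      exact (((((hM.measurable_g _ (hM.ball_subset hn)).sub (hM.measurable_g θ₀ hM.mem_param)).mul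
        (hM.measurable_grad_apply hn a)).sub
        (((hM.measurable_grad θ₀ hM.mem_ball).inner measurable_const).mul
          (hM.measurable_grad_apply hM.mem_ball a))).const_mul _).aestronglyMeasurable
    · filter_upwards [hball] with n hn
      refine Eventually.of_forall fun x => ?_
      have hF := hM.grad_env_nonneg x
      have h1 : |(g x (θ n) - g x θ₀) * gd x (θ n) a| ≤ F x * ‖θ n - θ₀‖ * F x := by
        rw [abs_mul]
        exact mul_le_mul (hM.abs_sub_le hM.mem_ball hn x) (hM.abs_grad_apply_le hn x a)
          (abs_nonneg _) (by positivity)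
      have h2 : |inner ℝ (gd x θ₀) (θ n - θ₀) * gd x θ₀ a| ≤ F x * ‖θ n - θ₀‖ * F x := by
        rw [abs_mul]
        exact mul_le_mul ((abs_real_inner_le_norm _ _).trans
          (mul_le_mul_of_nonneg_right (hM.grad_le x θ₀ hM.mem_ball) (norm_nonneg _)))
          (hM.abs_grad_apply_le hM.mem_ball x a) (abs_nonneg _) (by positivity)
      have h3 : |f n x| ≤ ‖θ n - θ₀‖ * (2 * F x ^ 2) :=
        (abs_sub _ _).trans ((add_le_add h1 h2).trans (le_of_eq (by ring)))
      rw [Real.norm_eq_abs, abs_mul, abs_inv, abs_norm]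
      rcases (norm_nonneg (θ n - θ₀)).eq_or_lt with h0 | h0
      · rw [← h0]; simp; positivity
      · rw [inv_mul_le_iff₀ h0]; exact h3
    · have hlo : (fun n => g x (θ n) - g x θ₀ - inner ℝ (gd x θ₀) (θ n - θ₀))
          =o[atTop] fun n => θ n - θ₀ := by
        have := (hM.hasGradientAt x θ₀ hM.mem_ball).hasFDerivAt.isLittleO.comp_tendsto hθ
        simpa [Function.comp_def, InnerProductSpace.toDual_apply_apply] using this
      have hg1 : Tendsto (fun n => gd x (θ n) a) atTop (𝓝 (gd x θ₀ a)) := by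
        have h1 := ((hM.hasFDerivAt x θ₀ hM.mem_ball).continuousAt.tendsto.comp hθ)
        exact ((EuclideanSpace.proj (𝕜 := ℝ) a).continuous.tendsto _).comp h1
      have hA : (fun n => (g x (θ n) - g x θ₀ - inner ℝ (gd x θ₀) (θ n - θ₀)) * gd x (θ n) a)
          =o[atTop] fun n => ‖θ n - θ₀‖ := by
        have := hlo.norm_right.mul_isBigO (hg1.isBigO_one ℝ)
        simpa using this
      have hB : (fun n => inner ℝ (gd x θ₀) (θ n - θ₀) * (gd x (θ n) a - gd x θ₀ a))
          =o[atTop] fun n => ‖θ n - θ₀‖ := by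
        have h1 : (fun n => inner ℝ (gd x θ₀) (θ n - θ₀)) =O[atTop] fun n => ‖θ n - θ₀‖ :=
          IsBigO.of_bound ‖gd x θ₀‖ (Eventually.of_forall fun n => by
            rw [norm_norm]; exact norm_inner_le_norm _ _)
        have h2 : (fun n => gd x (θ n) a - gd x θ₀ a) =o[atTop] fun _ => (1 : ℝ) := by
          rw [isLittleO_one_iff]
          simpa using hg1.sub_const (gd x θ₀ a)
        simpa using h1.mul_isLittleO h2
      have hAB := (hA.add hB).tendsto_div_nhds_zero
      refine hAB.congr fun n => ?_
      simp only [hf]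
      rw [div_eq_inv_mul]
      ring
  rw [integral_zero] at hlim
  refine IsLittleO.of_norm_right ?_
  rw [isLittleO_iff_tendsto' (Eventually.of_forall fun n hn => ?_)]
  · refine hlim.congr fun n => ?_
    rw [integral_const_mul, div_eq_inv_mul]
  · have h0 : θ n = θ₀ := by simpa [sub_eq_zero] using hn
    simp [hf, h0]

/-- The pseudo-true parameter moves in the direction `G⁻¹ E(ġ ℓ)`: this is the linearized first
order condition `G (θ - θ₀) = s E(ġ ℓ) + o(s) + o(‖θ - θ₀‖)`. -/
lemma tendsto_minimizer_div {δ : ℕ → ℝ} (hδ₀ : ∀ᶠ n in atTop, 0 < δ n)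
    (hδ : Tendsto δ atTop (𝓝 0)) {θs : ℝ → EuclideanSpace ℝ (Fin d)} (hθs : ∀ s, θs s ∈ Θ)
    (hmin : ∀ s ∈ Set.Icc (0 : ℝ) 1, ∀ θ ∈ Θ,
      criterion νX νE g ℓ θ₀ (θs s) s ≤ criterion νX νE g ℓ θ₀ θ s) :
    Tendsto (fun n => (δ n)⁻¹ • (θs (δ n) - θ₀)) atTop
      (𝓝 (WithLp.toLp 2 ((Matrix.of fun a b => ∫ x, gd x θ₀ a * gd x θ₀ b ∂νX)⁻¹.mulVec
        fun a => ∫ x, gd x θ₀ a * ℓ x ∂νX))) := by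
  set G : Matrix (Fin d) (Fin d) ℝ := Matrix.of fun a b => ∫ x, gd x θ₀ a * gd x θ₀ b ∂νX with hG
  have hGu : IsUnit G.det := (Matrix.isUnit_iff_isUnit_det G).1 hM.gram_nonsingular
  have hθ := hM.tendsto_minimizer hδ₀ hδ hθs hmin
  set θ : ℕ → EuclideanSpace ℝ (Fin d) := fun n => θs (δ n) with hθdef
  set L : ℕ → Fin d → ℝ := fun n a => ∫ x, ℓ x * gd x (θ n) a ∂νX with hL
  set R : ℕ → Fin d → ℝ := fun n a => ∫ x, (g x (θ n) - g x θ₀) * gd x (θ n) a ∂νX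
      - ∫ x, inner ℝ (gd x θ₀) (θ n - θ₀) * gd x θ₀ a ∂νX with hR
  have hball : ∀ᶠ n in atTop, dist (θ n) θ₀ < r := Metric.tendsto_nhds.1 hθ r hM.radius_pos
  have hRo : R =o[atTop] fun n => (θ n - θ₀).ofLp := by
    rw [isLittleO_pi]
    intro a
    refine (hM.isLittleO_linearization hθ a).trans_isBigO ?_
    have := (PiLp.continuousLinearEquiv 2 ℝ (fun _ : Fin d => ℝ)).symm.isBigO_comp
      (fun n => (θ n - θ₀).ofLp) atTop
    exact this
  have hLlim : Tendsto L atTop (𝓝 fun a => ∫ x, gd x θ₀ a * ℓ x ∂νX) := by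
    rw [tendsto_pi_nhds]
    intro a
    simp only [mul_comm (gd _ θ₀ a)]
    refine tendsto_integral_filter_of_dominated_convergence (fun x => |ℓ x| * F x) ?_ ?_
      (hM.ell_sq.norm.integrable_mul hM.grad_env_sq) (Eventually.of_forall fun x => ?_)
    · filter_upwards [hball] with n hn
      exact (hM.measurable_ell.mul (hM.measurable_grad_apply (le_of_lt hn) a)).aestronglyMeasurable
    · filter_upwards [hball] with n hn
      refine Eventually.of_forall fun x => ?_
      rw [norm_mul]
      exact mul_le_mul_of_nonneg_left (hM.abs_grad_apply_le (le_of_lt hn) x a) (norm_nonneg _)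
    · refine Tendsto.const_mul _ ?_
      have h1 := ((hM.hasFDerivAt x θ₀ hM.mem_ball).continuousAt.tendsto.comp hθ)
      exact ((EuclideanSpace.proj (𝕜 := ℝ) a).continuous.tendsto _).comp h1
  have hGh : ∀ n a, ∫ x, inner ℝ (gd x θ₀) (θ n - θ₀) * gd x θ₀ a ∂νX
      = G.mulVec (θ n - θ₀).ofLp a := by
    intro n a
    have h1 : ∀ x, inner ℝ (gd x θ₀) (θ n - θ₀) * gd x θ₀ a
        = ∑ b, gd x θ₀ a * gd x θ₀ b * (θ n - θ₀) b := fun x => by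
      rw [PiLp.inner_apply, Finset.sum_mul]
      refine Finset.sum_congr rfl fun b _ => ?_
      simp only [RCLike.inner_apply, conj_trivial]
      ring
    simp only [h1]
    have hi : ∀ b, Integrable (fun x => gd x θ₀ a * gd x θ₀ b) νX := fun b =>
      (hM.memLp_grad_apply hM.mem_ball a).integrable_mul (hM.memLp_grad_apply hM.mem_ball b)
    rw [integral_finsetSum _ fun b _ => (hi b).mul_const _]
    simp only [integral_mul_const]
    rfl
  have hfoc : ∀ᶠ n in atTop, (θ n - θ₀).ofLp - δ n • G⁻¹.mulVec (L n) = -G⁻¹.mulVec (R n) := by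
    filter_upwards [hball, hδ₀, hδ.eventually_lt_const one_pos] with n hn h0 h1
    have hs : δ n ∈ Set.Icc (0 : ℝ) 1 := ⟨h0.le, h1.le⟩
    have hRn : R n = δ n • L n - G.mulVec (θ n - θ₀).ofLp := by
      ext a
      have := hM.integral_sub_mul_grad hs hn (hmin _ hs) a
      simp only [hR, Pi.sub_apply, Pi.smul_apply, smul_eq_mul, ← hGh, hL]
      rw [this]
    rw [hRn, Matrix.mulVec_sub, Matrix.mulVec_mulVec, Matrix.nonsing_inv_mul _ hGu,
      Matrix.one_mulVec, Matrix.mulVec_smul]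
    abel
  have hGR : (fun n => G⁻¹.mulVec (R n)) =o[atTop] fun n => (θ n - θ₀).ofLp := by
    have h1 := (LinearMap.toContinuousLinearMap (Matrix.mulVecLin G⁻¹)).isBigO_comp R atTop
    exact h1.trans_isLittleO hRo
  have hequiv : IsEquivalent atTop (fun n => δ n • G⁻¹.mulVec (L n))
      fun n => (θ n - θ₀).ofLp := by
    refine (hGR.congr' ?_ EventuallyEq.rfl)
    filter_upwards [hfoc] with n hn
    simp only [Pi.sub_apply]
    rw [← neg_sub, hn, neg_neg]
  have hGL : Tendsto (fun n => G⁻¹.mulVec (L n)) atTop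
      (𝓝 (G⁻¹.mulVec fun a => ∫ x, gd x θ₀ a * ℓ x ∂νX)) :=
    ((LinearMap.toContinuousLinearMap (Matrix.mulVecLin G⁻¹)).continuous.tendsto _).comp hLlim
  have hsmall : (fun n => (θ n - θ₀).ofLp - δ n • G⁻¹.mulVec (L n)) =o[atTop] δ := by
    have h1 := hequiv.symm.isLittleO
    have h2 : (fun n => δ n • G⁻¹.mulVec (L n)) =O[atTop] δ := by
      have := (isBigO_refl δ atTop).smul (hGL.isBigO_one ℝ)
      simpa using this
    exact h1.trans_isBigO h2
  have hquot : Tendsto (fun n => (δ n)⁻¹ • ((θ n - θ₀).ofLp - δ n • G⁻¹.mulVec (L n))) atTop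
      (𝓝 0) := by
    rw [← isLittleO_one_iff ℝ]
    have := (isBigO_refl (fun n => (δ n)⁻¹) atTop).smul_isLittleO hsmall
    refine this.trans_isBigO (IsBigO.of_bound 1 ?_)
    filter_upwards [hδ₀] with n hn
    simp [hn.ne']
  have hsum := hquot.add hGL
  rw [zero_add] at hsum
  have hfin : Tendsto (fun n => ((δ n)⁻¹ • (θ n - θ₀)).ofLp) atTop
      (𝓝 (G⁻¹.mulVec fun a => ∫ x, gd x θ₀ a * ℓ x ∂νX)) := by
    refine hsum.congr' ?_
    filter_upwards [hδ₀] with n hn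
    rw [smul_sub, smul_smul, inv_mul_cancel₀ hn.ne', one_smul, sub_add_cancel]
    rfl
  exact ((PiLp.continuous_toLp 2 (fun _ : Fin d => ℝ)).tendsto _).comp hfin

end RegressionConditions

end PseudoTrue

/-! ### Consistency of least squares and curvature of the empirical criterion -/

section Consistency

variable {Ω : Type*} [MeasurableSpace Ω] {P : Measure Ω} [IsProbabilityMeasure P]
  {d : ℕ} {𝒳 : Type*} [MeasurableSpace 𝒳]
  {νX : Measure 𝒳} [IsProbabilityMeasure νX] {νE : Measure ℝ} [IsProbabilityMeasure νE]
  {Z : ℕ → Ω → 𝒳 × ℝ}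
  {g : 𝒳 → EuclideanSpace ℝ (Fin d) → ℝ} {ℓ : 𝒳 → ℝ}
  {gd : 𝒳 → EuclideanSpace ℝ (Fin d) → EuclideanSpace ℝ (Fin d)}
  {gdd : 𝒳 → EuclideanSpace ℝ (Fin d) → EuclideanSpace ℝ (Fin d) →L[ℝ] EuclideanSpace ℝ (Fin d)}
  {Θ : Set (EuclideanSpace ℝ (Fin d))} {θ₀ : EuclideanSpace ℝ (Fin d)} {r : ℝ}
  {Gs F : 𝒳 → ℝ} {J H : 𝒳 × ℝ → ℝ} {δ : ℕ → ℝ} {θhat : ℕ → Ω → EuclideanSpace ℝ (Fin d)}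

/-- With probability tending to one, `θhat n` minimizes the empirical least squares criterion of
the local alternative model of size `δ n` over `Θ`. -/
def IsLeastSquaresSequence (P : Measure Ω) (Z : ℕ → Ω → 𝒳 × ℝ)
    (g : 𝒳 → EuclideanSpace ℝ (Fin d) → ℝ) (ℓ : 𝒳 → ℝ) (Θ : Set (EuclideanSpace ℝ (Fin d)))
    (θ₀ : EuclideanSpace ℝ (Fin d)) (δ : ℕ → ℝ) (θhat : ℕ → Ω → EuclideanSpace ℝ (Fin d)) : Prop :=
  WithHighProb P fun n ω => θhat n ω ∈ Θ ∧ ∀ θ ∈ Θ,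
    avg n (fun j => resid g ℓ θ₀ (δ n) (θhat n ω) (Z j ω) ^ 2)
      ≤ avg n fun j => resid g ℓ θ₀ (δ n) θ (Z j ω) ^ 2

/-- Half the second derivative of the squared residual in the direction `u`. -/
noncomputable def curvature (g : 𝒳 → EuclideanSpace ℝ (Fin d) → ℝ) (ℓ : 𝒳 → ℝ)
    (gd : 𝒳 → EuclideanSpace ℝ (Fin d) → EuclideanSpace ℝ (Fin d))
    (gdd : 𝒳 → EuclideanSpace ℝ (Fin d) →
      EuclideanSpace ℝ (Fin d) →L[ℝ] EuclideanSpace ℝ (Fin d))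
    (θ₀ : EuclideanSpace ℝ (Fin d)) (s : ℝ) (θ u : EuclideanSpace ℝ (Fin d)) (z : 𝒳 × ℝ) : ℝ :=
  inner ℝ (gd z.1 θ) u ^ 2 - resid g ℓ θ₀ s θ z * inner ℝ (gdd z.1 θ u) u

namespace RegressionConditions

variable (hM : RegressionConditions νX νE g ℓ gd gdd Θ θ₀ r Gs F J H)
include hM

/-- Consistency of the least squares estimate. -/
lemma withHighProb_dist_lt (hZ : IsSample P Z (νX.prod νE)) (hδ₀ : ∀ᶠ n in atTop, 0 < δ n)
    (hδ : Tendsto δ atTop (𝓝 0)) (hls : IsLeastSquaresSequence P Z g ℓ Θ θ₀ δ θhat)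
    {ρ : ℝ} (hρ : 0 < ρ) : WithHighProb P fun n ω => dist (θhat n ω) θ₀ < ρ := by
  obtain ⟨κ, hκ, hsep⟩ := hM.exists_separation hρ
  have : CompactSpace Θ := isCompact_iff_compactSpace.1 hM.compact_param
  have hlln := hZ.uniform_lln (K := Θ × Set.Icc (0 : ℝ) 1)
    (f := fun z k => resid g ℓ θ₀ k.2 k.1 z ^ 2)
    (fun k => (hM.measurable_resid k.1.2 _).pow_const 2)
    (fun z => by
      have h1 : Continuous fun k : Θ × Set.Icc (0 : ℝ) 1 => resid g ℓ θ₀ k.2 k.1 z :=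
        (hM.continuousOn_resid z).comp_continuous
          (f := fun k : Θ × Set.Icc (0 : ℝ) 1 => ((k.1 : EuclideanSpace ℝ (Fin d)), (k.2 : ℝ)))
          (by fun_prop) fun k => ⟨k.1.2, trivial⟩
      exact h1.pow 2)
    hM.memLp_resid_env.integrable_sq
    (Eventually.of_forall fun z k => by
      rw [abs_of_nonneg (sq_nonneg _), ← sq_abs]
      exact pow_le_pow_left₀ (abs_nonneg _) (hM.abs_resid_le k.1.2 k.2.2 z) 2)
    (half_pos hκ)
  refine (hlln.and hls).mono ?_
  filter_upwards [hδ₀, hδ.eventually_lt_const hκ, hδ.eventually_lt_const one_pos]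
    with n h0 h1 h2 ω hω
  obtain ⟨hu, hmem, hmin⟩ := hω
  have hs : δ n ∈ Set.Icc (0 : ℝ) 1 := ⟨h0.le, h2.le⟩
  have e1 := (abs_lt.1 (hu (⟨θhat n ω, hmem⟩, ⟨δ n, hs⟩))).1
  have e2 := (abs_lt.1 (hu (⟨θ₀, hM.mem_param⟩, ⟨δ n, hs⟩))).2
  have e3 := hmin θ₀ hM.mem_param
  refine hsep _ hmem (δ n) hs h1 ?_
  unfold criterion
  simp only at e1 e2
  linarith

omit [IsProbabilityMeasure νX] [IsProbabilityMeasure νE] in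
lemma measurable_curvature {θ : EuclideanSpace ℝ (Fin d)} (hθ : θ ∈ Metric.closedBall θ₀ r) (s : ℝ)
    (u : EuclideanSpace ℝ (Fin d)) : Measurable (curvature g ℓ gd gdd θ₀ s θ u) :=
  ((hM.measurable_inner_grad hθ u).pow_const 2).sub
    ((hM.measurable_resid (hM.ball_subset hθ) s).mul
      (((hM.measurable_hess θ hθ u).comp measurable_fst).inner measurable_const))

omit [IsProbabilityMeasure νX] [IsProbabilityMeasure νE] in
lemma continuousOn_curvature (z : 𝒳 × ℝ) :
    ContinuousOn (fun k : EuclideanSpace ℝ (Fin d) × ℝ × EuclideanSpace ℝ (Fin d) =>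
      curvature g ℓ gd gdd θ₀ k.2.1 k.1 k.2.2 z) (Metric.closedBall θ₀ r ×ˢ Set.univ) := by
  have hfst : ∀ k ∈ Metric.closedBall θ₀ r ×ˢ
      (Set.univ : Set (ℝ × EuclideanSpace ℝ (Fin d))), k.1 ∈ Metric.closedBall θ₀ r :=
    fun k hk => hk.1
  have h1 : ContinuousOn (fun k : EuclideanSpace ℝ (Fin d) × ℝ × EuclideanSpace ℝ (Fin d) =>
      gd z.1 k.1) (Metric.closedBall θ₀ r ×ˢ Set.univ) :=
    (hM.continuousOn_grad z.1).comp continuousOn_fst hfst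
  have h2 : ContinuousOn (fun k : EuclideanSpace ℝ (Fin d) × ℝ × EuclideanSpace ℝ (Fin d) =>
      gdd z.1 k.1) (Metric.closedBall θ₀ r ×ˢ Set.univ) :=
    (hM.continuousOn_hess z.1).comp continuousOn_fst hfst
  have h3 : ContinuousOn (fun k : EuclideanSpace ℝ (Fin d) × ℝ × EuclideanSpace ℝ (Fin d) =>
      resid g ℓ θ₀ k.2.1 k.1 z) (Metric.closedBall θ₀ r ×ˢ Set.univ) :=
    (hM.continuousOn_resid z).comp
      (f := fun k : EuclideanSpace ℝ (Fin d) × ℝ × EuclideanSpace ℝ (Fin d) => (k.1, k.2.1))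
      (by fun_prop) fun k hk => ⟨hM.ball_subset hk.1, trivial⟩
  have h4 : ContinuousOn (fun k : EuclideanSpace ℝ (Fin d) × ℝ × EuclideanSpace ℝ (Fin d) =>
      k.2.2) (Metric.closedBall θ₀ r ×ˢ Set.univ) := by fun_prop
  exact ((h1.inner h4).pow 2).sub (h3.mul ((h2.clm_apply h4).inner h4))

omit [IsProbabilityMeasure νX] [IsProbabilityMeasure νE] in
lemma ae_abs_curvature_le : ∀ᵐ z ∂(νX.prod νE), ∀ θ ∈ Metric.closedBall θ₀ r,
    ∀ s ∈ Set.Icc (0 : ℝ) 1, ∀ u : EuclideanSpace ℝ (Fin d), ‖u‖ ≤ 1 →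
      |curvature g ℓ gd gdd θ₀ s θ u z| ≤ F z.1 ^ 2 + H z := by
  filter_upwards [hM.resid_hess_le] with z hz θ hθ s hs u hu
  have h1 : |inner ℝ (gd z.1 θ) u| ≤ F z.1 :=
    (abs_real_inner_le_norm _ _).trans
      ((mul_le_mul (hM.grad_le z.1 θ hθ) hu (norm_nonneg _) (hM.grad_env_nonneg _)).trans_eq
        (mul_one _))
  have h2 : |inner ℝ (gdd z.1 θ u) u| ≤ ‖gdd z.1 θ‖ :=
    calc _ ≤ ‖gdd z.1 θ u‖ * ‖u‖ := abs_real_inner_le_norm _ _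
      _ ≤ ‖gdd z.1 θ‖ * 1 * 1 := by
        gcongr
        exact (gdd z.1 θ).le_opNorm_of_le hu
      _ = _ := by ring
  unfold curvature
  refine (abs_sub _ _).trans (add_le_add ?_ ?_)
  · rw [abs_of_nonneg (sq_nonneg _), ← sq_abs]
    exact pow_le_pow_left₀ (abs_nonneg _) h1 2
  · rw [abs_mul]
    exact (mul_le_mul_of_nonneg_left h2 (abs_nonneg _)).trans (hz θ hθ s hs)

omit [IsProbabilityMeasure νX] in
lemma integrable_curvature_env :
    Integrable (fun z : 𝒳 × ℝ => F z.1 ^ 2 + H z) (νX.prod νE) :=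
  (hM.grad_env_sq.integrable_sq.comp_fst νE).add hM.resid_hess_env

omit [IsProbabilityMeasure νX] [IsProbabilityMeasure νE] in
/-- The Gram matrix is positive definite. -/
lemma integral_inner_grad_sq_pos {u : EuclideanSpace ℝ (Fin d)} (hu : u ≠ 0) :
    0 < ∫ x, inner ℝ (gd x θ₀) u ^ 2 ∂νX := by
  have hin : ∀ x, inner ℝ (gd x θ₀) u = ∑ b, gd x θ₀ b * u b := fun x => by
    rw [PiLp.inner_apply]
    exact Finset.sum_congr rfl fun b _ => by simp [mul_comm]
  refine (integral_nonneg fun x => sq_nonneg _).lt_of_ne fun h0 => hu ?_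
  have hae := (integral_eq_zero_iff_of_nonneg (fun x => sq_nonneg _) (hM.memLp_inner_grad u).integrable_sq).1 h0.symm
  set G : Matrix (Fin d) (Fin d) ℝ := Matrix.of fun a b => ∫ x, gd x θ₀ a * gd x θ₀ b ∂νX with hG
  have hGu : IsUnit G.det := (Matrix.isUnit_iff_isUnit_det G).1 hM.gram_nonsingular
  have hmul : G.mulVec u.ofLp = 0 := by
    ext a
    have hi : ∀ b, Integrable (fun x => gd x θ₀ a * gd x θ₀ b) νX := fun b =>
      (hM.memLp_grad_apply hM.mem_ball a).integrable_mul (hM.memLp_grad_apply hM.mem_ball b)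
    have h1 : G.mulVec u.ofLp a = ∫ x, ∑ b, gd x θ₀ a * gd x θ₀ b * u b ∂νX := by
      rw [integral_finsetSum _ fun b _ => (hi b).mul_const _]
      simp only [integral_mul_const]
      rfl
    rw [h1, Pi.zero_apply]
    refine integral_eq_zero_of_ae ?_
    filter_upwards [hae] with x hx
    have hx0 : inner ℝ (gd x θ₀) u = 0 := pow_eq_zero_iff two_ne_zero |>.1 hx
    rw [hin] at hx0
    simp only [mul_assoc, ← Finset.mul_sum, hx0, mul_zero, Pi.zero_apply]
  have : u.ofLp = 0 := by
    have h2 := congrArg G⁻¹.mulVec hmul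
    rwa [Matrix.mulVec_mulVec, Matrix.nonsing_inv_mul _ hGu, Matrix.one_mulVec,
      Matrix.mulVec_zero] at h2
  exact PiLp.ext fun a => congrFun this a

/-- At the true parameter of the null model the expected curvature is the Gram form, since the
centred error is independent of the covariate. -/
lemma integral_curvature_pos {u : EuclideanSpace ℝ (Fin d)} (hu : ‖u‖ = 1) :
    0 < ∫ z, curvature g ℓ gd gdd θ₀ 0 θ₀ u z ∂(νX.prod νE) := by
  have hu0 : u ≠ 0 := fun h => by simp [h] at hu
  have hcint : Integrable (curvature g ℓ gd gdd θ₀ 0 θ₀ u) (νX.prod νE) :=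
    hM.integrable_curvature_env.mono' (hM.measurable_curvature hM.mem_ball 0 u).aestronglyMeasurable
      (hM.ae_abs_curvature_le.mono fun z hz => hz θ₀ hM.mem_ball 0 ⟨le_rfl, zero_le_one⟩ u hu.le)
  have h1 : Integrable (fun z : 𝒳 × ℝ => inner ℝ (gd z.1 θ₀) u ^ 2) (νX.prod νE) :=
    (hM.memLp_inner_grad u).integrable_sq.comp_fst νE
  have hres : ∀ z : 𝒳 × ℝ, curvature g ℓ gd gdd θ₀ 0 θ₀ u z
      = inner ℝ (gd z.1 θ₀) u ^ 2 - inner ℝ (gdd z.1 θ₀ u) u * z.2 := fun z => by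
    simp only [curvature, resid]; ring
  have h2 : Integrable (fun z : 𝒳 × ℝ => inner ℝ (gdd z.1 θ₀ u) u * z.2) (νX.prod νE) := by
    refine (h1.sub hcint).congr (Eventually.of_forall fun z => ?_)
    simp only [Pi.sub_apply, hres]
    ring
  simp only [hres]
  rw [integral_sub h1 h2, integral_prod_mul (fun x => inner ℝ (gdd x θ₀ u) u) (fun e : ℝ => e),
    hM.err_mean, mul_zero, sub_zero,
    integral_fun_fst (μ := νX) (ν := νE) (f := fun x => inner ℝ (gd x θ₀) u ^ 2)]
  simpa using hM.integral_inner_grad_sq_pos hu0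

/-- The empirical criterion is uniformly convex near `θ₀`, with probability tending to one. -/
lemma exists_curvature_bound (hZ : IsSample P Z (νX.prod νE)) (hδ₀ : ∀ᶠ n in atTop, 0 < δ n)
    (hδ : Tendsto δ atTop (𝓝 0)) : ∃ c, 0 < c ∧ ∃ ρ, 0 < ρ ∧ ρ ≤ r ∧ WithHighProb P fun n ω =>
      ∀ θ ∈ Metric.closedBall θ₀ ρ, ∀ u,
        c * ‖u‖ ^ 2 ≤ avg n fun j => curvature g ℓ gd gdd θ₀ (δ n) θ u (Z j ω) := by
  set B := Metric.closedBall θ₀ r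
  set S := Metric.sphere (0 : EuclideanSpace ℝ (Fin d)) 1
  have hBc : IsCompact B := isCompact_closedBall θ₀ r
  have hSc : IsCompact S := isCompact_sphere 0 1
  set A : Set (EuclideanSpace ℝ (Fin d) × ℝ × EuclideanSpace ℝ (Fin d)) :=
    B ×ˢ Set.Icc (0 : ℝ) 1 ×ˢ S with hA
  have hAc : IsCompact A := hBc.prod (isCompact_Icc.prod hSc)
  have hunit : ∀ u ∈ S, ‖u‖ = 1 := fun u hu => by simpa [S] using hu
  set Q : EuclideanSpace ℝ (Fin d) × ℝ × EuclideanSpace ℝ (Fin d) → ℝ :=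
    fun k => ∫ z, curvature g ℓ gd gdd θ₀ k.2.1 k.1 k.2.2 z ∂(νX.prod νE) with hQ
  have hQc : ContinuousOn Q A :=
    continuousOn_of_dominated (bound := fun z => F z.1 ^ 2 + H z)
      (fun k hk => (hM.measurable_curvature hk.1 _ _).aestronglyMeasurable)
      (fun k hk => hM.ae_abs_curvature_le.mono fun z hz =>
        hz k.1 hk.1 k.2.1 hk.2.1 k.2.2 (hunit _ hk.2.2).le)
      hM.integrable_curvature_env
      (Eventually.of_forall fun z => (hM.continuousOn_curvature z).mono fun k hk => ⟨hk.1, trivial⟩)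
  obtain ⟨m, hm, hQm⟩ : ∃ m, 0 < m ∧ ∀ k ∈ A, dist k.1 θ₀ ≤ m → k.2.1 < m → 2 * m ≤ Q k := by
    rcases A.eq_empty_or_nonempty with hne | hne
    · exact ⟨1, one_pos, fun k hk => by rw [hne] at hk; exact hk.elim⟩
    -- this function is positive on `A` and bounds `Q` from below near `(θ₀, 0)`
    set φ : EuclideanSpace ℝ (Fin d) × ℝ × EuclideanSpace ℝ (Fin d) → ℝ :=
      fun k => max (Q k) 0 + dist k.1 θ₀ + k.2.1 with hφ
    have hφc : ContinuousOn φ A :=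
      ((hQc.sup continuousOn_const).add (by fun_prop)).add (by fun_prop)
    obtain ⟨k₀, hk₀, hmin⟩ := hAc.exists_isMinOn hne hφc
    have hpos : 0 < φ k₀ := by
      have hmax := le_max_right (Q k₀) 0
      have hs0 := hk₀.2.1.1
      rcases (dist_nonneg (x := k₀.1) (y := θ₀)).eq_or_lt with h0 | h0
      · rcases hs0.eq_or_lt with h1 | h1
        · have : 0 < Q k₀ := by
            have := hM.integral_curvature_pos (hunit _ hk₀.2.2)
            simp only [hQ]
            rwa [dist_eq_zero.1 h0.symm, ← h1]
          have := lt_max_of_lt_left (b := Q k₀) (c := 0) this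
          simp only [hφ]
          linarith
        · simp only [hφ]; linarith
      · simp only [hφ]; linarith
    refine ⟨φ k₀ / 5, by positivity, fun k hk hd hs => ?_⟩
    have h1 : φ k₀ ≤ max (Q k) 0 + dist k.1 θ₀ + k.2.1 := hmin hk
    have h2 : 2 * (φ k₀ / 5) ≤ max (Q k) 0 := by linarith
    rcases le_max_iff.1 h2 with h3 | h3
    · exact h3
    · linarith
  have : CompactSpace B := isCompact_iff_compactSpace.1 hBc
  have : CompactSpace S := isCompact_iff_compactSpace.1 hSc
  have hlln := hZ.uniform_lln (K := B × Set.Icc (0 : ℝ) 1 × S)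
    (f := fun z k => curvature g ℓ gd gdd θ₀ k.2.1 k.1 k.2.2 z)
    (fun k => hM.measurable_curvature k.1.2 _ _)
    (fun z => (hM.continuousOn_curvature z).comp_continuous
      (f := fun k : B × Set.Icc (0 : ℝ) 1 × S =>
        ((k.1 : EuclideanSpace ℝ (Fin d)), (k.2.1 : ℝ), (k.2.2 : EuclideanSpace ℝ (Fin d))))
      (by fun_prop) fun k => ⟨k.1.2, trivial⟩)
    hM.integrable_curvature_env
    (hM.ae_abs_curvature_le.mono fun z hz k =>
      hz k.1 k.1.2 k.2.1 k.2.1.2 k.2.2 (hunit _ k.2.2.2).le) hm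
  refine ⟨m, hm, min m r, lt_min hm hM.radius_pos, min_le_right _ _, hlln.mono ?_⟩
  filter_upwards [hδ₀, hδ.eventually_lt_const hm, hδ.eventually_lt_const one_pos]
    with n h0 h1 h2 ω hω θ hθ u
  rcases eq_or_ne u 0 with rfl | hu
  · simp [curvature, avg]
  have hθB : θ ∈ B := Metric.closedBall_subset_closedBall (min_le_right _ _) hθ
  have hs : δ n ∈ Set.Icc (0 : ℝ) 1 := ⟨h0.le, h2.le⟩
  have hu' : ‖u‖ ≠ 0 := norm_ne_zero_iff.2 hu
  have hv : ‖u‖⁻¹ • u ∈ S := by simp [S, norm_smul, hu']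
  have e1 := (abs_lt.1 (hω (⟨θ, hθB⟩, ⟨δ n, hs⟩, ⟨_, hv⟩))).1
  have e2 := hQm (θ, δ n, ‖u‖⁻¹ • u) ⟨hθB, hs, hv⟩ (le_trans hθ (min_le_left _ _)) h1
  simp only [hQ] at e1 e2
  have hscale : ∀ z : 𝒳 × ℝ, curvature g ℓ gd gdd θ₀ (δ n) θ u z
      = ‖u‖ ^ 2 * curvature g ℓ gd gdd θ₀ (δ n) θ (‖u‖⁻¹ • u) z := fun z => by
    simp only [curvature, map_smul, real_inner_smul_left, real_inner_smul_right]
    field_simp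
  simp only [hscale]
  rw [avg_const_mul, mul_comm]
  exact mul_le_mul_of_nonneg_left (by linarith) (sq_nonneg _)

end RegressionConditions

end Consistency

/-! ### The rate of the least squares estimate -/

section Rate

variable {Ω : Type*} [MeasurableSpace Ω] {P : Measure Ω} [IsProbabilityMeasure P]
  {d : ℕ} {𝒳 : Type*} [MeasurableSpace 𝒳]
  {νX : Measure 𝒳} [IsProbabilityMeasure νX] {νE : Measure ℝ} [IsProbabilityMeasure νE]
  {Z : ℕ → Ω → 𝒳 × ℝ}
  {g : 𝒳 → EuclideanSpace ℝ (Fin d) → ℝ} {ℓ : 𝒳 → ℝ}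
  {gd : 𝒳 → EuclideanSpace ℝ (Fin d) → EuclideanSpace ℝ (Fin d)}
  {gdd : 𝒳 → EuclideanSpace ℝ (Fin d) → EuclideanSpace ℝ (Fin d) →L[ℝ] EuclideanSpace ℝ (Fin d)}
  {Θ : Set (EuclideanSpace ℝ (Fin d))} {θ₀ : EuclideanSpace ℝ (Fin d)} {r : ℝ}
  {Gs F : 𝒳 → ℝ} {J H : 𝒳 × ℝ → ℝ} {δ : ℕ → ℝ} {θhat : ℕ → Ω → EuclideanSpace ℝ (Fin d)}

lemma hasDerivAt_avg {n : ℕ} {f : ℕ → ℝ → ℝ} {f' : ℕ → ℝ} {t : ℝ}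
    (h : ∀ j, HasDerivAt (f j) (f' j) t) :
    HasDerivAt (fun t => avg n fun j => f j t) (avg n f') t :=
  (HasDerivAt.fun_sum fun j _ => h j).const_mul _

namespace RegressionConditions

variable (hM : RegressionConditions νX νE g ℓ gd gdd Θ θ₀ r Gs F J H)
include hM

omit [IsProbabilityMeasure νX] [IsProbabilityMeasure νE] in
lemma hasDerivAt_resid_mul_inner {θ u : EuclideanSpace ℝ (Fin d)} {t : ℝ}
    (ht : θ + t • u ∈ Metric.closedBall θ₀ r) (s : ℝ) (z : 𝒳 × ℝ) :
    HasDerivAt (fun t : ℝ => resid g ℓ θ₀ s (θ + t • u) z * inner ℝ (gd z.1 (θ + t • u)) u)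
      (-curvature g ℓ gd gdd θ₀ s (θ + t • u) u z) t := by
  have h1 : HasDerivAt (fun t : ℝ => θ + t • u) u t := by
    simpa using ((hasDerivAt_id t).smul_const u).const_add θ
  have h2 := (hM.hasFDerivAt z.1 _ ht).comp_hasDerivAt t h1
  have h3 := (hM.hasDerivAt_resid ht s z).mul (h2.inner ℝ (hasDerivAt_const t u))
  refine h3.congr_deriv ?_
  simp only [curvature, Function.comp_apply, inner_zero_right, zero_add]
  ring

omit [IsProbabilityMeasure νX] [IsProbabilityMeasure νE] in
/-- The empirical first order condition at an interior minimizer. -/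
lemma avg_resid_mul_inner_eq_zero {n : ℕ} {z : ℕ → 𝒳 × ℝ} {θ : EuclideanSpace ℝ (Fin d)} {s : ℝ}
    (hθ : dist θ θ₀ < r) (hmin : ∀ θ' ∈ Θ,
      avg n (fun j => resid g ℓ θ₀ s θ (z j) ^ 2) ≤ avg n fun j => resid g ℓ θ₀ s θ' (z j) ^ 2)
    (u : EuclideanSpace ℝ (Fin d)) :
    avg n (fun j => resid g ℓ θ₀ s θ (z j) * inner ℝ (gd (z j).1 θ) u) = 0 := by
  have hcont : Continuous fun t : ℝ => θ + t • u := by fun_prop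
  have hnhds : {t : ℝ | θ + t • u ∈ Metric.ball θ₀ r} ∈ 𝓝 (0 : ℝ) :=
    hcont.continuousAt.preimage_mem_nhds (by
      simpa using Metric.isOpen_ball.mem_nhds (show θ ∈ Metric.ball θ₀ r from hθ))
  have hmem : (0 : ℝ) ∈ {t : ℝ | θ + t • u ∈ Metric.ball θ₀ r} := mem_of_mem_nhds hnhds
  have h0 : θ + (0 : ℝ) • u ∈ Metric.closedBall θ₀ r := Metric.ball_subset_closedBall hmem
  have hder := hasDerivAt_avg (n := n) fun j => (hM.hasDerivAt_resid h0 s (z j)).pow 2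
  have hloc : IsLocalMin (fun t : ℝ => avg n fun j => resid g ℓ θ₀ s (θ + t • u) (z j) ^ 2) 0 := by
    refine Filter.mem_of_superset hnhds fun t ht => ?_
    have := hmin _ (hM.ball_subset (Metric.ball_subset_closedBall ht))
    simpa using this
  have hz := hloc.hasDerivAt_eq_zero hder
  have heq : (fun j => ((2 : ℕ) : ℝ) * resid g ℓ θ₀ s (θ + (0 : ℝ) • u) (z j) ^ (2 - 1)
      * -inner ℝ (gd (z j).1 (θ + (0 : ℝ) • u)) u)
      = fun j => -2 * (resid g ℓ θ₀ s θ (z j) * inner ℝ (gd (z j).1 θ) u) := by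
    funext j
    simp only [zero_smul, add_zero, Nat.cast_ofNat, Nat.add_one_sub_one, pow_one]
    ring
  rw [heq, avg_const_mul] at hz
  simpa using hz

omit [IsProbabilityMeasure νX] [IsProbabilityMeasure νE] in
/-- Uniform convexity bounds the distance from a minimizer by the score. -/
lemma mul_norm_sq_le_avg_score {n : ℕ} {z : ℕ → 𝒳 × ℝ} {θ θ' : EuclideanSpace ℝ (Fin d)} {s c ρ : ℝ}
    (hρ : ρ ≤ r) (hθ : dist θ θ₀ < ρ) (hθ' : dist θ' θ₀ < ρ)
    (hmin : ∀ θ'' ∈ Θ,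
      avg n (fun j => resid g ℓ θ₀ s θ (z j) ^ 2) ≤ avg n fun j => resid g ℓ θ₀ s θ'' (z j) ^ 2)
    (hcurv : ∀ θ ∈ Metric.closedBall θ₀ ρ, ∀ u,
        c * ‖u‖ ^ 2 ≤ avg n fun j => curvature g ℓ gd gdd θ₀ s θ u (z j)) :
    c * ‖θ - θ'‖ ^ 2
      ≤ avg n fun j => resid g ℓ θ₀ s θ' (z j) * inner ℝ (gd (z j).1 θ') (θ - θ') := by
  set u := θ - θ' with hu
  have hseg : ∀ t ∈ Set.Icc (0 : ℝ) 1, θ' + t • u ∈ Metric.closedBall θ₀ ρ := fun t ht =>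
    (convex_closedBall θ₀ ρ).add_smul_sub_mem hθ'.le hθ.le ht
  have hseg' : ∀ t ∈ Set.Icc (0 : ℝ) 1, θ' + t • u ∈ Metric.closedBall θ₀ r := fun t ht =>
    Metric.closedBall_subset_closedBall hρ (hseg t ht)
  set ψ : ℝ → ℝ := fun t =>
    avg n fun j => resid g ℓ θ₀ s (θ' + t • u) (z j) * inner ℝ (gd (z j).1 (θ' + t • u)) u with hψ
  have hder : ∀ t ∈ Set.Icc (0 : ℝ) 1, HasDerivAt ψ
      (avg n fun j => -curvature g ℓ gd gdd θ₀ s (θ' + t • u) u (z j)) t := fun t ht =>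
    hasDerivAt_avg fun j => hM.hasDerivAt_resid_mul_inner (hseg' t ht) s (z j)
  have hmv := (convex_Icc (0 : ℝ) 1).image_sub_le_mul_sub_of_deriv_le (f := ψ) (C := -(c * ‖u‖ ^ 2))
    (fun t ht => (hder t ht).continuousAt.continuousWithinAt)
    (fun t ht => (hder t (interior_subset ht)).differentiableAt.differentiableWithinAt)
    (fun t ht => by
      rw [(hder t (interior_subset ht)).deriv]
      have h1 := hcurv _ (hseg t (interior_subset ht)) u
      have h2 := avg_const_mul n (-1)
        fun j => curvature g ℓ gd gdd θ₀ s (θ' + t • u) u (z j)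
      simp only [neg_mul, one_mul] at h2
      linarith)
    0 ⟨le_rfl, zero_le_one⟩ 1 ⟨zero_le_one, le_rfl⟩ zero_le_one
  have h1 : ψ 1 = 0 := by
    have := hM.avg_resid_mul_inner_eq_zero (hθ.trans_le hρ) hmin u
    simpa [hψ, hu] using this
  have h0 : ψ 0 = avg n fun j => resid g ℓ θ₀ s θ' (z j) * inner ℝ (gd (z j).1 θ') u := by
    simp [hψ]
  rw [← h0]
  linarith

omit [IsProbabilityMeasure νX] [IsProbabilityMeasure νE] in
lemma measurable_resid_mul_grad {θ : EuclideanSpace ℝ (Fin d)} (hθ : θ ∈ Metric.closedBall θ₀ r)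
    (s : ℝ) (a : Fin d) : Measurable fun z : 𝒳 × ℝ => resid g ℓ θ₀ s θ z * gd z.1 θ a :=
  (hM.measurable_resid (hM.ball_subset hθ) s).mul
    ((hM.measurable_grad_apply hθ a).comp measurable_fst)

/-- At the minimizers of the population criterion the score is `O_P(n^{-1/2})`. -/
lemma bddInProb_score (hZ : IsSample P Z (νX.prod νE)) (hδ₀ : ∀ᶠ n in atTop, 0 < δ n)
    (hδ : Tendsto δ atTop (𝓝 0)) {θs : ℝ → EuclideanSpace ℝ (Fin d)} (hθs : ∀ s, θs s ∈ Θ)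
    (hmin : ∀ s ∈ Set.Icc (0 : ℝ) 1, ∀ θ ∈ Θ,
      criterion νX νE g ℓ θ₀ (θs s) s ≤ criterion νX νE g ℓ θ₀ θ s) (a : Fin d) :
    BddInProb P fun n ω => (n : ℝ) * avg n
      (fun j => resid g ℓ θ₀ (δ n) (θs (δ n)) (Z j ω) * gd (Z j ω).1 (θs (δ n)) a) ^ 2 := by
  refine bddInProb_of_integral_le (C := ∫ z, √(J z) ^ 2 ∂(νX.prod νE)) (fun n ω => by positivity) ?_
  have hθ := hM.tendsto_minimizer hδ₀ hδ hθs hmin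
  filter_upwards [hδ₀, hδ.eventually_lt_const one_pos, eventually_ge_atTop 1,
    Metric.tendsto_nhds.1 hθ r hM.radius_pos] with n h0 h1 hn hd
  have hs : δ n ∈ Set.Icc (0 : ℝ) 1 := ⟨h0.le, h1.le⟩
  have hball : θs (δ n) ∈ Metric.closedBall θ₀ r := le_of_lt hd
  have hin : ∀ x, inner ℝ (gd x (θs (δ n))) (EuclideanSpace.single a (1 : ℝ))
      = gd x (θs (δ n)) a := fun x => by
    rw [EuclideanSpace.inner_single_right]; simp
  have hfoc := hM.integral_resid_mul_inner_eq_zero hs hd (hmin _ hs) (EuclideanSpace.single a 1)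
  simp only [hin] at hfoc
  have hb : ∀ z, |resid g ℓ θ₀ (δ n) (θs (δ n)) z * gd z.1 (θs (δ n)) a| ≤ √(J z) := fun z => by
    have := hM.abs_resid_mul_inner_le (u := EuclideanSpace.single a (1 : ℝ)) hball hs z
    rw [hin] at this
    simpa using this
  have hk := hZ.kernel_bound (f := fun z _ => resid g ℓ θ₀ (δ n) (θs (δ n)) z * gd z.1 (θs (δ n)) a)
    ((hM.measurable_resid_mul_grad hball _ a).comp measurable_fst) (fun _ => hfoc)
    hM.memLp_sqrt_env (fun z _ => hb z) hn
  simp only [avg_const hn] at hk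
  refine ⟨hk.1.const_mul _, ?_⟩
  rw [integral_const_mul]
  exact hk.2

/-- The least squares estimate is within `O_P(n^{-1/2})` of the minimizer of the population
criterion. -/
lemma bddInProb_norm_sub_sq (hZ : IsSample P Z (νX.prod νE)) (hδ₀ : ∀ᶠ n in atTop, 0 < δ n)
    (hδ : Tendsto δ atTop (𝓝 0)) (hls : IsLeastSquaresSequence P Z g ℓ Θ θ₀ δ θhat)
    {θs : ℝ → EuclideanSpace ℝ (Fin d)} (hθs : ∀ s, θs s ∈ Θ)
    (hmin : ∀ s ∈ Set.Icc (0 : ℝ) 1, ∀ θ ∈ Θ,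
      criterion νX νE g ℓ θ₀ (θs s) s ≤ criterion νX νE g ℓ θ₀ θ s) :
    BddInProb P fun n ω => (n : ℝ) * ‖θhat n ω - θs (δ n)‖ ^ 2 := by
  obtain ⟨c, hc, ρ, hρ, hρr, hcurv⟩ := hM.exists_curvature_bound hZ hδ₀ hδ
  have hθ := hM.tendsto_minimizer hδ₀ hδ hθs hmin
  have hsum := (BddInProb.sum Finset.univ fun a _ =>
    hM.bddInProb_score hZ hδ₀ hδ hθs hmin a).const_mul (c := (c ^ 2)⁻¹) (by positivity)
  refine hsum.mono (((hcurv.and (hM.withHighProb_dist_lt hZ hδ₀ hδ hls hρ)).and hls).mono ?_)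
  filter_upwards [Metric.tendsto_nhds.1 hθ ρ hρ] with n hd ω hω
  obtain ⟨⟨h1, h2⟩, -, h3⟩ := hω
  have hle := hM.mul_norm_sq_le_avg_score hρr h2 hd h3 h1
  set u := θhat n ω - θs (δ n)
  set N : Fin d → ℝ := fun a =>
    avg n (fun j => resid g ℓ θ₀ (δ n) (θs (δ n)) (Z j ω) * gd (Z j ω).1 (θs (δ n)) a) with hN
  have hexp : avg n (fun j => resid g ℓ θ₀ (δ n) (θs (δ n)) (Z j ω)
      * inner ℝ (gd (Z j ω).1 (θs (δ n))) u) = ∑ a, u a * N a := by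
    simp only [hN, ← avg_const_mul]
    rw [← avg_sum]
    congr 1
    funext j
    rw [PiLp.inner_apply, Finset.mul_sum]
    refine Finset.sum_congr rfl fun a _ => ?_
    simp only [RCLike.inner_apply, conj_trivial]
    ring
  rw [hexp] at hle
  have hcs := Finset.sum_mul_sq_le_sq_mul_sq Finset.univ (fun a => u a) N
  have hnu : ‖u‖ ^ 2 = ∑ a, u a ^ 2 := EuclideanSpace.real_norm_sq_eq u
  rw [← hnu] at hcs
  have hN0 : 0 ≤ ∑ a, N a ^ 2 := Finset.sum_nonneg fun a _ => sq_nonneg _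
  have hfin : c ^ 2 * ‖u‖ ^ 2 ≤ ∑ a, N a ^ 2 := by
    rcases (sq_nonneg ‖u‖).eq_or_lt with h0 | h0
    · rw [← h0, mul_zero]; exact hN0
    · have h4 := (pow_le_pow_left₀ (by positivity) hle 2).trans hcs
      refine le_of_mul_le_mul_left ?_ h0
      calc _ = (c * ‖u‖ ^ 2) ^ 2 := by ring
        _ ≤ _ := h4
  rw [← Finset.mul_sum]
  calc (n : ℝ) * ‖u‖ ^ 2 = (c ^ 2)⁻¹ * (n * (c ^ 2 * ‖u‖ ^ 2)) := by field_simp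
    _ ≤ _ := by gcongr

end RegressionConditions

end Rate

/-! ### Residuals of the least squares fit -/

section LeastSquaresResiduals

variable {Ω : Type*} [MeasurableSpace Ω] {P : Measure Ω} [IsProbabilityMeasure P]
  {p d : ℕ}
  {νX : Measure (EuclideanSpace ℝ (Fin p))} [IsProbabilityMeasure νX]
  {νE : Measure ℝ} [IsProbabilityMeasure νE]
  {Z : ℕ → Ω → EuclideanSpace ℝ (Fin p) × ℝ}
  {g : EuclideanSpace ℝ (Fin p) → EuclideanSpace ℝ (Fin d) → ℝ} {ℓ : EuclideanSpace ℝ (Fin p) → ℝ}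
  {gd : EuclideanSpace ℝ (Fin p) → EuclideanSpace ℝ (Fin d) → EuclideanSpace ℝ (Fin d)}
  {gdd : EuclideanSpace ℝ (Fin p) → EuclideanSpace ℝ (Fin d) →
    EuclideanSpace ℝ (Fin d) →L[ℝ] EuclideanSpace ℝ (Fin d)}
  {Θ : Set (EuclideanSpace ℝ (Fin d))} {θ₀ : EuclideanSpace ℝ (Fin d)} {r : ℝ}
  {Gs F : EuclideanSpace ℝ (Fin p) → ℝ} {J H : EuclideanSpace ℝ (Fin p) × ℝ → ℝ} {δ : ℕ → ℝ}
  {θhat : ℕ → Ω → EuclideanSpace ℝ (Fin d)}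

/-- The part `ℓ - ġᵀ G⁻¹ E(ġ ℓ)` of the departure `ℓ` that a change of the parameter cannot
absorb. -/
noncomputable def limitDrift (νX : Measure (EuclideanSpace ℝ (Fin p)))
    (gd : EuclideanSpace ℝ (Fin p) → EuclideanSpace ℝ (Fin d) → EuclideanSpace ℝ (Fin d))
    (ℓ : EuclideanSpace ℝ (Fin p) → ℝ) (θ₀ : EuclideanSpace ℝ (Fin d))
    (x : EuclideanSpace ℝ (Fin p)) : ℝ :=
  ℓ x - inner ℝ (gd x θ₀) (WithLp.toLp 2 ((Matrix.of fun a b =>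
    ∫ x, gd x θ₀ a * gd x θ₀ b ∂νX)⁻¹.mulVec fun a => ∫ x, gd x θ₀ a * ℓ x ∂νX))

/-- Residuals formed at the least squares estimate are errors shifted by a drift of order `δ n`, up
to `O_P(n^{-1/2})`. The drift is the bias of the population minimizer, and after division by `δ n` it
converges to `limitDrift`. -/
theorem RegressionConditions.exists_drift
    (hM : RegressionConditions νX νE g ℓ gd gdd Θ θ₀ r Gs F J H)
    (hX2 : ∀ i, MemLp (fun x => x i) 2 νX) (hX0 : ∀ i, ∫ x, x i ∂νX = 0)
    (hZ : IsSample P Z (νX.prod νE)) (hδ₀ : ∀ᶠ n in atTop, 0 < δ n)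
    (hδ : Tendsto δ atTop (𝓝 0)) (hls : IsLeastSquaresSequence P Z g ℓ Θ θ₀ δ θhat) :
    ∃ (D : ℕ → EuclideanSpace ℝ (Fin p) → ℝ) (U : EuclideanSpace ℝ (Fin p) → ℝ)
      (h : ℕ → Ω → ℝ), DriftConditions νX νE D U δ ∧
      ResidualConditions P Z νX D (fun n j ω => resid g ℓ θ₀ (δ n) (θhat n ω) (Z j ω)) F h ∧
      ∀ x, Tendsto (fun n => D n x / δ n) atTop (𝓝 (limitDrift νX gd ℓ θ₀ x)) := by
  obtain ⟨θs, hθs, hmin⟩ := hM.exists_minimizer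
  have hθ := hM.tendsto_minimizer hδ₀ hδ hθs hmin
  have hdir := hM.tendsto_minimizer_div hδ₀ hδ hθs hmin
  set b := WithLp.toLp 2 ((Matrix.of fun a b => ∫ x, gd x θ₀ a * gd x θ₀ b ∂νX)⁻¹.mulVec
    fun a => ∫ x, gd x θ₀ a * ℓ x ∂νX) with hb
  have hball : ∀ᶠ n in atTop, dist (θs (δ n)) θ₀ < r := Metric.tendsto_nhds.1 hθ r hM.radius_pos
  have hF0 := hM.grad_env_nonneg
  refine ⟨fun n x => δ n * ℓ x - (g x (θs (δ n)) - g x θ₀), fun x => |ℓ x| + (‖b‖ + 1) * F x,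
    fun n ω => ‖θhat n ω - θs (δ n)‖, ?_, ?_, fun x => ?_⟩
  · refine ⟨hX2, hX0, hM.err_sq, fun n => ?_, fun x => ?_, ?_, ?_, hδ₀, ?_⟩
    · exact (hM.measurable_ell.const_mul _).sub
        ((hM.measurable_g _ (hθs _)).sub (hM.measurable_g _ hM.mem_param))
    · have := hF0 x
      positivity
    · exact hM.ell_sq.norm.add (hM.grad_env_sq.const_mul _)
    · filter_upwards [hδ₀, hball, hdir.norm.eventually_lt_const (lt_add_one ‖b‖)] with n h0 h1 h2 x
      have h3 := hM.abs_sub_le hM.mem_ball (le_of_lt h1) x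
      rw [norm_smul, Real.norm_eq_abs, abs_inv, abs_of_pos h0, inv_mul_lt_iff₀ h0] at h2
      have h4 : F x * ‖θs (δ n) - θ₀‖ ≤ F x * (δ n * (‖b‖ + 1)) :=
        mul_le_mul_of_nonneg_left h2.le (hF0 x)
      have h5 := abs_sub (δ n * ℓ x) (g x (θs (δ n)) - g x θ₀)
      rw [abs_mul, abs_of_pos h0] at h5
      linarith
    · exact (hδ.eventually_lt_const one_pos).mono fun n hn => hn.le
  · refine ⟨hF0, hM.grad_env_sq, fun n ω => norm_nonneg _,
      hM.bddInProb_norm_sub_sq hZ hδ₀ hδ hls hθs hmin, ?_⟩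
    refine (hM.withHighProb_dist_lt hZ hδ₀ hδ hls hM.radius_pos).mono ?_
    filter_upwards [hball] with n h1 ω h2 j _
    have h3 := hM.abs_sub_le (le_of_lt h2) (le_of_lt h1) (Z j ω).1
    rw [norm_sub_rev, mul_comm] at h3
    refine le_of_eq_of_le ?_ h3
    unfold resid
    congr 1
    ring
  · -- the derivative of `g x` at `θ₀` along the convergent directions `(θs (δ n) - θ₀) / δ n`
    have h1 : Tendsto (fun n => (δ n)⁻¹ * (g x (θs (δ n)) - g x θ₀)) atTop
        (𝓝 (inner ℝ (gd x θ₀) b)) := by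
      have h2 := (hM.hasGradientAt x θ₀ hM.mem_ball).hasFDerivAt.isLittleO.comp_tendsto hθ
      have h3 : (fun n => θs (δ n) - θ₀) =O[atTop] δ := by
        have := (isBigO_refl δ atTop).smul (hdir.isBigO_one ℝ)
        refine (this.congr' ?_ (Eventually.of_forall fun n => by simp))
        filter_upwards [hδ₀] with n hn
        rw [smul_smul, mul_inv_cancel₀ hn.ne', one_smul]
      have h4 := (h2.trans_isBigO h3).tendsto_div_nhds_zero
      have h5 : Tendsto (fun n => inner ℝ (gd x θ₀) ((δ n)⁻¹ • (θs (δ n) - θ₀))) atTop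
          (𝓝 (inner ℝ (gd x θ₀) b)) := tendsto_const_nhds.inner hdir
      have h6 := h4.add h5
      rw [zero_add] at h6
      refine h6.congr fun n => ?_
      simp only [Function.comp_apply, InnerProductSpace.toDual_apply_apply, real_inner_smul_right]
      ring
    have h2 := h1.const_sub (ℓ x)
    refine h2.congr' ?_
    filter_upwards [hδ₀] with n hn
    field_simp

end LeastSquaresResiduals

/-! ### Gradient and Hessian of the regression function -/

section Derivatives

variable {p d : ℕ} {g : EuclideanSpace ℝ (Fin p) → EuclideanSpace ℝ (Fin d) → ℝ}
  {Θ : Set (EuclideanSpace ℝ (Fin d))}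

lemma contDiffOn_gdot {x : EuclideanSpace ℝ (Fin p)} (hc : ContDiffOn ℝ 2 (g x) Θ)
    (hU : UniqueDiffOn ℝ Θ) : ContDiffOn ℝ 1 (gdot g Θ x) Θ :=
  (InnerProductSpace.toDual ℝ (EuclideanSpace ℝ (Fin d))).symm.contDiff.comp_contDiffOn
    (hc.fderivWithin hU (by norm_num))

lemma continuousOn_gddot {x : EuclideanSpace ℝ (Fin p)} (hc : ContDiffOn ℝ 2 (g x) Θ)
    (hU : UniqueDiffOn ℝ Θ) : ContinuousOn (gddot g Θ x) Θ :=
  (contDiffOn_gdot hc hU).continuousOn_fderivWithin hU le_rfl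

lemma hasGradientAt_gdot {x : EuclideanSpace ℝ (Fin p)} (hc : ContDiffOn ℝ 2 (g x) Θ)
    {θ : EuclideanSpace ℝ (Fin d)} (hθ : θ ∈ interior Θ) :
    HasGradientAt (g x) (gdot g Θ x θ) θ := by
  have h := ((hc.differentiableOn two_ne_zero) θ
    (interior_subset hθ)).hasGradientWithinAt.hasFDerivWithinAt
  exact h.hasFDerivAt (mem_interior_iff_mem_nhds.1 hθ)

lemma hasFDerivAt_gdot {x : EuclideanSpace ℝ (Fin p)} (hc : ContDiffOn ℝ 2 (g x) Θ)
    (hU : UniqueDiffOn ℝ Θ) {θ : EuclideanSpace ℝ (Fin d)} (hθ : θ ∈ interior Θ) :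
    HasFDerivAt (gdot g Θ x) (gddot g Θ x θ) θ :=
  (((contDiffOn_gdot hc hU).differentiableOn one_ne_zero) θ
    (interior_subset hθ)).hasFDerivWithinAt.hasFDerivAt (mem_interior_iff_mem_nhds.1 hθ)

/-- Derivatives are limits of difference quotients, hence measurable in a parameter. -/
lemma measurable_fderiv_apply {𝒳 E F : Type*} [MeasurableSpace 𝒳] [NormedAddCommGroup E]
    [NormedSpace ℝ E] [NormedAddCommGroup F] [NormedSpace ℝ F] [MeasurableSpace F] [BorelSpace F]
    [SecondCountableTopology F] {f : 𝒳 → E → F} {f' : 𝒳 → E →L[ℝ] F} {θ : E}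
    (hf : ∀ᶠ θ' in 𝓝 θ, Measurable fun x => f x θ') (hd : ∀ x, HasFDerivAt (f x) (f' x) θ)
    (u : E) : Measurable fun x => f' x u := by
  have hc : Tendsto (fun n : ℕ => (n : ℝ)) atTop atTop := tendsto_natCast_atTop_atTop
  have hpt : Tendsto (fun n : ℕ => θ + (n : ℝ)⁻¹ • u) atTop (𝓝 θ) := by
    have := ((tendsto_inv_atTop_zero.comp hc).smul_const u).const_add θ
    simpa using this
  obtain ⟨N, hN⟩ := eventually_atTop.1 (hpt.eventually hf)
  refine measurable_of_tendsto_metrizable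
    (f := fun n x => ((n + N : ℕ) : ℝ) • (f x (θ + ((n + N : ℕ) : ℝ)⁻¹ • u) - f x θ))
    (fun n => ((hN (n + N) (Nat.le_add_left _ _)).sub hf.self_of_nhds).const_smul _) ?_
  rw [tendsto_pi_nhds]
  intro x
  have := (hd x).lim u (c := fun n : ℕ => (n : ℝ)) (tendsto_norm_atTop_atTop.comp hc)
  exact this.comp (tendsto_add_atTop_nat N)

lemma measurable_gdot (hm : ∀ θ ∈ Θ, Measurable fun x => g x θ)
    (hc : ∀ x, ContDiffOn ℝ 2 (g x) Θ) {θ : EuclideanSpace ℝ (Fin d)} (hθ : θ ∈ interior Θ) :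
    Measurable fun x => gdot g Θ x θ := by
  have h : ∀ a, Measurable fun x => gdot g Θ x θ a := fun a => by
    have := measurable_fderiv_apply (Filter.mem_of_superset (mem_interior_iff_mem_nhds.1 hθ) hm)
      (fun x => (hasGradientAt_gdot (hc x) hθ).hasFDerivAt) (EuclideanSpace.single a 1)
    simpa [EuclideanSpace.inner_single_right] using this
  exact (PiLp.continuous_toLp 2 (fun _ : Fin d => ℝ)).measurable.comp (measurable_pi_iff.2 h)

lemma measurable_gddot_apply (hm : ∀ θ ∈ Θ, Measurable fun x => g x θ)
    (hc : ∀ x, ContDiffOn ℝ 2 (g x) Θ) (hU : UniqueDiffOn ℝ Θ)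
    {θ : EuclideanSpace ℝ (Fin d)} (hθ : θ ∈ interior Θ) (u : EuclideanSpace ℝ (Fin d)) :
    Measurable fun x => gddot g Θ x θ u :=
  measurable_fderiv_apply (Filter.mem_of_superset (isOpen_interior.mem_nhds hθ) fun _ h =>
    measurable_gdot hm hc h) (fun x => hasFDerivAt_gdot (hc x) hU hθ) u

lemma measurable_norm_gddot (hm : ∀ θ ∈ Θ, Measurable fun x => g x θ)
    (hc : ∀ x, ContDiffOn ℝ 2 (g x) Θ) (hU : UniqueDiffOn ℝ Θ)
    {θ : EuclideanSpace ℝ (Fin d)} (hθ : θ ∈ interior Θ) :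
    Measurable fun x => ‖gddot g Θ x θ‖ := by
  -- a linear map is a continuous function of its values on the standard basis
  have hsum : ∀ x, gddot g Θ x θ = ∑ b, (EuclideanSpace.proj (𝕜 := ℝ) b).smulRight
      (gddot g Θ x θ (EuclideanSpace.single b 1)) := fun x => by
    ext1 u
    have hu : u = ∑ b, u b • EuclideanSpace.single b (1 : ℝ) := by
      ext a
      simp [Finset.sum_apply, Pi.single_apply]
    conv_lhs => rw [hu]
    simp
  have hcont : ∀ b : Fin d, Continuous fun v : EuclideanSpace ℝ (Fin d) =>
      (EuclideanSpace.proj (𝕜 := ℝ) b : EuclideanSpace ℝ (Fin d) →L[ℝ] ℝ).smulRight v := fun b =>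
    (ContinuousLinearMap.smulRightL ℝ (EuclideanSpace ℝ (Fin d)) (EuclideanSpace ℝ (Fin d))
      (EuclideanSpace.proj (𝕜 := ℝ) b)).continuous
  have : StronglyMeasurable fun x => ∑ b, (EuclideanSpace.proj (𝕜 := ℝ) b).smulRight
      (gddot g Θ x θ (EuclideanSpace.single b 1)) :=
    Finset.stronglyMeasurable_fun_sum _ fun b _ => (hcont b).comp_stronglyMeasurable
      (measurable_gddot_apply hm hc hU hθ _).stronglyMeasurable
  simp only [← hsum] at this
  exact this.norm.measurable

end Derivatives

/-! ### Dominating functions from the moment conditions -/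

section Regularity

variable {Ω : Type*} [MeasurableSpace Ω] {P : Measure Ω} [IsProbabilityMeasure P] {p d : ℕ}
  {X : ℕ → Ω → EuclideanSpace ℝ (Fin p)} {ε : ℕ → Ω → ℝ}
  {g : EuclideanSpace ℝ (Fin p) → EuclideanSpace ℝ (Fin d) → ℝ}
  {ℓ : EuclideanSpace ℝ (Fin p) → ℝ}
  {Θ : Set (EuclideanSpace ℝ (Fin d))} {θ₀ : EuclideanSpace ℝ (Fin d)} {δ : ℕ → ℝ}

namespace RegularityConditions

variable (hreg : RegularityConditions P X ε g ℓ Θ θ₀ δ)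
include hreg

lemma isProbabilityMeasure_map_X : IsProbabilityMeasure (P.map (X 0)) :=
  Measure.isProbabilityMeasure_map (hreg.measurable_X 0).aemeasurable

lemma isProbabilityMeasure_map_err : IsProbabilityMeasure (P.map (ε 0)) :=
  Measure.isProbabilityMeasure_map (hreg.measurable_err 0).aemeasurable

lemma map_pair : P.map (fun ω => (X 0 ω, ε 0 ω)) = (P.map (X 0)).prod (P.map (ε 0)) :=
  (indepFun_iff_map_prod_eq_prod_map_map (hreg.measurable_X 0).aemeasurable
    (hreg.measurable_err 0).aemeasurable).1 hreg.indep_err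

lemma isSample : IsSample P (fun j ω => (X j ω, ε j ω)) ((P.map (X 0)).prod (P.map (ε 0))) where
  measurable j := (hreg.measurable_X j).prodMk (hreg.measurable_err j)
  indep := hreg.indep
  map_eq j := (hreg.identDistrib j).map_eq.trans hreg.map_pair

omit [IsProbabilityMeasure P] in
lemma mem_param : θ₀ ∈ Θ := interior_subset hreg.interior_param

omit [IsProbabilityMeasure P] in
lemma uniqueDiffOn : UniqueDiffOn ℝ Θ :=
  uniqueDiffOn_convex hreg.convex_param ⟨θ₀, hreg.interior_param⟩

omit [IsProbabilityMeasure P] in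
lemma memLp_g : MemLp (fun ω => g (X 0 ω) θ₀) 2 P := by
  have hm : Measurable fun ω => g (X 0 ω) θ₀ :=
    (hreg.measurable_g θ₀ hreg.mem_param).comp (hreg.measurable_X 0)
  rw [memLp_two_iff_integrable_sq hm.aestronglyMeasurable]
  refine ⟨(hm.pow_const 2).aestronglyMeasurable, ?_⟩
  refine (hasFiniteIntegral_iff_ofReal (Eventually.of_forall fun ω => sq_nonneg _)).2 ?_
  exact lt_of_le_of_lt (lintegral_mono fun ω =>
    le_iSup₂_of_le (f := fun θ (_ : θ ∈ Θ) => ENNReal.ofReal (g (X 0 ω) θ ^ 2))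
      θ₀ hreg.mem_param le_rfl) hreg.moments_null.sup_g

omit [IsProbabilityMeasure P] in
lemma memLp_err : MemLp (fun e => e) 2 (P.map (ε 0)) := by
  have h := hreg.moments_null.response_sq.sub hreg.memLp_g
  have h2 : MemLp (ε 0) 2 P := by
    refine (memLp_congr_ae (Eventually.of_forall fun ω => ?_)).1 h
    simp [response]
  exact (memLp_map_measure_iff aestronglyMeasurable_id
    (hreg.measurable_err 0).aemeasurable).2 h2

omit [IsProbabilityMeasure P] in
lemma integral_err : ∫ e, e ∂(P.map (ε 0)) = 0 := by
  have h := integral_map (hreg.measurable_err 0).aemeasurable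
    (f := fun e : ℝ => e) (μ := P) measurable_id.aestronglyMeasurable
  exact h.trans hreg.mean_err

omit [IsProbabilityMeasure P] in
/-- The departure `ℓ(X)` is the difference of the responses at the sizes `δ 1 = 1` and `0`. -/
lemma memLp_ell (hδ : δ 1 = 1) : MemLp ℓ 2 (P.map (X 0)) := by
  have h := (hreg.moments_local 1 le_rfl).response_sq.sub hreg.moments_null.response_sq
  have h2 : MemLp (ℓ ∘ X 0) 2 P := by
    refine (memLp_congr_ae (Eventually.of_forall fun ω => ?_)).1 h
    simp only [Pi.sub_apply, response, hδ, Function.comp_apply]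
    ring
  exact (memLp_map_measure_iff hreg.measurable_ell.aestronglyMeasurable
    (hreg.measurable_X 0).aemeasurable).2 h2

omit [IsProbabilityMeasure P] in
/-- A degenerate error would make `M̃` vanish, because of the factor `t` in `m̃(t)`. -/
lemma integral_sq_err_pos : 0 < ∫ e, e ^ 2 ∂(P.map (ε 0)) := by
  refine (integral_nonneg fun e => sq_nonneg e).lt_of_ne fun h0 => hreg.target_ne_zero ?_
  have hae := (integral_eq_zero_iff_of_nonneg (fun e : ℝ => sq_nonneg e)
    hreg.memLp_err.integrable_sq).1 h0.symm
  ext i j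
  refine integral_eq_zero_of_ae ?_
  filter_upwards [hae] with t ht
  have ht0 : t = 0 := pow_eq_zero_iff two_ne_zero |>.1 ht
  simp [ht0, mTilde]

omit [IsProbabilityMeasure P] in
lemma exists_closedBall : ∃ r, 0 < r ∧ Metric.closedBall θ₀ r ⊆ interior Θ :=
  Metric.nhds_basis_closedBall.mem_iff.1 (isOpen_interior.mem_nhds hreg.interior_param)

omit [IsProbabilityMeasure P] in
lemma measurable_response (s : ℝ) : Measurable fun z : EuclideanSpace ℝ (Fin p) × ℝ =>
    response g ℓ θ₀ s z.1 z.2 :=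
  ((((hreg.measurable_g θ₀ hreg.mem_param).comp measurable_fst).add
    ((hreg.measurable_ell.comp measurable_fst).const_mul s))).add measurable_snd

/-- Domination of `‖(Y - g)² ġ ġᵀ‖` and of `‖(Y - g)² g̈‖`. -/
lemma exists_resid_envelopes {s r : ℝ} (hr : Metric.closedBall θ₀ r ⊆ interior Θ)
    (hmom : MomentConditions P (X 0) (fun ω => response g ℓ θ₀ s (X 0 ω) (ε 0 ω)) g Θ) :
    ∃ J H : EuclideanSpace ℝ (Fin p) × ℝ → ℝ,
      Integrable J ((P.map (X 0)).prod (P.map (ε 0))) ∧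
      Integrable H ((P.map (X 0)).prod (P.map (ε 0))) ∧
      ∀ z, ∀ θ ∈ Metric.closedBall θ₀ r,
        resid g ℓ θ₀ s θ z ^ 2 * ‖gdot g Θ z.1 θ‖ ^ 2 ≤ J z ∧
        resid g ℓ θ₀ s θ z ^ 2 * ‖gddot g Θ z.1 θ‖ ≤ H z := by
  have hU := hreg.uniqueDiffOn
  have hrΘ : Metric.closedBall θ₀ r ⊆ Θ := hr.trans interior_subset
  have hmZ : Measurable fun ω => (X 0 ω, ε 0 ω) := hreg.isSample.measurable 0
  have hresp : ∀ θ z, resid g ℓ θ₀ s θ z = response g ℓ θ₀ s z.1 z.2 - g z.1 θ := fun θ z => by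
    unfold resid response; ring
  have hmr : ∀ θ ∈ Metric.closedBall θ₀ r, Measurable fun z => resid g ℓ θ₀ s θ z := fun θ hθ => by
    simp only [hresp]
    exact (hreg.measurable_response s).sub
      ((hreg.measurable_g θ (hrΘ hθ)).comp measurable_fst)
  have hcr : ∀ z, ContinuousOn (fun θ => resid g ℓ θ₀ s θ z) (Metric.closedBall θ₀ r) := fun z => by
    simp only [hresp]
    exact continuousOn_const.sub ((hreg.contDiff_g z.1).continuousOn.mono hrΘ)
  obtain ⟨J, -, -, hJ, hJle⟩ := exists_envelope (P := P) (isCompact_closedBall θ₀ r) hmZ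
    (f := fun z θ => resid g ℓ θ₀ s θ z ^ 2 * ‖gdot g Θ z.1 θ‖ ^ 2)
    (fun θ hθ => ((hmr θ hθ).pow_const 2).mul
      (((measurable_gdot hreg.measurable_g hreg.contDiff_g (hr hθ)).comp
        measurable_fst).norm.pow_const 2))
    (fun z => ((hcr z).pow 2).mul
      (((contDiffOn_gdot (hreg.contDiff_g z.1) hU).continuousOn.mono hrΘ).norm.pow 2))
    (fun z θ => by positivity)
    (lt_of_le_of_lt (lintegral_mono fun ω => by
      simp only [hresp]
      exact biSup_mono hrΘ) hmom.sup_res_grad)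
  obtain ⟨H, -, -, hH, hHle⟩ := exists_envelope (P := P) (isCompact_closedBall θ₀ r) hmZ
    (f := fun z θ => resid g ℓ θ₀ s θ z ^ 2 * ‖gddot g Θ z.1 θ‖)
    (fun θ hθ => ((hmr θ hθ).pow_const 2).mul
      ((measurable_norm_gddot hreg.measurable_g hreg.contDiff_g hU (hr hθ)).comp measurable_fst))
    (fun z => ((hcr z).pow 2).mul ((continuousOn_gddot (hreg.contDiff_g z.1) hU).mono hrΘ).norm)
    (fun z θ => by positivity)
    (lt_of_le_of_lt (lintegral_mono fun ω => by
      simp only [hresp]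
      exact biSup_mono hrΘ) hmom.sup_res_hess)
  rw [hreg.map_pair] at hJ hH
  exact ⟨J, H, hJ, hH, fun z θ hθ => ⟨hJle z θ hθ, hHle z θ hθ⟩⟩

/-- The expected supremum of the Hessian is finite. Averaging the bound on
`(ε - Δ)² ‖g̈‖` over the error, which is independent, centred and not degenerate, leaves
`(E ε² + Δ²) ‖g̈‖`. -/
lemma ae_norm_gddot_le {r : ℝ} {H : EuclideanSpace ℝ (Fin p) × ℝ → ℝ}
    (hH : Integrable H ((P.map (X 0)).prod (P.map (ε 0))))
    (hle : ∀ z, ∀ θ ∈ Metric.closedBall θ₀ r,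
      resid g ℓ θ₀ 0 θ z ^ 2 * ‖gddot g Θ z.1 θ‖ ≤ H z) :
    ∀ᵐ x ∂(P.map (X 0)), ∀ θ ∈ Metric.closedBall θ₀ r,
      ‖gddot g Θ x θ‖ ≤ (∫ e, e ^ 2 ∂(P.map (ε 0)))⁻¹ * ∫ e, H (x, e) ∂(P.map (ε 0)) := by
  have := hreg.isProbabilityMeasure_map_err
  have := hreg.isProbabilityMeasure_map_X
  have hσ := hreg.integral_sq_err_pos
  have i1 : Integrable (fun e : ℝ => e) (P.map (ε 0)) := hreg.memLp_err.integrable one_le_two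
  have i2 : Integrable (fun e : ℝ => e ^ 2) (P.map (ε 0)) := hreg.memLp_err.integrable_sq
  filter_upwards [hH.prod_right_ae] with x hx θ hθ
  set b := g x θ - g x θ₀ with hb
  have i3 : Integrable (fun e : ℝ => e ^ 2 + b ^ 2) (P.map (ε 0)) := i2.add (integrable_const _)
  have hexp : ∀ e : ℝ, resid g ℓ θ₀ 0 θ (x, e) ^ 2 = e ^ 2 + b ^ 2 - 2 * b * e := fun e => by
    simp only [resid, ← hb]; ring
  have hint : ∫ e, resid g ℓ θ₀ 0 θ (x, e) ^ 2 ∂(P.map (ε 0)) = ∫ e, e ^ 2 ∂(P.map (ε 0)) + b ^ 2 := by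
    simp only [hexp]
    rw [integral_sub i3 (i1.const_mul _), integral_add i2 (integrable_const _), integral_const_mul,
      hreg.integral_err]
    simp
  have i4 : Integrable (fun e : ℝ => resid g ℓ θ₀ 0 θ (x, e) ^ 2) (P.map (ε 0)) := by
    simp only [hexp]
    exact i3.sub (i1.const_mul _)
  have hmono := integral_mono (i4.mul_const ‖gddot g Θ x θ‖) hx fun e => hle (x, e) θ hθ
  rw [integral_mul_const, hint] at hmono
  rw [le_inv_mul_iff₀ hσ]
  refine le_trans ?_ hmono
  exact mul_le_mul_of_nonneg_right (le_add_of_nonneg_right (sq_nonneg b)) (norm_nonneg _)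

lemma integral_resid_sq (θ : EuclideanSpace ℝ (Fin d)) (hθ : θ ∈ Θ) :
    ∫ z, resid g ℓ θ₀ 0 θ z ^ 2 ∂((P.map (X 0)).prod (P.map (ε 0)))
      = ∫ ω, (response g ℓ θ₀ 0 (X 0 ω) (ε 0 ω) - g (X 0 ω) θ) ^ 2 ∂P := by
  have hm : Measurable fun z : EuclideanSpace ℝ (Fin p) × ℝ =>
      (response g ℓ θ₀ 0 z.1 z.2 - g z.1 θ) ^ 2 :=
    ((hreg.measurable_response 0).sub ((hreg.measurable_g θ hθ).comp measurable_fst)).pow_const 2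
  rw [← hreg.isSample.integral_comp 0 (f := fun z => resid g ℓ θ₀ 0 θ z ^ 2)]
  · refine integral_congr_ae (Eventually.of_forall fun ω => ?_)
    simp only [resid, response]
    ring
  · refine (hm.aestronglyMeasurable).congr (Eventually.of_forall fun z => ?_)
    simp only [resid, response]
    ring

omit [IsProbabilityMeasure P] in
lemma gramMatrix_eq : gramMatrix P (X 0) g Θ θ₀
    = Matrix.of fun a b => ∫ x, gdot g Θ x θ₀ a * gdot g Θ x θ₀ b ∂(P.map (X 0)) := by
  have hm : ∀ a, Measurable fun x => gdot g Θ x θ₀ a := fun a =>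
    (EuclideanSpace.proj (𝕜 := ℝ) a).continuous.measurable.comp
      (measurable_gdot hreg.measurable_g hreg.contDiff_g hreg.interior_param)
  ext a b
  exact (integral_map (hreg.measurable_X 0).aemeasurable
    ((hm a).mul (hm b)).aestronglyMeasurable).symm

/-- The regularity conditions provide a regression model with dominating functions. -/
theorem exists_regressionConditions (hδ : δ 1 = 1) :
    ∃ (r : ℝ) (Gs F : EuclideanSpace ℝ (Fin p) → ℝ) (J H : EuclideanSpace ℝ (Fin p) × ℝ → ℝ),
      RegressionConditions (P.map (X 0)) (P.map (ε 0)) g ℓ (gdot g Θ) (gddot g Θ) Θ θ₀ r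
        Gs F J H := by
  have := hreg.isProbabilityMeasure_map_err
  have := hreg.isProbabilityMeasure_map_X
  have hU := hreg.uniqueDiffOn
  obtain ⟨r, hr0, hr⟩ := hreg.exists_closedBall
  have hrΘ : Metric.closedBall θ₀ r ⊆ Θ := hr.trans interior_subset
  obtain ⟨G2, hG2m, hG20, hG2i, hG2⟩ := exists_envelope (P := P) hreg.compact_param
    (hreg.measurable_X 0) (f := fun x θ => g x θ ^ 2)
    (fun θ hθ => (hreg.measurable_g θ hθ).pow_const 2)
    (fun x => (hreg.contDiff_g x).continuousOn.pow 2) (fun x θ => sq_nonneg _)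
    hreg.moments_null.sup_g
  obtain ⟨F2, hF2m, hF20, hF2i, hF2⟩ := exists_envelope (P := P) (isCompact_closedBall θ₀ r)
    (hreg.measurable_X 0) (f := fun x θ => ‖gdot g Θ x θ‖ ^ 2)
    (fun θ hθ => (measurable_gdot hreg.measurable_g hreg.contDiff_g (hr hθ)).norm.pow_const 2)
    (fun x => ((contDiffOn_gdot (hreg.contDiff_g x) hU).continuousOn.mono hrΘ).norm.pow 2)
    (fun x θ => by positivity)
    (lt_of_le_of_lt (lintegral_mono fun ω => biSup_mono hrΘ) hreg.moments_null.sup_grad)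
  obtain ⟨J0, H0, hJ0, hH0, hle0⟩ := hreg.exists_resid_envelopes hr hreg.moments_null
  have hmom1 := hreg.moments_local 1 le_rfl
  rw [hδ] at hmom1
  obtain ⟨J1, H1, hJ1, hH1, hle1⟩ := hreg.exists_resid_envelopes hr hmom1
  have hhess := hreg.ae_norm_gddot_le hH0 fun z θ hθ => (hle0 z θ hθ).2
  set h2 : EuclideanSpace ℝ (Fin p) → ℝ := fun x =>
    (∫ e, e ^ 2 ∂(P.map (ε 0)))⁻¹ * ∫ e, H0 (x, e) ∂(P.map (ε 0)) with hh2
  have hh2i : Integrable h2 (P.map (X 0)) := hH0.integral_prod_left.const_mul _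
  -- the residual is affine in the size of the alternative
  have hconv : ∀ z θ, ∀ s ∈ Set.Icc (0 : ℝ) 1,
      resid g ℓ θ₀ s θ z ^ 2 ≤ resid g ℓ θ₀ 0 θ z ^ 2 + resid g ℓ θ₀ 1 θ z ^ 2 := by
    intro z θ s hs
    have h1 : resid g ℓ θ₀ s θ z = (1 - s) * resid g ℓ θ₀ 0 θ z + s * resid g ℓ θ₀ 1 θ z := by
      unfold resid; ring
    rw [h1]
    have h2 := mul_nonneg hs.1 (sub_nonneg.2 hs.2)
    nlinarith [mul_nonneg h2 (sq_nonneg (resid g ℓ θ₀ 0 θ z - resid g ℓ θ₀ 1 θ z)),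
      mul_nonneg hs.1 (sq_nonneg (resid g ℓ θ₀ 0 θ z)),
      mul_nonneg (sub_nonneg.2 hs.2) (sq_nonneg (resid g ℓ θ₀ 1 θ z))]
  refine ⟨r, fun x => √(G2 x), fun x => √(F2 x), fun z => J0 z + J1 z,
    fun z => h2 z.1 + (H0 z + H1 z), ?_⟩
  exact {
    compact_param := hreg.compact_param
    radius_pos := hr0
    ball_subset := hrΘ
    measurable_g := hreg.measurable_g
    continuousOn_g := fun x => (hreg.contDiff_g x).continuousOn
    measurable_ell := hreg.measurable_ell
    ell_sq := hreg.memLp_ell hδ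
    err_sq := hreg.memLp_err
    err_mean := hreg.integral_err
    g_le := fun x θ hθ => Real.abs_le_sqrt (hG2 x θ hθ)
    g_env_sq := by
      rw [memLp_two_iff_integrable_sq hG2m.sqrt.aestronglyMeasurable]
      exact hG2i.congr (Eventually.of_forall fun x => (Real.sq_sqrt (hG20 x)).symm)
    grad_le := fun x θ hθ => Real.le_sqrt_of_sq_le (hF2 x θ hθ)
    grad_env_sq := by
      rw [memLp_two_iff_integrable_sq hF2m.sqrt.aestronglyMeasurable]
      exact hF2i.congr (Eventually.of_forall fun x => (Real.sq_sqrt (hF20 x)).symm)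
    resid_grad_le := fun z θ hθ s hs => by
      have h1 := mul_le_mul_of_nonneg_right (hconv z θ s hs) (sq_nonneg ‖gdot g Θ z.1 θ‖)
      rw [add_mul] at h1
      exact h1.trans (add_le_add (hle0 z θ hθ).1 (hle1 z θ hθ).1)
    resid_grad_env := hJ0.add hJ1
    resid_hess_le := by
      filter_upwards [Measure.quasiMeasurePreserving_fst.ae hhess] with z hz θ hθ s hs
      have h1 := mul_le_mul_of_nonneg_right (hconv z θ s hs) (norm_nonneg (gddot g Θ z.1 θ))
      have h3 : |resid g ℓ θ₀ s θ z| ≤ 1 + resid g ℓ θ₀ s θ z ^ 2 := by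
        rw [← sq_abs]
        nlinarith [sq_nonneg (|resid g ℓ θ₀ s θ z| - 1), abs_nonneg (resid g ℓ θ₀ s θ z)]
      have h4 := mul_le_mul_of_nonneg_right h3 (norm_nonneg (gddot g Θ z.1 θ))
      have h5 := (hle0 z θ hθ).2
      have h6 := (hle1 z θ hθ).2
      have h7 := hz θ hθ
      simp only [hh2]
      linarith
    resid_hess_env := (hh2i.comp_fst _).add (hH0.add hH1)
    hasGradientAt := fun x θ hθ => hasGradientAt_gdot (hreg.contDiff_g x) (hr hθ)
    hasFDerivAt := fun x θ hθ => hasFDerivAt_gdot (hreg.contDiff_g x) hU (hr hθ)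
    continuousOn_hess := fun x => (continuousOn_gddot (hreg.contDiff_g x) hU).mono hrΘ
    measurable_grad := fun θ hθ => measurable_gdot hreg.measurable_g hreg.contDiff_g (hr hθ)
    measurable_hess := fun θ hθ => measurable_gddot_apply hreg.measurable_g hreg.contDiff_g hU (hr hθ)
    unique_min := fun θ hθ hne => by
      rw [hreg.integral_resid_sq θ hθ, hreg.integral_resid_sq θ₀ hreg.mem_param]
      exact hreg.unique_min θ hθ hne
    gram_nonsingular := by
      rw [← hreg.gramMatrix_eq]
      exact hreg.gram_nonsingular }

end RegularityConditions

end Regularity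

/-! ### The limiting target vector -/

section Target

variable {Ω : Type*} [MeasurableSpace Ω] {P : Measure Ω} [IsProbabilityMeasure P] {p d : ℕ}
  {X : ℕ → Ω → EuclideanSpace ℝ (Fin p)} {ε : ℕ → Ω → ℝ}
  {g : EuclideanSpace ℝ (Fin p) → EuclideanSpace ℝ (Fin d) → ℝ}
  {ℓ : EuclideanSpace ℝ (Fin p) → ℝ}
  {Θ : Set (EuclideanSpace ℝ (Fin d))} {θ₀ : EuclideanSpace ℝ (Fin d)} {δ : ℕ → ℝ}

namespace RegularityConditions

variable (hreg : RegularityConditions P X ε g ℓ Θ θ₀ δ)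
include hreg

omit [IsProbabilityMeasure P] in
lemma memLp_coord (i : Fin p) : MemLp (fun x => x i) 2 (P.map (X 0)) := by
  have h : MemLp (fun ω => X 0 ω i) 2 P :=
    (EuclideanSpace.proj (𝕜 := ℝ) i).comp_memLp' hreg.X_sq
  exact (memLp_map_measure_iff (measurable_coord i).aestronglyMeasurable
    (hreg.measurable_X 0).aemeasurable).2 h

lemma integral_coord (i : Fin p) : ∫ x, x i ∂(P.map (X 0)) = 0 := by
  rw [integral_map (hreg.measurable_X 0).aemeasurable (measurable_coord i).aestronglyMeasurable]
  have h := (EuclideanSpace.proj (𝕜 := ℝ) i).integral_comp_comm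
    (hreg.X_sq.integrable one_le_two)
  rw [hreg.mean_X, map_zero] at h
  exact h

lemma integral_exp_mul {f : EuclideanSpace ℝ (Fin p) → ℝ} (hf : Measurable f) (t : ℝ) :
    ∫ ω, Complex.I * t * Complex.exp (Complex.I * t * ε 0 ω) * (f (X 0 ω) : ℂ) ∂P
      = Complex.I * t * errCharFun (P.map (ε 0)) t * ((∫ x, f x ∂(P.map (X 0)) : ℝ) : ℂ) := by
  have := hreg.isProbabilityMeasure_map_err
  have := hreg.isProbabilityMeasure_map_X
  have hm : Measurable fun z : EuclideanSpace ℝ (Fin p) × ℝ =>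
      Complex.I * t * Complex.exp (Complex.I * t * z.2) * (f z.1 : ℂ) := by fun_prop
  have h1 := hreg.isSample.integral_comp 0 hm.aestronglyMeasurable
  have h2 : ∀ z : EuclideanSpace ℝ (Fin p) × ℝ,
      Complex.I * t * Complex.exp (Complex.I * t * z.2) * (f z.1 : ℂ)
        = Complex.I * t * ((f z.1 : ℂ) * Complex.exp (Complex.I * t * z.2)) := fun z => by ring
  rw [h1]
  simp only [h2]
  rw [integral_const_mul, integral_prod_mul (fun x => (f x : ℂ))
    (fun e : ℝ => Complex.exp (Complex.I * t * e)), integral_complex_ofReal]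
  unfold errCharFun
  ring

/-- By independence the vector `m̃(t)` factorizes. -/
lemma mTilde_eq (hδ : δ 1 = 1) (t : ℝ) (i : Fin p) :
    mTilde P (X 0) (ε 0) g ℓ Θ θ₀ t i = linMean (P.map (X 0)) (P.map (ε 0))
      (limitDrift (P.map (X 0)) (gdot g Θ) ℓ θ₀) i t := by
  obtain ⟨r, Gs, F, J, H, hM⟩ := hreg.exists_regressionConditions hδ
  have hm : ∀ a, Measurable fun x => gdot g Θ x θ₀ a := hM.measurable_grad_apply hM.mem_ball
  have hgell : gradEll P (X 0) g ℓ Θ θ₀ = fun a => ∫ x, gdot g Θ x θ₀ a * ℓ x ∂(P.map (X 0)) := by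
    ext a
    exact (integral_map (hreg.measurable_X 0).aemeasurable
      ((hm a).mul hreg.measurable_ell).aestronglyMeasurable).symm
  unfold mTilde linMean limitDrift
  rw [hgell, hreg.gramMatrix_eq]
  set b := (Matrix.of fun a b => ∫ x, gdot g Θ x θ₀ a * gdot g Θ x θ₀ b ∂(P.map (X 0)))⁻¹.mulVec
    fun a => ∫ x, gdot g Θ x θ₀ a * ℓ x ∂(P.map (X 0)) with hb
  have h1 := hreg.integral_exp_mul (f := fun x => x i * ℓ x)
    ((measurable_coord i).mul hreg.measurable_ell) t
  have h2 := fun a => hreg.integral_exp_mul (f := fun x => x i * gdot g Θ x θ₀ a)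
    ((measurable_coord i).mul (hm a)) t
  have e1 : ∀ ω, Complex.I * t * Complex.exp (Complex.I * t * ε 0 ω) * (X 0 ω i : ℂ)
      * (ℓ (X 0 ω) : ℂ) = Complex.I * t * Complex.exp (Complex.I * t * ε 0 ω)
        * ((X 0 ω i * ℓ (X 0 ω) : ℝ) : ℂ) := fun ω => by push_cast; ring
  have e2 : ∀ a ω, Complex.I * t * (X 0 ω i : ℂ) * (gdot g Θ (X 0 ω) θ₀ a : ℂ)
      * Complex.exp (Complex.I * t * ε 0 ω) = Complex.I * t * Complex.exp (Complex.I * t * ε 0 ω)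
        * ((X 0 ω i * gdot g Θ (X 0 ω) θ₀ a : ℝ) : ℂ) := fun a ω => by push_cast; ring
  simp only [e1, e2, h1, h2]
  have i1 : Integrable (fun x => x i * ℓ x) (P.map (X 0)) :=
    (hreg.memLp_coord i).integrable_mul hM.ell_sq
  have i2 : ∀ a, Integrable (fun x => x i * gdot g Θ x θ₀ a) (P.map (X 0)) := fun a =>
    (hreg.memLp_coord i).integrable_mul (hM.memLp_grad_apply hM.mem_ball a)
  have e3 : ∀ x : EuclideanSpace ℝ (Fin p), x i * (ℓ x - inner ℝ (gdot g Θ x θ₀) (WithLp.toLp 2 b))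
      = x i * ℓ x - ∑ a, x i * gdot g Θ x θ₀ a * b a := fun x => by
    rw [PiLp.inner_apply, mul_sub, Finset.mul_sum]
    congr 1
    refine Finset.sum_congr rfl fun a _ => ?_
    simp only [RCLike.inner_apply, conj_trivial]
    ring
  have i3 : Integrable (fun x => ∑ a, x i * gdot g Θ x θ₀ a * b a) (P.map (X 0)) :=
    integrable_finsetSum _ fun a _ => (i2 a).mul_const _
  simp only [e3]
  rw [integral_sub i1 i3, integral_finsetSum _ fun a _ => (i2 a).mul_const _]
  simp only [integral_mul_const]
  push_cast
  rw [mul_sub, Finset.mul_sum]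
  congr 1
  exact Finset.sum_congr rfl fun a _ => by ring

/-- Some coordinate of the limiting target does not vanish. -/
lemma exists_linMean_pos (hδ : δ 1 = 1) : ∃ i : Fin p,
    0 < ∫ t, ‖linMean (P.map (X 0)) (P.map (ε 0))
      (limitDrift (P.map (X 0)) (gdot g Θ) ℓ θ₀) i t‖ ^ 2 ∂(P.map (ε 0)) := by
  have := hreg.isProbabilityMeasure_map_err
  set D := limitDrift (P.map (X 0)) (gdot g Θ) ℓ θ₀
  by_contra! h
  refine hreg.target_ne_zero ?_
  ext i j
  have hint : Integrable (fun t => ‖linMean (P.map (X 0)) (P.map (ε 0)) D i t‖ ^ 2)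
      (P.map (ε 0)) := by
    refine (hreg.memLp_err.integrable_sq.mul_const ((∫ x, x i * D x ∂(P.map (X 0))) ^ 2)).mono'
      ((measurable_linMean i).norm.pow_const 2).aestronglyMeasurable
      (Eventually.of_forall fun t => ?_)
    rw [Real.norm_eq_abs, abs_of_nonneg (sq_nonneg _), ← mul_pow, ← sq_abs (t * _), abs_mul]
    exact pow_le_pow_left₀ (norm_nonneg _) (norm_linMean_le i t) 2
  have h0 := le_antisymm (h i) (integral_nonneg fun t => sq_nonneg _)
  have hae := (integral_eq_zero_iff_of_nonneg (fun t => sq_nonneg _) hint).1 h0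
  refine integral_eq_zero_of_ae ?_
  filter_upwards [hae] with t ht
  have ht0 := norm_eq_zero.1 (pow_eq_zero_iff two_ne_zero |>.1 ht)
  rw [hreg.mTilde_eq hδ, ht0, zero_mul, Pi.zero_apply]

end RegularityConditions

end Target

/-! ### The estimated indicative dimension under local alternatives -/

section Dimension

variable {Ω : Type*} [MeasurableSpace Ω] {P : Measure Ω} [IsProbabilityMeasure P] {p d : ℕ}
  {X : ℕ → Ω → EuclideanSpace ℝ (Fin p)} {ε : ℕ → Ω → ℝ}
  {g : EuclideanSpace ℝ (Fin p) → EuclideanSpace ℝ (Fin d) → ℝ}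
  {ℓ : EuclideanSpace ℝ (Fin p) → ℝ}
  {Θ : Set (EuclideanSpace ℝ (Fin d))} {θ₀ : EuclideanSpace ℝ (Fin d)} {δ : ℕ → ℝ}
  {θhat : ℕ → Ω → EuclideanSpace ℝ (Fin d)} {c₁ c₂ : ℕ → ℝ} {τ : ℝ}

lemma response_sub_eq_resid (s : ℝ) (x : EuclideanSpace ℝ (Fin p)) (e : ℝ)
    (θ : EuclideanSpace ℝ (Fin d)) :
    response g ℓ θ₀ s x e - g x θ = resid g ℓ θ₀ s θ (x, e) := by
  unfold response resid
  ring

omit [MeasurableSpace Ω] in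
lemma qHatLocal_eq_tdrr (n : ℕ) (ω : Ω) :
    qHatLocal n X ε g ℓ θ₀ (δ n) (θhat n) (c₁ n) (c₂ n) τ ω
      = tdrr p (sampleEigenvalue (fun j ω => (X j ω, ε j ω))
        (fun n j ω => resid g ℓ θ₀ (δ n) (θhat n ω) (X j ω, ε j ω)) n ω) (c₁ n) (c₂ n) τ := by
  unfold qHatLocal qHat
  rw [show (fun j => response g ℓ θ₀ (δ n) (X j ω) (ε j ω) - g (X j ω) (θhat n ω))
    = fun j => resid g ℓ θ₀ (δ n) (θhat n ω) (X j ω, ε j ω) from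
      funext fun j => response_sub_eq_resid _ _ _ _]
  rfl

omit [IsProbabilityMeasure P] in
lemma isLeastSquaresSequence (hθ : ∀ n, ∀ᵐ ω ∂P, IsLeastSquares g Θ n (fun j => X j ω)
      (fun j => response g ℓ θ₀ (δ n) (X j ω) (ε j ω)) (θhat n ω)) :
    IsLeastSquaresSequence P (fun j ω => (X j ω, ε j ω)) g ℓ Θ θ₀ δ θhat := by
  refine withHighProb_of_ae fun n => ?_
  filter_upwards [hθ n] with ω hω
  refine ⟨hω.1, fun θ hθ' => ?_⟩
  have h := hω.2 θ hθ'
  simp only [response_sub_eq_resid] at h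
  exact mul_le_mul_of_nonneg_left h (by positivity)

namespace RegularityConditions

variable (hreg : RegularityConditions P X ε g ℓ Θ θ₀ δ)
include hreg

lemma exists_drift (hδ1 : δ 1 = 1) (hδ₀ : ∀ᶠ n in atTop, 0 < δ n) (hδ : Tendsto δ atTop (𝓝 0))
    (hθ : ∀ n, ∀ᵐ ω ∂P, IsLeastSquares g Θ n (fun j => X j ω)
      (fun j => response g ℓ θ₀ (δ n) (X j ω) (ε j ω)) (θhat n ω)) :
    ∃ (D : ℕ → EuclideanSpace ℝ (Fin p) → ℝ) (U F : EuclideanSpace ℝ (Fin p) → ℝ)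
      (h : ℕ → Ω → ℝ), DriftConditions (P.map (X 0)) (P.map (ε 0)) D U δ ∧
      ResidualConditions P (fun j ω => (X j ω, ε j ω)) (P.map (X 0)) D
        (fun n j ω => resid g ℓ θ₀ (δ n) (θhat n ω) (X j ω, ε j ω)) F h ∧
      ∀ x, Tendsto (fun n => D n x / δ n) atTop
        (𝓝 (limitDrift (P.map (X 0)) (gdot g Θ) ℓ θ₀ x)) := by
  have := hreg.isProbabilityMeasure_map_err
  have := hreg.isProbabilityMeasure_map_X
  obtain ⟨r, Gs, F, J, H, hM⟩ := hreg.exists_regressionConditions hδ1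
  obtain ⟨D, U, h, hDr, hRe, hlim⟩ := hM.exists_drift hreg.memLp_coord hreg.integral_coord
    hreg.isSample hδ₀ hδ (isLeastSquaresSequence hθ)
  exact ⟨D, U, F, h, hDr, hRe, hlim⟩

/-- Alternatives at distance `O(n^{-1/2})` are not detected: all eigenvalues are `O_P(1/n)`. -/
theorem withHighProb_qHatLocal_eq_zero {K : ℝ} (hδ1 : δ 1 = 1) (hδ₀ : ∀ᶠ n in atTop, 0 < δ n)
    (hδ : Tendsto δ atTop (𝓝 0)) (hδK : ∀ᶠ n : ℕ in atTop, n * δ n ^ 2 ≤ K)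
    (hθ : ∀ n, ∀ᵐ ω ∂P, IsLeastSquares g Θ n (fun j => X j ω)
      (fun j => response g ℓ θ₀ (δ n) (X j ω) (ε j ω)) (θhat n ω))
    (hc₁ : ∀ᶠ n in atTop, 0 < c₁ n) (hc₂ : ∀ᶠ n in atTop, 0 < c₂ n) (hτ₀ : 0 < τ) (hτ₁ : τ < 1)
    (hc : Tendsto (fun n : ℕ => (n : ℝ) ^ 2 * c₁ n * c₂ n) atTop atTop) :
    WithHighProb P fun n ω => qHatLocal n X ε g ℓ θ₀ (δ n) (θhat n) (c₁ n) (c₂ n) τ ω = 0 := by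
  have := hreg.isProbabilityMeasure_map_err
  have := hreg.isProbabilityMeasure_map_X
  obtain ⟨D, U, F, h, hDr, hRe, -⟩ := hreg.exists_drift hδ1 hδ₀ hδ hθ
  simp only [qHatLocal_eq_tdrr]
  exact withHighProb_tdrr_eq_zero (bddInProb_sampleEigenvalue_one hreg.isSample hDr hRe hδK)
    hc₁ hc₂ hτ₀ hτ₁ hc

/-- Alternatives at a larger distance are detected: the first eigenvalue is at least of order
`δ n ^ 2`, whereas the others are `O_P(1/n + δ n ^ 3)`. -/
theorem withHighProb_qHatLocal_eq_one (hδ1 : δ 1 = 1) (hδ₀ : ∀ᶠ n in atTop, 0 < δ n)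
    (hδ : Tendsto δ atTop (𝓝 0)) (hnδ : Tendsto (fun n : ℕ => (n : ℝ) * δ n ^ 2) atTop atTop)
    (hθ : ∀ n, ∀ᵐ ω ∂P, IsLeastSquares g Θ n (fun j => X j ω)
      (fun j => response g ℓ θ₀ (δ n) (X j ω) (ε j ω)) (θhat n ω))
    (hmom : 2 ≤ p → MemLp (X 0) 4 P ∧ MemLp (ε 0) 3 P)
    (hc₁ : ∀ᶠ n in atTop, 0 < c₁ n) (hc₂ : ∀ᶠ n in atTop, 0 < c₂ n) (hτ₀ : 0 < τ) (hτ₁ : τ < 1)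
    (hc₁δ : c₁ =o[atTop] (fun n => δ n ^ 4)) (hc₂0 : Tendsto c₂ atTop (𝓝 0))
    (hcn : Tendsto (fun n : ℕ => (n : ℝ) * c₁ n * c₂ n / δ n ^ 2) atTop atTop)
    (hcδ : Tendsto (fun n : ℕ => c₁ n * c₂ n / δ n ^ 6) atTop atTop) :
    WithHighProb P fun n ω => qHatLocal n X ε g ℓ θ₀ (δ n) (θhat n) (c₁ n) (c₂ n) τ ω = 1 := by
  have := hreg.isProbabilityMeasure_map_err
  have := hreg.isProbabilityMeasure_map_X
  obtain ⟨D, U, F, h, hDr, hRe, hlim⟩ := hreg.exists_drift hδ1 hδ₀ hδ hθ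
  obtain ⟨i, hi⟩ := hreg.exists_linMean_pos hδ1
  simp only [qHatLocal_eq_tdrr]
  refine withHighProb_tdrr_eq_one (i.pos) hδ₀
    ((hδ.eventually_lt_const one_pos).mono fun n hn => hn.le) hnδ
    (exists_le_sampleEigenvalue_one hreg.isSample hDr hRe hδ hnδ hlim hi) ?_
    hc₁ hc₂ hτ₀ hτ₁ hc₁δ hc₂0 hcn hcδ
  rcases lt_or_ge p 2 with hp | hp
  · -- a single eigenvalue
    refine (bddInProb_const 0).mono (withHighProb_of_eventually (Eventually.of_forall fun n ω => ?_))
    rw [sampleEigenvalue, orderedEigenvalue_of_lt _ hp, mul_zero]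
  · obtain ⟨h4, h3⟩ := hmom hp
    refine bddInProb_sampleEigenvalue_two hreg.isSample hDr hRe (fun i => ?_) ?_
    · have h5 : MemLp (fun ω => X 0 ω i) 4 P := (EuclideanSpace.proj (𝕜 := ℝ) i).comp_memLp' h4
      exact (memLp_map_measure_iff (measurable_coord i).aestronglyMeasurable
        (hreg.measurable_X 0).aemeasurable).2 h5
    · exact (memLp_map_measure_iff aestronglyMeasurable_id
        (hreg.measurable_err 0).aemeasurable).2 h3

end RegularityConditions

end Dimension

end HybridTest

/-! ### Consistency of the estimated indicative dimension -/

theorem mainTheorem5 {Ω : Type*} [MeasurableSpace Ω] (P : Measure Ω) [IsProbabilityMeasure P]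
    {p d : ℕ} (X : ℕ → Ω → EuclideanSpace ℝ (Fin p)) (ε : ℕ → Ω → ℝ)
    (g : EuclideanSpace ℝ (Fin p) → EuclideanSpace ℝ (Fin d) → ℝ)
    (ℓ : EuclideanSpace ℝ (Fin p) → ℝ)
    (Θ : Set (EuclideanSpace ℝ (Fin d))) (θ₀ : EuclideanSpace ℝ (Fin d)) (δ : ℕ → ℝ)
    (hreg : HybridTest.RegularityConditions P X ε g ℓ Θ θ₀ δ)
    (θhat : ℕ → Ω → EuclideanSpace ℝ (Fin d))
    (hθmeas : ∀ n, AEMeasurable (θhat n) P)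
    (hθ : ∀ n, ∀ᵐ ω ∂P, HybridTest.IsLeastSquares g Θ n (fun j => X j ω)
      (fun j => HybridTest.response g ℓ θ₀ (δ n) (X j ω) (ε j ω)) (θhat n ω))
    (c₁ c₂ : ℕ → ℝ) (hc₁ : ∀ᶠ n in atTop, 0 < c₁ n) (hc₂ : ∀ᶠ n in atTop, 0 < c₂ n)
    (τ : ℝ) (hτ₀ : 0 < τ) (hτ₁ : τ < 1) :
    ((∀ n : ℕ, 1 ≤ n → δ n = (n : ℝ) ^ (-(1 / 2 : ℝ))) →
      Tendsto c₁ atTop (𝓝 0) → Tendsto c₂ atTop (𝓝 0) →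
      Tendsto (fun n : ℕ => (n : ℝ) ^ 2 * c₁ n * c₂ n) atTop atTop →
      Tendsto (fun n =>
          P {ω | HybridTest.qHatLocal n X ε g ℓ θ₀ (δ n) (θhat n) (c₁ n) (c₂ n) τ ω = 0})
        atTop (𝓝 1)) ∧
    (∀ α : ℝ, 0 < α → α < 1 / 2 →
      (∀ n : ℕ, 1 ≤ n → δ n = (n : ℝ) ^ (-α)) →
      (2 ≤ p → MemLp (X 0) 4 P ∧ MemLp (ε 0) 3 P) →
      c₁ =o[atTop] (fun n => δ n ^ 4) → Tendsto c₂ atTop (𝓝 0) →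
      Tendsto (fun n : ℕ => (n : ℝ) * c₁ n * c₂ n / δ n ^ 2) atTop atTop →
      Tendsto (fun n : ℕ => c₁ n * c₂ n / δ n ^ 6) atTop atTop →
      Tendsto (fun n =>
          P {ω | HybridTest.qHatLocal n X ε g ℓ θ₀ (δ n) (θhat n) (c₁ n) (c₂ n) τ ω = 1})
        atTop (𝓝 1)) := by
  have hδ_one : ∀ β : ℝ, (∀ n : ℕ, 1 ≤ n → δ n = (n : ℝ) ^ (-β)) → δ 1 = 1 := fun β h => by
    rw [h 1 le_rfl, Nat.cast_one, Real.one_rpow]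
  have hδ_pos : ∀ β : ℝ, (∀ n : ℕ, 1 ≤ n → δ n = (n : ℝ) ^ (-β)) → ∀ᶠ n in atTop, 0 < δ n :=
    fun β h => (eventually_ge_atTop 1).mono fun n hn => by
      rw [h n hn]
      positivity
  have hδ_zero : ∀ β : ℝ, 0 < β → (∀ n : ℕ, 1 ≤ n → δ n = (n : ℝ) ^ (-β)) →
      Tendsto δ atTop (𝓝 0) := fun β hβ h =>
    ((tendsto_rpow_neg_atTop hβ).comp tendsto_natCast_atTop_atTop).congr'
      ((eventually_ge_atTop 1).mono fun n hn => (h n hn).symm)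
  have hδ_sq : ∀ β : ℝ, (∀ n : ℕ, 1 ≤ n → δ n = (n : ℝ) ^ (-β)) → ∀ n : ℕ, 1 ≤ n →
      (n : ℝ) * δ n ^ 2 = (n : ℝ) ^ (1 - 2 * β) := fun β h n hn => by
    have hn0 : (0 : ℝ) < n := by positivity
    rw [h n hn, ← Real.rpow_natCast ((n : ℝ) ^ (-β)) 2, ← Real.rpow_mul hn0.le]
    nth_rewrite 1 [← Real.rpow_one (n : ℝ)]
    rw [← Real.rpow_add hn0]
    congr 1
    push_cast
    ring
  refine ⟨fun hδ hc₁0 hc₂0 hc => ?_, fun α hα0 hα1 hδ hmom hc₁δ hc₂0 hcn hcδ => ?_⟩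
  · refine (hreg.withHighProb_qHatLocal_eq_zero (K := 1) (hδ_one _ hδ) (hδ_pos _ hδ)
      (hδ_zero _ (by norm_num) hδ) ?_ hθ hc₁ hc₂ hτ₀ hτ₁ hc).tendsto_one
    filter_upwards [eventually_ge_atTop 1] with n hn
    rw [hδ_sq _ hδ n hn]
    norm_num
  · refine (hreg.withHighProb_qHatLocal_eq_one (hδ_one _ hδ) (hδ_pos _ hδ) (hδ_zero _ hα0 hδ) ?_ hθ
      hmom hc₁ hc₂ hτ₀ hτ₁ hc₁δ hc₂0 hcn hcδ).tendsto_one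
    refine ((tendsto_rpow_atTop (show 0 < 1 - 2 * α by linarith)).comp
      tendsto_natCast_atTop_atTop).congr' ?_
    filter_upwards [eventually_ge_atTop 1] with n hn
    exact (hδ_sq _ hδ n hn).symm
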